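/- Let $k\ge 0$ and $n\ge 2k+1$, and let $X_{n,k}$ be the set of bitstrings of length $n$ with exactly $k$ many 1s, regarded as cyclic strings (positions modulo $n$). **Cycle factor.** For $x\in X_{n,k}$, match every 1 (opening bracket) with the last 0 (closing bracket) of the shortest cyclic substring that starts at this 1, goes to the right, and contains as many 0s as 1s. Let $f(x)$ be obtained from $x$ by complementing all matched bits, and let $C(x)=(x,f(x),f^2(x),\dots)$. **Motzkin path.** Let $\hat x$ be the bi-infinite $n$-periodic string obtained by repeating $x$. It is drawn as a lattice path in which matched 1s are up-steps, matched 0s are down-steps and unmatched 0s are flat steps, with the flat steps lying on the abscissa. A *hill* is a subpath that is a Dyck word (possibly empty); a *base hill* is a hill that starts and ends on the abscissa. **Gliders.** For a hill $y$, define a set $\Gamma(y)$ of pairs of sets of positions recursively. Set $\Gamma(\varepsilon)=\emptyset$, and $\Gamma(y_1\cdots y_\ell)=\bigcup_i\Gamma(y_i)$ if each $y_i$ has the form $1u0$ with $u$ a Dyck word. If $y=1u0$ with $u$ a Dyck word has height $h$, put $y=10$ if $h=1$, and otherwise decompose it uniquely as $$y=1\,u_1\,1\,u_2\cdots 1\,u_{h-2}\,1\,1\,v_0\,0\,v_1\,0\cdots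 0\,v_{h-2}\,0\,0,$$ where all $u_i$ and all complements $\overline{v_i}$ are Dyck words and the leftmost highest point of $y$ is the point between the last displayed 1 and $v_0$. Then $$\Gamma(y)=\bigcup_{i=1}^{h-2}\Gamma(u_i)\cup\bigcup_{i=0}^{h-2}\Gamma(\overline{v_i})\cup\{(A,B)\},$$ where $A$ and $B$ are the sets of positions (in $\hat x$) of the displayed 1s and of the displayed 0s, respectively. Let $\Gamma(x)$ be the union of $\Gamma(y)$ over all base hills $y$ of $\hat x$. Its elements $\gamma=(A,B)$ are the *gliders* of $x$; the *speed* of $\gamma$ is $v(\gamma)=|A|=|B|$, its first step is at $\min A$ and its last step at $\max B$. Two gliders are equivalent if their sets are the same modulo $n$. The *speed set* $V(x)$ is the multiset of the speeds of the equivalence classes of gliders. **Trains.** Two gliders of the same speed, one to the left of the other, are *coupled* if all steps between the last step of the left one and the first step of the right one belong to gliders of strictly smaller speed. A *train* is a maximal sequence of coupled gliders, and its size is its number of gliders. For a speed $v$ occurring in $V(x)$, let $z_v(x)$ be the sequence, up to cyclic shifts, of the sizes of the trains of speed $v$ from left to right, one train for each class modulo $n$. The *train composition* $Z(x)$ is the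 set of all $v$ in $V(x)$ (without repetition), each together with $z_v(x)$. **Lemma.** Let $x\in X_{n,k}$. Then $V(x)$ is a number partition of $k$, that is, a multiset of positive integers with sum $k$. Moreover, for every vertex $y$ on the cycle $C(x)$ we have $V(y)=V(x)$ and $Z(y)=Z(x)$. -/

import Mathlib

/-!
Bitstrings of length `n` are functions `ZMod n → Bool` (positions are taken modulo `n`), where `true`
is the bit 1.  An infinite bitstring is a function `ℤ → Bool`.  The subpath or substring at the
positions `a, a + 1, …, b - 1` is given by its two endpoints `a ≤ b`; it is empty if `a = b`.
-/

namespace KneserGliders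

/-- The set `X_{n,k}` of bitstrings of length `n` with exactly `k` many 1s. -/
def X (n k : ℕ) : Set (ZMod n → Bool) := {x | {i | x i = true}.ncard = k}

/-- The infinite `n`-periodic string obtained by unrolling the cyclic string `x`. -/
def hat {n : ℕ} (x : ZMod n → Bool) : ℤ → Bool := fun i => x (i : ZMod n)

/-- Number of 1s minus number of 0s among the positions `a, …, b - 1` of `w`. -/
noncomputable def bal (w : ℤ → Bool) (a b : ℤ) : ℤ := ∑ i ∈ Finset.Ico a b, if w i = true then 1 else -1

/-! ### Parenthesis matching and the cycle factor -/

/-- The 1-bit of `w` at position `i` is matched to the 0-bit at position `j`: the substring on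
`[i, j]` is the shortest one starting at `i` that contains as many 0s as 1s. -/
def IsMatch (w : ℤ → Bool) (i j : ℤ) : Prop :=
  i < j ∧ w i = true ∧ bal w i (j + 1) = 0 ∧ ∀ m, i < m → m ≤ j → bal w i m ≠ 0

/-- The step at position `i` is an up-step: a matched 1. -/
def IsUp {n : ℕ} (x : ZMod n → Bool) (i : ℤ) : Prop := ∃ j, IsMatch (hat x) i j

/-- The step at position `i` is a down-step: a matched 0. -/
def IsDown {n : ℕ} (x : ZMod n → Bool) (i : ℤ) : Prop := ∃ j, IsMatch (hat x) j i

/-- The step at position `i` is a flat step: an unmatched 0. -/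
def IsFlat {n : ℕ} (x : ZMod n → Bool) (i : ℤ) : Prop := hat x i = false ∧ ¬ IsDown x i

open Classical in
/-- The map `f` that complements all matched bits of the cyclic string `x`. -/
noncomputable def f {n : ℕ} (x : ZMod n → Bool) : ZMod n → Bool := fun i =>
  if ∃ p : ℤ, (p : ZMod n) = i ∧ (IsUp x p ∨ IsDown x p) then !(x i) else x i

/-- The vertices of the cycle `C(x) = (x, f(x), f²(x), …)`. -/
def cycle {n : ℕ} (x : ZMod n → Bool) : Set (ZMod n → Bool) := {y | ∃ t : ℕ, y = f^[t] x}

/-! ### Motzkin path and hills -/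

open Classical in
/-- The change of the ordinate of the Motzkin path of `x` in step `i`. -/
noncomputable def step {n : ℕ} (x : ZMod n → Bool) (i : ℤ) : ℤ :=
  if IsUp x i then 1 else if IsDown x i then -1 else 0

/-- The infinite Motzkin path of `x`, in which the flat steps lie on the abscissa, is on the abscissa
just before step `a`. -/
def OnAbscissa {n : ℕ} (x : ZMod n → Bool) (a : ℤ) : Prop :=
  ∃ i ≤ a, IsFlat x i ∧ ∑ j ∈ Finset.Ico i a, step x j = 0

/-- The substring of `w` on `[a, b)` is a Dyck word (set `D`). -/
def IsHill (w : ℤ → Bool) (a b : ℤ) : Prop :=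
  a ≤ b ∧ bal w a b = 0 ∧ ∀ j, a ≤ j → j ≤ b → 0 ≤ bal w a j

/-- The substring of `w` on `[a, b)` is `1 u 0` with a Dyck word `u` (set `D'`). -/
def IsPrimeHill (w : ℤ → Bool) (a b : ℤ) : Prop :=
  a < b ∧ bal w a b = 0 ∧ ∀ j, a < j → j < b → 0 < bal w a j

/-- A Dyck subpath of the infinite Motzkin path of `x` that starts and ends on the abscissa. -/
def IsBaseHill {n : ℕ} (x : ZMod n → Bool) (a b : ℤ) : Prop :=
  OnAbscissa x a ∧ IsHill (hat x) a b

/-! ### Glider partition -/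

/-- The pair `(A, B)` of sets of positions of the steps of a glider. -/
abbrev Glider : Type := Finset ℤ × Finset ℤ

/-- The starting position of the `i`-th dent in the decomposition below. -/
def dentStart (h : ℕ) (α β : ℕ → ℤ) (i : ℕ) : ℤ := (if i = 0 then α (h - 1) else β (i - 1)) + 1

/-- The decomposition `1 u₁ 1 u₂ ⋯ 1 u_{h-2} 1 1 v₀ 0 v₁ 0 ⋯ 0 v_{h-2} 0 0` (or `1 0` if `h = 1`) of
the hill of height `h` on `[a, b)` into bulges `uᵢ`, to the left of its leftmost highest point, and
dents `vᵢ`, to the right of it.  The displayed 1s are at `α 0 < ⋯ < α (h-1)`, the displayed 0s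
are at `β 0 < ⋯ < β (h-1)`; the bulge `uᵢ` is on `[α (i-1) + 1, α i)` and the dent `vᵢ` is on
`[dentStart h α β i, β i)`. -/
structure HillDecomp (w : ℤ → Bool) (a b : ℤ) (h : ℕ) (α β : ℕ → ℤ) : Prop where
  prime : IsPrimeHill w a b
  pos : 1 ≤ h
  first : α 0 = a
  last : β (h - 1) = b - 1
  one : ∀ i < h, w (α i) = true
  zero : ∀ i < h, w (β i) = false
  height : bal w a (α (h - 1) + 1) = h
  highest : ∀ j, a ≤ j → j ≤ b → bal w a j ≤ h
  leftmost : ∀ j, a ≤ j → j ≤ α (h - 1) → bal w a j < h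
  bulge : ∀ i, 1 ≤ i → i < h → IsHill w (α (i - 1) + 1) (α i)
  dent : ∀ i < h, IsHill (fun j => !(w j)) (dentStart h α β i) (β i)
  no_last_bulge : 2 ≤ h → α (h - 1) = α (h - 2) + 1
  no_last_dent : β (h - 1) = dentStart h α β (h - 1)

/-- `GliderIn w a b γ` means that `γ ∈ Γ(y)` for the hill `y` of `w` on `[a, b)`: the
recursive computation of the gliders of a hill. -/
inductive GliderIn : (ℤ → Bool) → ℤ → ℤ → Glider → Prop
  | factor {w : ℤ → Bool} {a b c d : ℤ} {γ : Glider} : IsHill w a b → a ≤ c → d ≤ b →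
      bal w a c = 0 → IsPrimeHill w c d → GliderIn w c d γ → GliderIn w a b γ
  | self {w : ℤ → Bool} {a b : ℤ} {h : ℕ} {α β : ℕ → ℤ} : HillDecomp w a b h α β →
      GliderIn w a b ((Finset.range h).image α, (Finset.range h).image β)
  | bulge {w : ℤ → Bool} {a b : ℤ} {h : ℕ} {α β : ℕ → ℤ} {γ : Glider} (i : ℕ) :
      HillDecomp w a b h α β → 1 ≤ i → i + 2 ≤ h →
      GliderIn w (α (i - 1) + 1) (α i) γ → GliderIn w a b γ
  | dent {w : ℤ → Bool} {a b : ℤ} {h : ℕ} {α β : ℕ → ℤ} {γ : Glider} (i : ℕ) :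
      HillDecomp w a b h α β → i + 2 ≤ h →
      GliderIn (fun j => !(w j)) (dentStart h α β i) (β i) γ → GliderIn w a b γ

/-- The set `Γ(x)` of all gliders in the infinite Motzkin path of `x`. -/
def gliders {n : ℕ} (x : ZMod n → Bool) : Set Glider :=
  {γ | ∃ a b, IsBaseHill x a b ∧ GliderIn (hat x) a b γ}

/-- The speed of a glider. -/
def speed (γ : Glider) : ℕ := γ.1.card

/-- Two gliders of `x` are equivalent if their sets are the same modulo `n`. -/
def gliderSetoid {n : ℕ} (x : ZMod n → Bool) : Setoid (gliders x) :=
  Setoid.ker fun γ : gliders x =>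
    ((γ.1.1.image (fun i : ℤ => (i : ZMod n)), γ.1.2.image (fun i : ℤ => (i : ZMod n))) :
      Finset (ZMod n) × Finset (ZMod n))

/-- The set `Γ(x)/∼` of equivalence classes of gliders. -/
abbrev GliderClass {n : ℕ} (x : ZMod n → Bool) : Type := Quotient (gliderSetoid x)

instance {n : ℕ} [NeZero n] (x : ZMod n → Bool) : Finite (GliderClass x) :=
  Finite.of_injective _ (Setoid.kerLift_injective _)

noncomputable instance {n : ℕ} [NeZero n] (x : ZMod n → Bool) : Fintype (GliderClass x) :=
  Fintype.ofFinite _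

/-! Equivalent gliders have the same speed. -/

theorem bal_succ (w : ℤ → Bool) {a b : ℤ} (h : a ≤ b) :
    bal w a (b + 1) = bal w a b + if w b = true then 1 else -1 := by
  unfold bal
  rw [← Finset.insert_Ico_right_eq_Ico_add_one h, Finset.sum_insert (by simp), add_comm]

theorem bal_add (w : ℤ → Bool) {a b c : ℤ} (h : a ≤ b) (h' : b ≤ c) :
    bal w a b + bal w b c = bal w a c := by
  unfold bal
  rw [← Finset.Ico_union_Ico_eq_Ico h h', Finset.sum_union (Finset.Ico_disjoint_Ico_consecutive a b c)]

theorem bal_shift {n : ℕ} (x : ZMod n → Bool) (a b t : ℤ) :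
    bal (hat x) (a + n * t) (b + n * t) = bal (hat x) a b := by
  unfold bal
  rw [← Finset.image_add_right_Ico a b (n * t), Finset.sum_image (by simp)]
  simp [hat]
  rfl

theorem isMatch_shift {n : ℕ} (x : ZMod n → Bool) (i j t : ℤ) (h : IsMatch (hat x) i j) :
    IsMatch (hat x) (i + n * t) (j + n * t) := by
  obtain ⟨h1, h2, h3, h4⟩ := h
  refine ⟨by linarith, by simpa [hat] using h2, ?_, fun m hm hm' => ?_⟩
  · rw [add_right_comm, bal_shift, h3]
  · have := bal_shift x i (m - n * t) t
    rw [sub_add_cancel] at this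
    rw [this]
    exact h4 _ (by linarith) (by linarith)

theorem exists_isMatch_of_isHill {w : ℤ → Bool} {a b i : ℤ} (h : IsHill w a b) (hi : a ≤ i)
    (hib : i < b) (hw : w i = false) : ∃ j, IsMatch w j i := by
  obtain ⟨_, _, hpos⟩ := h
  have hs := bal_succ w hi
  simp only [hw] at hs
  have hs0 := hpos (i + 1) (by linarith) (by linarith)
  obtain ⟨j, ⟨hja, hji, hj⟩, hmax⟩ := Int.exists_greatest_of_bdd
    (P := fun j => a ≤ j ∧ j ≤ i ∧ bal w a j < bal w a i) ⟨i, fun z hz => hz.2.1⟩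
    ⟨a, le_rfl, hi, by simp [bal] at hs hs0 ⊢; linarith⟩
  have hji' : j < i := lt_of_le_of_ne hji (by rintro rfl; exact lt_irrefl _ hj)
  have hge : ∀ m, j < m → m ≤ i → bal w a i ≤ bal w a m := by
    intro m hm hm'
    by_contra hc
    have := hmax m ⟨by linarith, hm', by linarith⟩
    linarith
  have h1 := hge (j + 1) (by linarith) (by linarith)
  have h2 := bal_succ w hja
  have hwj : w j = true := by
    by_contra hc
    simp only [hc] at h2
    simp at h2
    linarith
  simp only [hwj] at h2
  simp at h2 hs
  refine ⟨j, hji', hwj, ?_, fun m hm hm' => ?_⟩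
  · have := bal_add w hja (by linarith : j ≤ i + 1)
    linarith
  · have := bal_add w hja hm.le
    have := hge m hm hm'
    intro h0
    linarith

theorem isBaseHill_length {n : ℕ} [NeZero n] {x : ZMod n → Bool} {a b : ℤ} (h : IsBaseHill x a b) :
    b - a < n := by
  obtain ⟨⟨i, _, ⟨hi0, hi1⟩, _⟩, hh⟩ := h
  by_contra hc
  have hn : (0 : ℤ) < n := by exact_mod_cast Nat.pos_of_ne_zero (NeZero.ne n)
  have e := Int.emod_add_mul_ediv (i - a) n
  have e1 := Int.emod_nonneg (i - a) hn.ne'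
  have e2 := Int.emod_lt_of_pos (i - a) hn
  set q := (i - a) / (n : ℤ)
  obtain ⟨j, hj⟩ := exists_isMatch_of_isHill (i := i + n * (-q)) hh (by linarith) (by linarith)
    (by simpa [hat] using hi0)
  apply hi1
  have := isMatch_shift x _ _ q hj
  refine ⟨j + n * q, ?_⟩
  convert this using 1
  ring

theorem HillDecomp.bounds {w : ℤ → Bool} {a b : ℤ} {h : ℕ} {α β : ℕ → ℤ}
    (H : HillDecomp w a b h α β) :
    (∀ i < h, a ≤ α i ∧ α i < b) ∧ ∀ i < h, a ≤ dentStart h α β i ∧ β i < b := by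
  have hpos := H.pos
  have hα : ∀ i < h, a ≤ α i := by
    intro i
    induction i with
    | zero => intro _; exact H.first.ge
    | succ i ih =>
      intro hi
      have := (H.bulge (i + 1) (by omega) hi).1
      have := ih (by omega)
      simp at *
      linarith
  have hα' : ∀ d, ∀ i, i + d = h - 1 → α i ≤ α (h - 1) := by
    intro d
    induction d with
    | zero => intro i hi; simp at hi; rw [hi]
    | succ d ih =>
      intro i hi
      have := (H.bulge (i + 1) (by omega) (by omega)).1
      have := ih (i + 1) (by omega)
      simp at *
      linarith
  have hβ' : ∀ d, ∀ i, i + d = h - 1 → β i ≤ β (h - 1) := by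
    intro d
    induction d with
    | zero => intro i hi; simp at hi; rw [hi]
    | succ d ih =>
      intro i hi
      have := (H.dent (i + 1) (by omega)).1
      have := ih (i + 1) (by omega)
      simp [dentStart] at *
      linarith
  have h0 := (H.dent 0 (by omega)).1
  simp [dentStart] at h0
  have hβ0 : ∀ i < h, β 0 ≤ β i := by
    intro i
    induction i with
    | zero => intro _; rfl
    | succ i ih =>
      intro hi
      have := (H.dent (i + 1) hi).1
      have := ih (by omega)
      simp [dentStart] at *
      linarith
  have hl := H.last
  refine ⟨fun i hi => ⟨hα i hi, ?_⟩, fun i hi => ⟨?_, ?_⟩⟩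
  · have := hα' (h - 1 - i) i (by omega)
    have := hβ0 (h - 1) (by omega)
    linarith
  · have h1 := hα (h - 1) (by omega)
    unfold dentStart
    split_ifs
    · linarith
    · have := hβ0 (i - 1) (by omega)
      linarith
  · have := hβ' (h - 1 - i) i (by omega)
    linarith

theorem GliderIn.subset {w : ℤ → Bool} {a b : ℤ} {γ : Glider} (h : GliderIn w a b γ) :
    ∀ p ∈ γ.1, a ≤ p ∧ p < b := by
  induction h with
  | factor _ h1 h2 _ _ _ ih =>
    intro p hp
    have := ih p hp
    exact ⟨by linarith, by linarith⟩
  | self H =>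
    intro p hp
    simp only [Finset.mem_image, Finset.mem_range] at hp
    obtain ⟨i, hi, rfl⟩ := hp
    exact H.bounds.1 i hi
  | bulge i H h1 h2 _ ih =>
    intro p hp
    have := ih p hp
    have := H.bounds.1 i (by omega)
    have := H.bounds.1 (i - 1) (by omega)
    exact ⟨by linarith, by linarith⟩
  | dent i H h2 _ ih =>
    intro p hp
    have := ih p hp
    have := H.bounds.2 i (by omega)
    exact ⟨by linarith, by linarith⟩

theorem card_image_of_mem_gliders {n : ℕ} [NeZero n] {x : ZMod n → Bool} {γ : Glider}
    (h : γ ∈ gliders x) : (γ.1.image (fun i : ℤ => (i : ZMod n))).card = speed γ := by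
  obtain ⟨a, b, hb, hγ⟩ := h
  have hl := isBaseHill_length hb
  refine Finset.card_image_of_injOn fun p hp q hq hpq => ?_
  have h1 := hγ.subset p hp
  have h2 := hγ.subset q hq
  obtain ⟨c, hc⟩ := (ZMod.intCast_eq_intCast_iff_dvd_sub p q n).1 hpq
  have hn : (0 : ℤ) < n := by exact_mod_cast Nat.pos_of_ne_zero (NeZero.ne n)
  have : c = 0 := by
    by_contra h0
    rcases lt_or_gt_of_ne h0 with h | h <;> nlinarith
  subst this
  linarith

/-- The common speed of the gliders in an equivalence class. -/
def classSpeed {n : ℕ} [NeZero n] {x : ZMod n → Bool} : GliderClass x → ℕ :=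
  Quotient.lift (fun γ : gliders x => speed γ.1) fun γ γ' h => by
    have e := congrArg (fun s => s.1.card) (Setoid.ker_def.1 h)
    simp only [card_image_of_mem_gliders γ.2, card_image_of_mem_gliders γ'.2] at e
    exact e

/-- The speed set `V(x)`, a multiset with one element for each class of gliders. -/
noncomputable def V {n : ℕ} [NeZero n] (x : ZMod n → Bool) : Multiset ℕ :=
  (Finset.univ : Finset (GliderClass x)).val.map classSpeed

/-! ### Trains -/

/-- The gliders `γ` and `γ'` of `x`, with `γ` to the left of `γ'`, are coupled: they have
the same speed and all steps between the last step of `γ` and the first step of `γ'` belong to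
gliders of strictly smaller speed. -/
def Coupled {n : ℕ} (x : ZMod n → Bool) (γ γ' : Glider) : Prop :=
  γ ∈ gliders x ∧ γ' ∈ gliders x ∧ speed γ = speed γ' ∧
    ∃ p q : ℤ, IsGreatest (γ.2 : Set ℤ) p ∧ IsLeast (γ'.1 : Set ℤ) q ∧ p < q ∧
      ∀ i, p < i → i < q → ∃ δ ∈ gliders x, (i ∈ δ.1 ∨ i ∈ δ.2) ∧ speed δ < speed γ

/-- The train of the glider `γ`: the maximal sequence of coupled gliders that contains `γ`. -/
def train {n : ℕ} (x : ZMod n → Bool) (γ : Glider) : Set Glider :=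
  {γ' | Relation.EqvGen (Coupled x) γ γ'}

/-- `γ` is the leftmost glider of a train of gliders of speed `v`, and its first step is at `p`. -/
def IsHead {n : ℕ} (x : ZMod n → Bool) (v : ℕ) (p : ℤ) (γ : Glider) : Prop :=
  γ ∈ gliders x ∧ speed γ = v ∧ IsLeast (γ.1 : Set ℤ) p ∧ ¬ ∃ γ', Coupled x γ' γ

/-- The size of the train of speed `v` whose first step is at position `p`. -/
noncomputable def trainSize {n : ℕ} (x : ZMod n → Bool) (v : ℕ) (p : ℤ) : ℕ :=
  {γ' | ∃ γ, IsHead x v p γ ∧ γ' ∈ train x γ}.ncard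

open Classical in
/-- The sizes of the trains of speed `v` from left to right, one for each equivalence class of trains
modulo `n` (the one starting at a position in `1, …, n`), up to cyclic shifts. -/
noncomputable def trainSizes {n : ℕ} (x : ZMod n → Bool) (v : ℕ) : Cycle ℕ :=
  ((((Finset.Icc (1 : ℤ) n).filter fun p => ∃ γ, IsHead x v p γ).sort (· ≤ ·)).map
    (trainSize x v) : List ℕ)

/-- The train composition `Z(x)`: each speed `v` in `V(x)` (without repetition) together with the
cyclic composition formed by the sizes of the trains of speed `v`. -/
noncomputable def Z {n : ℕ} [NeZero n] (x : ZMod n → Bool) : Set (ℕ × Cycle ℕ) :=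
  {z | z.1 ∈ V x ∧ z.2 = trainSizes x z.1}

end KneserGliders

namespace KneserGliders

/-! ### Balances and flat steps -/

/-! A carrier with seats 0, 1, 2, … reads the string from right to left and restarts empty at every
unmatched 0: a 0 takes the lowest empty seat, a 1 frees the lowest occupied one. `seat n w p` is the
seat that changes at `p`, with value `n` at unmatched 0s. These numbers display the recursive glider
partition: the steps of a glider of speed v have seats v-1, …, 0, v-1, …, 0, and every step between
two successive ones has a seat below that of the right one (`HillDecomp.seats`,
`GliderIn.exists_isChain`).

Fix v; call a step with seat v-1 a mark and a step with seat at least v a slot. A glider of speed v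
has two marks, with opposite bits and no slot between them. In a maximal stretch without slots the
bits of the marks alternate, and the marks are paired from the right into gliders of speed v; a mark
left over on the left belongs to a faster glider (`isFirst_iff`, `mem_glider_iff`). Two gliders of
speed v are in the same train exactly if no slot separates them (`coupled_iff`,
`mem_train_of_noSlot`, `noSlot_of_mem_train`). So speeds and train sizes can be read off from seats
and bits.

The 1s of f(x) are the matched 0s of x. The carriers of x and f(x) are almost complementary
(`Evolves.linked`), and at every 1 of f(x) they change the same seat (`Evolves.seat_eq`). Hence the
marks with bit 0 in x are the marks with bit 1 in f(x). A glider of speed v has exactly one mark of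
each bit, so it suffices that such a common mark belongs to a glider of speed v in x if and only if
it does in f(x) (`Evolves.gliderMarks_eq`), and that two common marks are separated by a slot in
both strings or in neither (`Evolves.noSlot_iff`).

The speeds add up to k because a glider of speed v contains v of the 1s and every 1 lies in exactly
one class of gliders (`sum_V`). -/

theorem bal_self (w : ℤ → Bool) (a : ℤ) : bal w a a = 0 := by simp [bal]

theorem bal_compl (w : ℤ → Bool) (a b : ℤ) : bal (fun j => !(w j)) a b = -bal w a b := by
  unfold bal
  rw [← Finset.sum_neg_distrib]
  refine Finset.sum_congr rfl fun i _ => ?_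
  cases h : w i <;> simp [h]

theorem bal_succ_true {w : ℤ → Bool} {a b : ℤ} (h : a ≤ b) (hw : w b = true) :
    bal w a (b + 1) = bal w a b + 1 := by rw [bal_succ w h, if_pos hw]

theorem bal_succ_false {w : ℤ → Bool} {a b : ℤ} (h : a ≤ b) (hw : w b = false) :
    bal w a (b + 1) = bal w a b - 1 := by rw [bal_succ w h, if_neg (by simp [hw])]; rfl

theorem bal_succ_cases (w : ℤ → Bool) {a b : ℤ} (h : a ≤ b) :
    (w b = true ∧ bal w a (b + 1) = bal w a b + 1) ∨
      (w b = false ∧ bal w a (b + 1) = bal w a b - 1) := by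
  cases hw : w b
  · exact Or.inr ⟨rfl, bal_succ_false h hw⟩
  · exact Or.inl ⟨rfl, bal_succ_true h hw⟩

theorem bal_single (w : ℤ → Bool) (a : ℤ) :
    (w a = true ∧ bal w a (a + 1) = 1) ∨ (w a = false ∧ bal w a (a + 1) = -1) := by
  have := bal_succ_cases w (le_refl a)
  rw [bal_self] at this
  simpa using this

theorem bal_le_length (w : ℤ → Bool) {a b : ℤ} (h : a ≤ b) : bal w a b ≤ b - a := by
  induction b, h using Int.leInduction with
  | base => simp [bal_self]
  | succ b hb ih => rcases bal_succ_cases w hb with ⟨_, h⟩ | ⟨_, h⟩ <;> omega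

/-- The step of `w` at `p` is an unmatched 0. -/
def Flat (w : ℤ → Bool) (p : ℤ) : Prop := ∀ a ≤ p, bal w a (p + 1) < 0

theorem Flat.bit {w : ℤ → Bool} {p : ℤ} (h : Flat w p) : w p = false := by
  have h1 := h p le_rfl
  rcases bal_single w p with h | h
  · omega
  · exact h.1

theorem IsMatch.bal_pos {w : ℤ → Bool} {i j : ℤ} (h : IsMatch w i j) {m : ℤ} (hm : i < m)
    (hmj : m ≤ j) : 0 < bal w i m := by
  obtain ⟨_, h2, _, h4⟩ := h
  have hm' : i + 1 ≤ m := hm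
  induction m, hm' using Int.leInduction with
  | base => rcases bal_single w i with h | h <;> simp_all
  | succ m hm ih =>
    have h0 := h4 (m + 1) (by omega) hmj
    have := ih (by omega) (by omega)
    rcases bal_succ_cases w (by omega : i ≤ m) with ⟨_, h⟩ | ⟨_, h⟩ <;> omega

theorem IsMatch.right_bit {w : ℤ → Bool} {i j : ℤ} (h : IsMatch w i j) : w j = false := by
  have h1 := h.bal_pos h.1 le_rfl
  have h2 := h.2.2.1
  rcases bal_succ_cases w h.1.le with h | h
  · omega
  · exact h.1

/-- A 0 at `p` that is not flat is matched to the last start `j` from which the substring up to `p`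
contains at least as many 1s as 0s. -/
theorem flat_iff {w : ℤ → Bool} {p : ℤ} : Flat w p ↔ w p = false ∧ ¬ ∃ j, IsMatch w j p := by
  constructor
  · rintro h
    refine ⟨h.bit, ?_⟩
    rintro ⟨j, hj⟩
    have := h j hj.1.le
    have := hj.2.2.1
    omega
  · rintro ⟨h0, h1⟩ a ha
    by_contra hc
    apply h1
    obtain ⟨j, ⟨hjp, hj⟩, hmax⟩ := Int.exists_greatest_of_bdd
      (P := fun j => j ≤ p ∧ 0 ≤ bal w j (p + 1)) ⟨p, fun z hz => hz.1⟩ ⟨a, ha, by omega⟩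
    have hlt : ∀ m, j < m → m ≤ p → bal w m (p + 1) < 0 := by
      intro m hm hmp
      by_contra hc
      have := hmax m ⟨hmp, by omega⟩
      omega
    have hjp' : j < p := by
      rcases hjp.lt_or_eq with h | rfl
      · exact h
      · rcases bal_single w j with h | h
        · simp_all
        · omega
    have h2 := hlt (j + 1) (by omega) (by omega)
    have h3 := bal_add w (by omega : j ≤ j + 1) (by omega : j + 1 ≤ p + 1)
    rcases bal_single w j with h | h
    · refine ⟨j, hjp', h.1, by omega, fun m hm hmp => ?_⟩
      have := hlt m hm hmp
      have := bal_add w hm.le (by omega : m ≤ p + 1)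
      omega
    · omega

theorem isFlat_iff {n : ℕ} {x : ZMod n → Bool} {p : ℤ} : IsFlat x p ↔ Flat (hat x) p :=
  flat_iff.symm

theorem isDown_iff {n : ℕ} {x : ZMod n → Bool} {p : ℤ} :
    IsDown x p ↔ hat x p = false ∧ ¬ Flat (hat x) p := by
  rw [flat_iff]
  constructor
  · intro h
    exact ⟨h.choose_spec.right_bit, fun h' => h'.2 h⟩
  · rintro ⟨h, h'⟩
    by_contra hc
    exact h' ⟨h, hc⟩

theorem exists_isMatch_of_drift {w : ℤ → Bool} {i b : ℤ} (hw : w i = true) (hib : i ≤ b)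
    (hb : bal w i b < 0) : ∃ j, IsMatch w i j := by
  obtain ⟨m, ⟨him, hm⟩, hmin⟩ := Int.exists_least_of_bdd
    (P := fun m => i < m ∧ bal w i m ≤ 0) ⟨i, fun z hz => hz.1.le⟩
    ⟨b, lt_of_le_of_ne hib (by rintro rfl; simp [bal_self] at hb), hb.le⟩
  have hpos : ∀ z, i < z → z < m → 0 < bal w i z := by
    intro z hz hzm
    by_contra hc
    have := hmin z ⟨hz, by omega⟩
    omega
  have h1 : i + 1 < m := by
    rcases (show i + 1 ≤ m from him).lt_or_eq with h | rfl
    · exact h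
    · rcases bal_single w i with h | h
      · omega
      · simp_all
  have h2 := hpos (m - 1) (by omega) (by omega)
  have h3 := bal_succ_cases w (by omega : i ≤ m - 1)
  rw [sub_add_cancel] at h3
  refine ⟨m - 1, by omega, hw, ?_, fun z hz hzm => (hpos z hz (by omega)).ne'⟩
  rw [sub_add_cancel]
  omega

/-! ### Periodic strings with more 0s than 1s -/

/-- The infinite string obtained from a cyclic string of length `n` with more 0s than 1s. -/
structure Drift (n : ℕ) (w : ℤ → Bool) : Prop where
  pos : 0 < n
  periodic : ∀ i, w (i + n) = w i
  bal_lt : ∀ a, bal w a (a + n) < 0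

theorem Drift.periodic_mul {n : ℕ} {w : ℤ → Bool} (h : Drift n w) (i t : ℤ) :
    w (i + n * t) = w i := by
  induction t with
  | zero => simp
  | succ t ih =>
    have := h.periodic (i + n * t)
    rw [← ih, ← this]
    congr 1
    ring
  | pred t ih =>
    have := h.periodic (i + n * (-t - 1))
    rw [← ih, ← this]
    congr 1
    ring

theorem Drift.bal_shift {n : ℕ} {w : ℤ → Bool} (h : Drift n w) (a b t : ℤ) :
    bal w (a + n * t) (b + n * t) = bal w a b := by
  unfold bal
  rw [← Finset.image_add_right_Ico a b (n * t), Finset.sum_image (by simp)]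
  simp [h.periodic_mul]

theorem Drift.flat_add {n : ℕ} {w : ℤ → Bool} (h : Drift n w) {p : ℤ} (t : ℤ) (hp : Flat w p) :
    Flat w (p + n * t) := by
  intro a ha
  have := hp (a - n * t) (by omega)
  rwa [← h.bal_shift _ _ t, sub_add_cancel, add_right_comm] at this

theorem Drift.flat_add_iff {n : ℕ} {w : ℤ → Bool} (h : Drift n w) {p : ℤ} (t : ℤ) :
    Flat w (p + n * t) ↔ Flat w p := by
  refine ⟨fun hp => ?_, h.flat_add t⟩
  have := h.flat_add (-t) hp
  rwa [mul_neg, add_neg_cancel_right] at this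

/-- Cycle lemma: the step that ends at the leftmost minimum of the path over one period is flat,
since the path is strictly higher at all earlier points. -/
theorem Drift.exists_flat {n : ℕ} {w : ℤ → Bool} (h : Drift n w) : ∃ p, Flat w p := by
  have hn : (0 : ℤ) < n := by exact_mod_cast h.pos
  obtain ⟨q₀, hq₀, hmin₀⟩ := Finset.exists_min_image (Finset.Icc (1 : ℤ) n) (fun m => bal w 1 m)
    ⟨1, by simp; omega⟩
  obtain ⟨q, ⟨hq, hqb⟩, hleft⟩ := Int.exists_least_of_bdd
    (P := fun q => q ∈ Finset.Icc (1 : ℤ) n ∧ bal w 1 q ≤ bal w 1 q₀)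
    ⟨1, fun z hz => (Finset.mem_Icc.1 hz.1).1⟩ ⟨q₀, hq₀, le_rfl⟩
  simp only [Finset.mem_Icc] at *
  -- `t` is the number of periods by which `a` must move to the right to reach the window `1, …, n`.
  have key : ∀ t : ℕ, ∀ a : ℤ, 1 ≤ a + n * t → a + n * t ≤ n → a < q → bal w a q < 0 := by
    intro t
    induction t with
    | zero =>
      intro a ha han haq
      simp at ha han
      have h1 := bal_add w ha haq.le
      have h2 := hmin₀ a ⟨ha, by omega⟩
      by_contra hc
      have := hleft a ⟨⟨ha, han⟩, by omega⟩
      omega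
    | succ t ih =>
      intro a ha han haq
      push_cast at ha han
      rcases lt_or_ge (a + n) q with h1 | h1
      · have := ih (a + n) (by linarith) (by linarith) h1
        have := bal_add w (by omega : a ≤ a + n) h1.le
        have := h.bal_lt a
        omega
      · have h0 : t = 0 := by
          by_contra h0
          have : (1 : ℤ) ≤ t := by omega
          nlinarith
        subst h0
        simp at ha han
        have h2 := bal_add w (by omega : (1 : ℤ) ≤ q) h1
        have h3 := hmin₀ (a + n) ⟨ha, by omega⟩
        have h4 := bal_add w haq.le h1
        have := h.bal_lt a
        omega
  refine ⟨q - 1, fun a ha => ?_⟩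
  rw [sub_add_cancel]
  have e := Int.emod_add_mul_ediv (a - 1) n
  have e1 := Int.emod_nonneg (a - 1) hn.ne'
  have e2 := Int.emod_lt_of_pos (a - 1) hn
  have hd : (a - 1) / (n : ℤ) ≤ 0 := by
    by_contra hc
    have : (1 : ℤ) ≤ (a - 1) / n := by omega
    nlinarith
  refine key (-((a - 1) / (n : ℤ))).toNat a ?_ ?_ (by omega)
  all_goals
    rw [Int.toNat_of_nonneg (by omega), mul_neg]
    omega

theorem Drift.exists_flat_ge {n : ℕ} {w : ℤ → Bool} (h : Drift n w) (a : ℤ) :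
    ∃ p, a ≤ p ∧ Flat w p := by
  obtain ⟨p, hp⟩ := h.exists_flat
  have hn : (0 : ℤ) < n := by exact_mod_cast h.pos
  refine ⟨p + n * |a - p|, ?_, h.flat_add _ hp⟩
  have := le_abs_self (a - p)
  have := abs_nonneg (a - p)
  nlinarith

theorem Drift.exists_flat_lt {n : ℕ} {w : ℤ → Bool} (h : Drift n w) (a : ℤ) :
    ∃ p, p < a ∧ Flat w p := by
  obtain ⟨p, hp⟩ := h.exists_flat
  have hn : (0 : ℤ) < n := by exact_mod_cast h.pos
  refine ⟨p + n * (-(|a - p| + 1)), ?_, h.flat_add _ hp⟩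
  have := neg_abs_le (a - p)
  have := abs_nonneg (a - p)
  nlinarith

theorem Drift.exists_nextFlat {n : ℕ} {w : ℤ → Bool} (h : Drift n w) (a : ℤ) :
    ∃ r, a ≤ r ∧ Flat w r ∧ ∀ p, a ≤ p → p < r → ¬ Flat w p := by
  obtain ⟨r, ⟨h1, h2⟩, h3⟩ := Int.exists_least_of_bdd (P := fun r => a ≤ r ∧ Flat w r)
    ⟨a, fun z hz => hz.1⟩ (h.exists_flat_ge a)
  refine ⟨r, h1, h2, fun p hp hpr hf => ?_⟩
  have := h3 p ⟨hp, hf⟩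
  omega

theorem Drift.exists_prevFlat {n : ℕ} {w : ℤ → Bool} (h : Drift n w) (a : ℤ) :
    ∃ q, q < a ∧ Flat w q ∧ ∀ p, q < p → p < a → ¬ Flat w p := by
  obtain ⟨q, ⟨h1, h2⟩, h3⟩ := Int.exists_greatest_of_bdd (P := fun q => q < a ∧ Flat w q)
    ⟨a, fun z hz => hz.1.le⟩ (h.exists_flat_lt a)
  refine ⟨q, h1, h2, fun p hp hpr hf => ?_⟩
  have := h3 p ⟨hpr, hf⟩
  omega

/-- Consecutive flat steps. -/
def FlatPair (w : ℤ → Bool) (q r : ℤ) : Prop :=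
  q < r ∧ Flat w q ∧ Flat w r ∧ ∀ p, q < p → p < r → ¬ Flat w p

theorem Drift.exists_flatPair {n : ℕ} {w : ℤ → Bool} (h : Drift n w) {p : ℤ} (hp : ¬ Flat w p) :
    ∃ q r, FlatPair w q r ∧ q < p ∧ p < r := by
  obtain ⟨r, h1, h2, h3⟩ := h.exists_nextFlat p
  obtain ⟨q, h4, h5, h6⟩ := h.exists_prevFlat p
  have : r ≠ p := by rintro rfl; exact hp h2
  refine ⟨q, r, ⟨by omega, h5, h2, fun p' hp' hp'' => ?_⟩, h4, by omega⟩
  rcases lt_or_ge p' p with h | h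
  · exact h6 p' hp' h
  · exact h3 p' h hp''

/-- The first point where the balance from `q + 1` is negative would end a flat step: for starts up
to `q`, flatness of `q` contributes the rest of the negative balance. -/
theorem bal_nonneg_of_no_flat {w : ℤ → Bool} {q r : ℤ} (hq : Flat w q)
    (h : ∀ p, q < p → p < r → ¬ Flat w p) {j : ℤ} (hj : q < j) (hjr : j ≤ r) :
    0 ≤ bal w (q + 1) j := by
  by_contra hc
  obtain ⟨m, ⟨hm1, hm2⟩, hmin⟩ := Int.exists_least_of_bdd
    (P := fun m => q < m ∧ bal w (q + 1) m < 0) ⟨q, fun z hz => hz.1.le⟩ ⟨j, hj, by omega⟩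
  have hpos : ∀ z, q < z → z < m → 0 ≤ bal w (q + 1) z := by
    intro z hz hzm
    by_contra hc
    have := hmin z ⟨hz, by omega⟩
    omega
  have hmj := hmin j ⟨hj, by omega⟩
  have hm3 : m ≠ q + 1 := by rintro rfl; simp [bal_self] at hm2
  refine h (m - 1) (by omega) (by omega) fun a ha => ?_
  rw [sub_add_cancel]
  rcases lt_or_ge q a with h1 | h1
  · have := hpos a h1 (by omega)
    have := bal_add w (by omega : q + 1 ≤ a) (by omega : a ≤ m)
    omega
  · have := hq a h1
    have := bal_add w (by omega : a ≤ q + 1) (by omega : q + 1 ≤ m)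
    omega

theorem FlatPair.isHill {w : ℤ → Bool} {q r : ℤ} (h : FlatPair w q r) : IsHill w (q + 1) r := by
  obtain ⟨h1, h2, h3, h4⟩ := h
  have hnn : ∀ j, q < j → j ≤ r → 0 ≤ bal w (q + 1) j :=
    fun j => bal_nonneg_of_no_flat h2 h4
  refine ⟨by omega, ?_, fun j hj => hnn j (by omega)⟩
  have h5 := h3 (q + 1)
  have h6 := hnn r h1 le_rfl
  have := h5 (by omega)
  rcases bal_succ_cases w (by omega : q + 1 ≤ r) with h | h <;> omega

theorem IsHill.not_flat {w : ℤ → Bool} {a b p : ℤ} (h : IsHill w a b) (ha : a ≤ p) (hb : p < b) :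
    ¬ Flat w p := by
  intro hf
  have := hf a ha
  have := h.2.2 (p + 1) (by omega) (by omega)
  omega

theorem IsHill.tail {w : ℤ → Bool} {a b c : ℤ} (h : IsHill w a b) (hac : a ≤ c) (hcb : c ≤ b)
    (h0 : bal w a c = 0) : IsHill w c b := by
  have := bal_add w hac hcb
  refine ⟨hcb, by have := h.2.1; omega, fun j hj hjb => ?_⟩
  have := h.2.2 j (by omega) hjb
  have := bal_add w hac hj
  omega

/-! ### The carrier with numbered seats -/

/-- The carrier reads the string `w` from right to left; `S p` tells which of its seats are occupied
after it has read the bit at position `p`.  A 0 occupies the lowest empty seat, and a 1 empties the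
lowest occupied seat; this seat is `σ p`. -/
def SeatRule (w : ℤ → Bool) (S : ℤ → ℕ → Bool) (σ : ℤ → ℕ) (p : ℤ) : Prop :=
  σ p = sInf {j | S (p + 1) j = w p} ∧ S p = Function.update (S (p + 1)) (σ p) (!(w p))

/-- The rule is symmetric under exchanging the two bits together with occupied and empty seats. This
allows dents to be treated as hills. -/
theorem SeatRule.compl {w : ℤ → Bool} {S : ℤ → ℕ → Bool} {σ : ℤ → ℕ} {p : ℤ}
    (h : SeatRule w S σ p) : SeatRule (fun j => !(w j)) (fun p j => !(S p j)) σ p := by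
  refine ⟨by simpa using h.1, ?_⟩
  funext j
  have := congrFun h.2 j
  rcases eq_or_ne j (σ p) with rfl | hj
  · simp_all
  · simp_all

theorem SeatRule.below {w : ℤ → Bool} {S : ℤ → ℕ → Bool} {σ : ℤ → ℕ} {p : ℤ}
    (h : SeatRule w S σ p) {j : ℕ} (hj : j < σ p) : S (p + 1) j = !(w p) := by
  rw [h.1] at hj
  have := Nat.notMem_of_lt_sInf hj
  simp only [Set.mem_ofPred_eq] at this
  cases h1 : S (p + 1) j <;> cases h2 : w p <;> simp_all

theorem SeatRule.seat {w : ℤ → Bool} {S : ℤ → ℕ → Bool} {σ : ℤ → ℕ} {p : ℤ}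
    (h : SeatRule w S σ p) {j : ℕ} (hj : S (p + 1) j = w p) :
    S (p + 1) (σ p) = w p ∧ σ p ≤ j := by
  have h1 := Nat.sInf_mem (s := {j | S (p + 1) j = w p}) ⟨j, hj⟩
  rw [← h.1] at h1
  exact ⟨h1, by rw [h.1]; exact Nat.sInf_le hj⟩

theorem SeatRule.seat_eq {w : ℤ → Bool} {S : ℤ → ℕ → Bool} {σ : ℤ → ℕ} {p : ℤ}
    (h : SeatRule w S σ p) {j : ℕ} (hj : S (p + 1) j = w p)
    (hlt : ∀ i < j, S (p + 1) i = !(w p)) : σ p = j := by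
  have h1 := h.seat hj
  refine le_antisymm h1.2 (not_lt.1 fun hc => ?_)
  have h2 := hlt _ hc
  rw [h1.1] at h2
  simp at h2

theorem SeatRule.new {w : ℤ → Bool} {S : ℤ → ℕ → Bool} {σ : ℤ → ℕ} {p : ℤ}
    (h : SeatRule w S σ p) : S p (σ p) = !(w p) := by simp [h.2]

theorem SeatRule.other {w : ℤ → Bool} {S : ℤ → ℕ → Bool} {σ : ℤ → ℕ} {p : ℤ}
    (h : SeatRule w S σ p) {j : ℕ} (hj : j ≠ σ p) : S p j = S (p + 1) j := by
  rw [h.2, Function.update_of_ne hj]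

/-- The number of occupied seats among the first `h` ones. -/
def occupied (h : ℕ) (s : ℕ → Bool) : ℕ := ((Finset.range h).filter fun j => s j = true).card

theorem exists_of_occupied_lt {h : ℕ} {s : ℕ → Bool} (hs : occupied h s < h) :
    ∃ j < h, s j = false := by
  by_contra! hc
  have : (Finset.range h).filter (fun j => s j = true) = Finset.range h :=
    Finset.filter_true_of_mem fun j hj => by simpa using hc j (Finset.mem_range.1 hj)
  rw [occupied, this, Finset.card_range] at hs
  exact lt_irrefl _ hs

theorem exists_of_occupied_pos {h : ℕ} {s : ℕ → Bool} (hs : 0 < occupied h s) :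
    ∃ j < h, s j = true := by
  obtain ⟨j, hj⟩ := Finset.card_pos.1 hs
  exact ⟨j, by simpa using hj⟩

theorem occupied_update_true {h j : ℕ} {s : ℕ → Bool} (hj : j < h) (hs : s j = false) :
    occupied h (Function.update s j true) = occupied h s + 1 := by
  unfold occupied
  rw [← Finset.card_insert_of_notMem (a := j) (by simp [hs])]
  congr 1
  ext i
  rcases eq_or_ne i j with rfl | hi
  · simp [hj]
  · simp [hi]

theorem occupied_update_false {h j : ℕ} {s : ℕ → Bool} (hj : j < h) (hs : s j = true) :
    occupied h (Function.update s j false) + 1 = occupied h s := by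
  have := occupied_update_true (s := Function.update s j false) hj (by simp)
  rw [← this]
  congr 1
  funext i
  rcases eq_or_ne i j with rfl | hi
  · simp [hs]
  · simp [hi]

theorem occupied_eq_zero {h : ℕ} {s : ℕ → Bool} :
    occupied h s = 0 ↔ ∀ j < h, s j = false := by
  simp [occupied, Finset.filter_eq_empty_iff]

/-- From right to left, the first `h` seats hold as many passengers as there are 0s in excess of 1s
among the bits read, which is `bal w a p`. This lies between 0 and `h`, so every bit finds a
suitable seat below `h`, the default value of `sInf` never occurs, and higher seats stay untouched.
-/
theorem IsHill.seats_aux {w : ℤ → Bool} {S : ℤ → ℕ → Bool} {σ : ℤ → ℕ} {a b : ℤ} {h : ℕ}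
    (hH : IsHill w a b) (hR : ∀ p, a ≤ p → p < b → SeatRule w S σ p)
    (hh : ∀ j, a ≤ j → j ≤ b → bal w a j ≤ h) (he : ∀ j < h, S b j = false) {p : ℤ}
    (hp : p ≤ b) (hap : a ≤ p) :
    (occupied h (S p) : ℤ) = bal w a p ∧ (∀ j, h ≤ j → S p j = S b j) ∧
      (p < b → S (p + 1) (σ p) = w p ∧ σ p < h) := by
  induction p, hp using Int.leInductionDown with
  | base => exact ⟨by rw [hH.2.1, occupied_eq_zero.2 he]; rfl, fun _ _ => rfl, fun h => by omega⟩
  | pred p hp ih =>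
    obtain ⟨h1, h2, -⟩ := ih (by omega)
    have hr := hR (p - 1) hap (by omega)
    have hb := bal_succ_cases w hap
    have hb1 := hh (p - 1) hap (by omega)
    have hb2 := hH.2.2 (p - 1) hap (by omega)
    have key : ∃ j < h, S p j = w (p - 1) := by
      rw [sub_add_cancel] at hb
      rcases hb with ⟨hw, hb⟩ | ⟨hw, hb⟩
      · rw [hw]
        exact exists_of_occupied_pos (by omega)
      · rw [hw]
        exact exists_of_occupied_lt (by omega)
    obtain ⟨j, hj, hjw⟩ := key
    have hs := hr.seat (j := j) (by rwa [sub_add_cancel])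
    have hσ : σ (p - 1) < h := by omega
    have hr2 := hr.2
    rw [sub_add_cancel] at *
    refine ⟨?_, fun i hi => ?_, fun _ => ⟨hs.1, hσ⟩⟩
    · rw [hr2]
      rcases hb with ⟨hw, hb⟩ | ⟨hw, hb⟩
      · rw [hw] at hs ⊢
        have := occupied_update_false hσ hs.1
        simp only [Bool.not_true]
        omega
      · rw [hw] at hs ⊢
        have := occupied_update_true hσ hs.1
        simp only [Bool.not_false]
        omega
    · rw [hr2, Function.update_of_ne (by omega), h2 i hi]

theorem IsHill.seat_lt {w : ℤ → Bool} {S : ℤ → ℕ → Bool} {σ : ℤ → ℕ} {a b : ℤ} {h : ℕ}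
    (hH : IsHill w a b) (hR : ∀ p, a ≤ p → p < b → SeatRule w S σ p)
    (hh : ∀ j, a ≤ j → j ≤ b → bal w a j ≤ h) (he : ∀ j < h, S b j = false) {p : ℤ}
    (hap : a ≤ p) (hp : p < b) : S (p + 1) (σ p) = w p ∧ σ p < h :=
  (hH.seats_aux hR hh he hp.le hap).2.2 hp

theorem IsHill.state_eq {w : ℤ → Bool} {S : ℤ → ℕ → Bool} {σ : ℤ → ℕ} {a b : ℤ} {h : ℕ}
    (hH : IsHill w a b) (hR : ∀ p, a ≤ p → p < b → SeatRule w S σ p)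
    (hh : ∀ j, a ≤ j → j ≤ b → bal w a j ≤ h) (he : ∀ j < h, S b j = false) : S a = S b := by
  have h1 := hH.seats_aux hR hh he hH.1 le_rfl
  funext j
  rcases lt_or_ge j h with hj | hj
  · rw [he j hj]
    rw [bal_self] at h1
    exact occupied_eq_zero.1 (by omega) j hj
  · exact h1.2.1 j hj

/-! ### The carrier of a periodic string -/

/-- The carrier that has read `m` bits to the left of the flat step `r`. -/
noncomputable def carrier (w : ℤ → Bool) (r : ℤ) : ℕ → ℕ → Bool
  | 0 => fun _ => false
  | m + 1 => Function.update (carrier w r m) (sInf {j | carrier w r m j = w (r - 1 - m)})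
      (!(w (r - 1 - m)))

/-- The distance from `p` to the next flat step. -/
noncomputable def flatDist (w : ℤ → Bool) (p : ℤ) : ℕ := sInf {m : ℕ | Flat w (p + m)}

/-- The state of the carrier after it has read the bit at position `p`. -/
noncomputable def state (w : ℤ → Bool) (p : ℤ) : ℕ → Bool :=
  carrier w (p + flatDist w p) (flatDist w p)

open Classical in
/-- The seat of the carrier that changes at position `p`, and `n` at a flat step. -/
noncomputable def seat (n : ℕ) (w : ℤ → Bool) (p : ℤ) : ℕ :=
  if Flat w p then n else sInf {j | state w (p + 1) j = w p}

theorem flatDist_eq_zero {w : ℤ → Bool} {p : ℤ} (h : Flat w p) : flatDist w p = 0 :=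
  Nat.le_zero.1 (Nat.sInf_le (by simpa using h))

theorem flatDist_succ {n : ℕ} {w : ℤ → Bool} (hd : Drift n w) {p : ℤ} (h : ¬ Flat w p) :
    flatDist w p = flatDist w (p + 1) + 1 := by
  obtain ⟨r, h1, h2, h3⟩ := hd.exists_nextFlat (p + 1)
  have key : ∀ q, q ≤ r → (∀ i, q ≤ i → i < r → ¬ Flat w i) → flatDist w q = (r - q).toNat := by
    intro q hq hlt
    refine le_antisymm (Nat.sInf_le ?_) (le_csInf ⟨(r - q).toNat, ?_⟩ fun m hm => ?_)
    · simpa [hq] using h2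
    · simpa [hq] using h2
    · by_contra hc
      exact hlt _ (by omega) (by omega) hm
  rw [key p (by omega), key (p + 1) h1 h3]
  · omega
  · intro i hi hir
    rcases hi.lt_or_eq with h4 | rfl
    · exact h3 i h4 hir
    · exact h

theorem state_of_flat {w : ℤ → Bool} {p : ℤ} (h : Flat w p) : state w p = fun _ => false := by
  simp [state, flatDist_eq_zero h, carrier]

theorem seat_of_flat {n : ℕ} {w : ℤ → Bool} {p : ℤ} (h : Flat w p) : seat n w p = n := by
  simp [seat, h]

theorem seatRule {n : ℕ} {w : ℤ → Bool} (hd : Drift n w) {p : ℤ} (h : ¬ Flat w p) :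
    SeatRule w (state w) (seat n w) p := by
  have hs : seat n w p = sInf {j | state w (p + 1) j = w p} := by simp [seat, h]
  refine ⟨hs, ?_⟩
  rw [hs, state, flatDist_succ hd h, carrier, state]
  have e1 : p + ((flatDist w (p + 1) + 1 : ℕ) : ℤ) - 1 - (flatDist w (p + 1) : ℕ) = p := by
    push_cast; ring
  have e2 : p + ((flatDist w (p + 1) + 1 : ℕ) : ℤ) = p + 1 + (flatDist w (p + 1) : ℕ) := by
    push_cast; ring
  rw [e1, e2]

theorem FlatPair.rule {n : ℕ} {w : ℤ → Bool} (hd : Drift n w) {q r : ℤ} (h : FlatPair w q r)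
    (p : ℤ) (hp : q + 1 ≤ p) (hpr : p < r) : SeatRule w (state w) (seat n w) p :=
  seatRule hd (h.2.2.2 p (by omega) hpr)

/-- Flat steps repeat with period `n`. This bounds the heights of the hills by `n` and puts all
seats outside flat steps below `n`. -/
theorem FlatPair.length_le {n : ℕ} {w : ℤ → Bool} (hd : Drift n w) {q r : ℤ}
    (h : FlatPair w q r) : r - q ≤ n := by
  have h1 := hd.flat_add 1 h.2.1
  have hn := hd.pos
  by_contra hc
  exact h.2.2.2 _ (by omega) (by omega) h1

theorem FlatPair.bal_le {n : ℕ} {w : ℤ → Bool} (hd : Drift n w) {q r : ℤ}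
    (h : FlatPair w q r) (j : ℤ) (hj : q + 1 ≤ j) (hjr : j ≤ r) : bal w (q + 1) j ≤ n := by
  have := bal_le_length w hj
  have := h.length_le hd
  omega

theorem FlatPair.seat_lt {n : ℕ} {w : ℤ → Bool} (hd : Drift n w) {q r : ℤ} (h : FlatPair w q r)
    {p : ℤ} (hp : q < p) (hpr : p < r) :
    state w (p + 1) (seat n w p) = w p ∧ seat n w p < n :=
  h.isHill.seat_lt (h.rule hd) (h.bal_le hd) (by simp [state_of_flat h.2.2.1]) hp hpr

theorem FlatPair.state_left {n : ℕ} {w : ℤ → Bool} (hd : Drift n w) {q r : ℤ}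
    (h : FlatPair w q r) : state w (q + 1) = fun _ => false := by
  rw [h.isHill.state_eq (h.rule hd) (h.bal_le hd) (by simp [state_of_flat h.2.2.1]),
    state_of_flat h.2.2.1]

/-- The hill to the right of a flat step leaves the carrier empty, so restarting it at flat steps
discards nothing. -/
theorem state_succ_of_flat {n : ℕ} {w : ℤ → Bool} (hd : Drift n w) {p : ℤ} (h : Flat w p) :
    state w (p + 1) = fun _ => false := by
  obtain ⟨r, h1, h2, h3⟩ := hd.exists_nextFlat (p + 1)
  exact FlatPair.state_left hd (r := r) ⟨by omega, h, h2, fun i hi hir => h3 i (by omega) hir⟩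

theorem seat_lt {n : ℕ} {w : ℤ → Bool} (hd : Drift n w) {p : ℤ} (h : ¬ Flat w p) :
    seat n w p < n := by
  obtain ⟨q, r, h1, h2, h3⟩ := hd.exists_flatPair h
  exact (h1.seat_lt hd h2 h3).2

theorem state_seat {n : ℕ} {w : ℤ → Bool} (hd : Drift n w) {p : ℤ} (h : ¬ Flat w p) :
    state w (p + 1) (seat n w p) = w p := by
  obtain ⟨q, r, h1, h2, h3⟩ := hd.exists_flatPair h
  exact (h1.seat_lt hd h2 h3).1

theorem seat_lt_iff {n : ℕ} {w : ℤ → Bool} (hd : Drift n w) {p : ℤ} :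
    seat n w p < n ↔ ¬ Flat w p :=
  ⟨fun h hf => by rw [seat_of_flat hf] at h; omega, seat_lt hd⟩

theorem flatDist_add {n : ℕ} {w : ℤ → Bool} (hd : Drift n w) (p t : ℤ) :
    flatDist w (p + n * t) = flatDist w p := by
  unfold flatDist
  congr 1
  ext m
  rw [Set.mem_ofPred_eq, add_right_comm, hd.flat_add_iff]
  rfl

theorem carrier_add {n : ℕ} {w : ℤ → Bool} (hd : Drift n w) (r t : ℤ) (m : ℕ) :
    carrier w (r + n * t) m = carrier w r m := by
  induction m with
  | zero => rfl
  | succ m ih =>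
    have : r + n * t - 1 - m = r - 1 - m + n * t := by ring
    rw [carrier, carrier, ih, this, hd.periodic_mul]

theorem state_add {n : ℕ} {w : ℤ → Bool} (hd : Drift n w) (p t : ℤ) :
    state w (p + n * t) = state w p := by
  rw [state, flatDist_add hd, add_right_comm, carrier_add hd, state]

theorem seat_add {n : ℕ} {w : ℤ → Bool} (hd : Drift n w) (p t : ℤ) :
    seat n w (p + n * t) = seat n w p := by
  by_cases h : Flat w p
  · rw [seat_of_flat h, seat_of_flat (hd.flat_add t h)]
  · have h' : ¬ Flat w (p + n * t) := by rwa [hd.flat_add_iff]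
    rw [(seatRule hd h).1, (seatRule hd h').1, add_right_comm, state_add hd, hd.periodic_mul]

/-! ### The decomposition of a prime hill -/

/-- Left of the leftmost highest point, `α i` is the last step that starts at height `i`; right of
it, `β i` is the last step that starts at height `h - i`. By maximality the path between consecutive
ones cannot fall below its starting height on the left, nor rise above it on the right. -/
theorem IsPrimeHill.exists_hillDecomp {w : ℤ → Bool} {a b : ℤ} (hP : IsPrimeHill w a b) :
    ∃ h α β, HillDecomp w a b h α β := by
  obtain ⟨hab, hb0, hpos⟩ := hP
  have hone : w a = true ∧ bal w a (a + 1) = 1 ∧ a + 1 < b := by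
    rcases bal_single w a with h | h
    · refine ⟨h.1, h.2, lt_of_le_of_ne hab ?_⟩
      rintro rfl
      omega
    · rcases (show a + 1 ≤ b from hab).lt_or_eq with h1 | rfl
      · have := hpos (a + 1) (by omega) h1
        omega
      · omega
  obtain ⟨m, hm, hmax⟩ := Finset.exists_max_image (Finset.Icc a b) (fun j => bal w a j)
    ⟨a, by simpa using hab.le⟩
  simp only [Finset.mem_Icc] at hm hmax
  obtain ⟨h, hh⟩ : ∃ h : ℕ, (h : ℤ) = bal w a m :=
    ⟨(bal w a m).toNat, Int.toNat_of_nonneg (by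
      have := hmax (a + 1) ⟨by omega, by omega⟩
      omega)⟩
  have hh1 : 1 ≤ h := by
    have := hmax (a + 1) ⟨by omega, by omega⟩
    omega
  obtain ⟨top, ⟨ht1, ht2, ht3⟩, hleast⟩ := Int.exists_least_of_bdd
    (P := fun j => a ≤ j ∧ j ≤ b ∧ bal w a j = h) ⟨a, fun z hz => hz.1⟩ ⟨m, hm.1, hm.2, hh.symm⟩
  have hleft : ∀ j, a ≤ j → j < top → bal w a j < h := by
    intro j hj hjt
    have h1 := hmax j ⟨hj, by omega⟩
    by_contra hc
    have := hleast j ⟨hj, by omega, by omega⟩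
    omega
  have hta : a < top := by
    rcases ht1.lt_or_eq with h1 | rfl
    · exact h1
    · rw [bal_self] at ht3
      omega
  have htb : top < b := by
    rcases ht2.lt_or_eq with h1 | rfl
    · exact h1
    · omega
  have hα : ∀ i : ℕ, ∃ p, i < h → (a ≤ p ∧ p < top ∧ bal w a p ≤ i ∧
      ∀ j, p < j → j ≤ top → i < bal w a j) := by
    intro i
    by_cases hi : i < h
    · obtain ⟨p, ⟨h1, h2, h3⟩, h4⟩ := Int.exists_greatest_of_bdd
        (P := fun p => a ≤ p ∧ p < top ∧ bal w a p ≤ i) ⟨top, fun z hz => hz.2.1.le⟩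
        ⟨a, le_rfl, hta, by simp [bal_self]⟩
      refine ⟨p, fun _ => ⟨h1, h2, h3, fun j hj hjt => ?_⟩⟩
      rcases hjt.lt_or_eq with h5 | rfl
      · by_contra hc
        have := h4 j ⟨by omega, h5, by omega⟩
        omega
      · omega
    · exact ⟨0, fun h => absurd h hi⟩
  choose α hα using hα
  have hα' : ∀ i < h, bal w a (α i) = i ∧ w (α i) = true ∧ bal w a (α i + 1) = i + 1 := by
    intro i hi
    obtain ⟨h1, h2, h3, h4⟩ := hα i hi
    have := h4 (α i + 1) (by omega) (by omega)
    rcases bal_succ_cases w h1 with h | h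
    · exact ⟨by omega, h.1, by omega⟩
    · omega
  have hβ : ∀ i : ℕ, ∃ p, i < h → (top ≤ p ∧ p < b ∧ (h : ℤ) - i ≤ bal w a p ∧
      ∀ j, p < j → j ≤ b → bal w a j < h - i) := by
    intro i
    by_cases hi : i < h
    · obtain ⟨p, ⟨h1, h2, h3⟩, h4⟩ := Int.exists_greatest_of_bdd
        (P := fun p => top ≤ p ∧ p < b ∧ (h : ℤ) - i ≤ bal w a p) ⟨b, fun z hz => hz.2.1.le⟩
        ⟨top, le_rfl, htb, by omega⟩
      refine ⟨p, fun _ => ⟨h1, h2, h3, fun j hj hjt => ?_⟩⟩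
      rcases hjt.lt_or_eq with h5 | rfl
      · by_contra hc
        have := h4 j ⟨by omega, h5, by omega⟩
        omega
      · omega
    · exact ⟨0, fun h => absurd h hi⟩
  choose β hβ using hβ
  have hβ' : ∀ i < h, bal w a (β i) = h - i ∧ w (β i) = false ∧
      bal w a (β i + 1) = h - i - 1 := by
    intro i hi
    obtain ⟨h1, h2, h3, h4⟩ := hβ i hi
    have := h4 (β i + 1) (by omega) (by omega)
    rcases bal_succ_cases w (by omega : a ≤ β i) with h | h
    · omega
    · exact ⟨by omega, h.1, by omega⟩
  have hlast : α (h - 1) + 1 = top := by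
    have h1 := hα (h - 1) (by omega)
    have h2 := hα' (h - 1) (by omega)
    have := hleast (α (h - 1) + 1) ⟨by omega, by omega, by omega⟩
    omega
  have hds : ∀ i < h, a < dentStart h α β i ∧ dentStart h α β i ≤ β i ∧
      bal w a (dentStart h α β i) = h - i ∧
      ∀ j, dentStart h α β i ≤ j → j ≤ b → bal w a j ≤ h - i := by
    intro i hi
    obtain ⟨h1, h2, h3, h4⟩ := hβ i hi
    have h5 := hβ' i hi
    unfold dentStart
    split_ifs with h0
    · subst h0
      rw [hlast]
      refine ⟨hta, h1, by omega, fun j hj hjb => ?_⟩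
      have := hmax j ⟨by omega, hjb⟩
      simp
      omega
    · obtain ⟨g1, g2, g3, g4⟩ := hβ (i - 1) (by omega)
      have g5 := hβ' (i - 1) (by omega)
      have e : ((i - 1 : ℕ) : ℤ) = i - 1 := by omega
      rw [e] at *
      refine ⟨by omega, ?_, by omega, fun j hj hjb => ?_⟩
      · by_contra hc
        rcases (show β i ≤ β (i - 1) by omega).lt_or_eq with h6 | h6
        · have := h4 (β (i - 1)) h6 (by omega)
          omega
        · rw [h6] at h5
          omega
      · have := g4 j (by omega) hjb
        omega
  have hβlast : β (h - 1) = b - 1 := by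
    obtain ⟨h1, h2, h3, h4⟩ := hβ (h - 1) (by omega)
    by_contra hc
    have h5 := h4 (b - 1) (by omega) (by omega)
    have := hpos (b - 1) (by omega) (by omega)
    omega
  refine ⟨h, α, β, ⟨hab, hb0, hpos⟩, hh1, ?_, hβlast, fun i hi => (hα' i hi).2.1,
    fun i hi => (hβ' i hi).2.1, by rw [hlast, ht3], fun j hj hjb => ?_, fun j hj hjt => ?_,
    fun i hi hih => ?_, fun i hi => ?_, fun h2 => ?_, ?_⟩
  · have h1 := hα 0 (by omega)
    by_contra hc
    have := hpos (α 0) (by omega) (by omega)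
    have := h1.2.2.1
    simp at this
    omega
  · have := hmax j ⟨hj, hjb⟩
    omega
  · exact hleft j hj (by omega)
  · obtain ⟨g1, g2, g3, g4⟩ := hα (i - 1) (by omega)
    obtain ⟨h1, h2, h3, h4⟩ := hα i hih
    have h5 := hα' i hih
    have g5 := hα' (i - 1) (by omega)
    have e : ((i - 1 : ℕ) : ℤ) = i - 1 := by omega
    rw [e] at *
    have hle : α (i - 1) < α i := by
      by_contra hc
      rcases (show α i ≤ α (i - 1) by omega).lt_or_eq with h6 | h6
      · have := h4 (α (i - 1)) h6 (by omega)
        omega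
      · rw [h6] at h5
        omega
    refine ⟨hle, ?_, fun j hj hji => ?_⟩
    · have := bal_add w (by omega : a ≤ α (i - 1) + 1) hle
      omega
    · have := bal_add w (by omega : a ≤ α (i - 1) + 1) hj
      have := g4 j (by omega) (by omega)
      omega
  · obtain ⟨h1, h2, h3, h4⟩ := hds i hi
    have h5 := hβ' i hi
    refine ⟨h2, ?_, fun j hj hji => ?_⟩
    · rw [bal_compl]
      have := bal_add w h1.le h2
      omega
    · rw [bal_compl]
      have := bal_add w h1.le hj
      have := h4 j hj (by have := (hβ i hi).2.1; omega)
      omega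
  · obtain ⟨g1, g2, g3, g4⟩ := hα (h - 2) (by omega)
    have g5 := hα' (h - 2) (by omega)
    by_contra hc
    have h3 : α (h - 2) + 1 < top := by
      by_contra h4
      have : α (h - 2) + 1 = top := by omega
      rw [this] at g5
      omega
    -- After `α (h - 2)` the path has height at least `h - 1`, and before the top less than `h`:
    -- there is no room for a bulge.
    have h4 := hleft (α (h - 2) + 1 + 1) (by omega) (by omega)
    have h5 := g4 (α (h - 2) + 1 + 1) (by omega) (by omega)
    rcases bal_succ_cases w (by omega : a ≤ α (h - 2) + 1) with h | h <;> omega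
  · obtain ⟨h1, h2, h3, h4⟩ := hds (h - 1) (by omega)
    by_contra hc
    -- From here on the height is at most 1, while it is positive inside a prime hill: the next step
    -- is the last one.
    have h5 := h4 (dentStart h α β (h - 1) + 1) (by omega) (by omega)
    have h6 := hpos (dentStart h α β (h - 1) + 1) (by omega) (by omega)
    rcases bal_succ_cases w (by omega : a ≤ dentStart h α β (h - 1)) with h | h <;> omega

theorem HillDecomp.bal_left {w : ℤ → Bool} {a b : ℤ} {h : ℕ} {α β : ℕ → ℤ}
    (H : HillDecomp w a b h α β) {i : ℕ} (hi : i < h) :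
    bal w a (α i) = i ∧ bal w a (α i + 1) = i + 1 := by
  have hs := bal_succ_true (H.bounds.1 i hi).1 (H.one i hi)
  suffices bal w a (α i) = i from ⟨this, by omega⟩
  clear hs
  induction i with
  | zero => rw [H.first, bal_self]; rfl
  | succ i ih =>
    have h1 := ih (by omega)
    have hs := bal_succ_true (H.bounds.1 i (by omega)).1 (H.one i (by omega))
    have hb := H.bulge (i + 1) (by omega) hi
    rw [Nat.add_sub_cancel] at hb
    have h3 := (H.bounds.1 i (by omega)).1
    have := bal_add w (by omega : a ≤ α i + 1) hb.1
    have := hb.2.1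
    push_cast
    omega

theorem HillDecomp.bal_right {w : ℤ → Bool} {a b : ℤ} {h : ℕ} {α β : ℕ → ℤ}
    (H : HillDecomp w a b h α β) {i : ℕ} (hi : i < h) :
    bal w a (dentStart h α β i) = h - i ∧ bal w a (β i) = h - i := by
  have key : ∀ i < h, bal w a (dentStart h α β i) = h - i → bal w a (β i) = h - i := by
    intro i hi h1
    have hd := H.dent i hi
    have h3 := (H.bounds.2 i hi).1
    have := bal_add w h3 hd.1
    have h4 := hd.2.1
    rw [bal_compl] at h4
    omega
  suffices bal w a (dentStart h α β i) = h - i from ⟨this, key i hi this⟩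
  induction i with
  | zero => simp [dentStart, H.height]
  | succ i ih =>
    have h1 := key i (by omega) (ih (by omega))
    have h3 := (H.bounds.2 i (by omega)).1
    have h4 := (H.dent i (by omega)).1
    have := bal_succ_false (by omega : a ≤ β i) (H.zero i (by omega))
    simp only [dentStart, Nat.add_one_ne_zero, if_false, Nat.add_sub_cancel]
    push_cast
    omega

/-- The bulges and dents of a hill of height `h` are lower than `h`. -/
theorem HillDecomp.bulge_le {w : ℤ → Bool} {a b : ℤ} {h : ℕ} {α β : ℕ → ℤ}
    (H : HillDecomp w a b h α β) {i : ℕ} (h1 : 1 ≤ i) (hi : i < h) {j : ℤ}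
    (hj : α (i - 1) + 1 ≤ j) (hji : j ≤ α i) : bal w (α (i - 1) + 1) j ≤ (h - 1 - i : ℕ) := by
  have hb := H.bal_left (i := i - 1) (by omega)
  have ha := (H.bounds.1 (i - 1) (by omega)).1
  have := bal_add w (by omega : a ≤ α (i - 1) + 1) hj
  have hm : ∀ d, i + d < h → α i ≤ α (i + d) := by
    intro d
    induction d with
    | zero => intro _; exact le_rfl
    | succ d ih =>
      intro hd
      have := ih (by omega)
      have := (H.bulge (i + (d + 1)) (by omega) hd).1
      rw [show i + (d + 1) - 1 = i + d by omega] at this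
      omega
  have h2 := hm (h - 1 - i) (by omega)
  rw [show i + (h - 1 - i) = h - 1 by omega] at h2
  have := H.leftmost j (by omega) (by omega)
  omega

theorem HillDecomp.dent_le {w : ℤ → Bool} {a b : ℤ} {h : ℕ} {α β : ℕ → ℤ}
    (H : HillDecomp w a b h α β) {i : ℕ} (hi : i < h) {j : ℤ}
    (hj : dentStart h α β i ≤ j) (hji : j ≤ β i) :
    bal (fun j => !(w j)) (dentStart h α β i) j ≤ (h - 1 - i : ℕ) := by
  rw [bal_compl]
  have hb := (H.bal_right hi).1
  have h0 := H.bounds.2 i hi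
  have := bal_add w h0.1 hj
  rcases h0.1.lt_or_eq with h1 | h1
  · have := H.prime.2.2 j (by omega) (by omega)
    omega
  · rw [← h1, bal_self] at hb
    omega

/-- If `p < q`, the hill after `p` would contain the 1 at `q` followed by the hill after `q`, and
would end above its start. -/
theorem IsHill.eq_of_end {w : ℤ → Bool} {p q e : ℤ} (hp : IsHill w (p + 1) e)
    (hq : IsHill w (q + 1) e) (wp : w p = true) (wq : w q = true) : p = q := by
  rcases lt_trichotomy p q with h | h | h
  · have h1 := hp.2.2 q h (by have := hq.1; omega)
    have := bal_succ_true (show p + 1 ≤ q from h) wq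
    have := bal_add w (by omega : p + 1 ≤ q + 1) hq.1
    have := hp.2.1
    have := hq.2.1
    omega
  · exact h
  · have h1 := hq.2.2 p h (by have := hp.1; omega)
    have := bal_succ_true (show q + 1 ≤ p from h) wp
    have := bal_add w (by omega : q + 1 ≤ p + 1) hp.1
    have := hp.2.1
    have := hq.2.1
    omega

/-- The leftmost highest point fixes `α (h - 1)` and the end of the hill fixes `β (h - 1)`. Every
other displayed step is found from its right neighbour by `IsHill.eq_of_end`, applied to the
complement in the case of dents. -/
theorem HillDecomp.unique {w : ℤ → Bool} {a b : ℤ} {h h' : ℕ} {α β α' β' : ℕ → ℤ}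
    (H : HillDecomp w a b h α β) (H' : HillDecomp w a b h' α' β') :
    h = h' ∧ ∀ i < h, α i = α' i ∧ β i = β' i := by
  have hp := H.pos
  have hp' := H'.pos
  have b1 := H.bounds.1 (h - 1) (by omega)
  have b1' := H'.bounds.1 (h' - 1) (by omega)
  obtain rfl : h = h' := by
    have h1 := H.highest (α' (h' - 1) + 1) (by omega) (by omega)
    have h2 := H'.highest (α (h - 1) + 1) (by omega) (by omega)
    rw [H'.height] at h1
    rw [H.height] at h2
    omega
  refine ⟨rfl, ?_⟩
  have hlast : α (h - 1) = α' (h - 1) := by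
    rcases lt_trichotomy (α (h - 1)) (α' (h - 1)) with h1 | h1 | h1
    · have := H'.leftmost (α (h - 1) + 1) (by omega) (by omega)
      rw [H.height] at this
      omega
    · exact h1
    · have := H.leftmost (α' (h - 1) + 1) (by omega) (by omega)
      rw [H'.height] at this
      omega
  have hα : ∀ d i, i + d = h - 1 → α i = α' i := by
    intro d
    induction d with
    | zero => intro i hi; rw [show i = h - 1 by omega, hlast]
    | succ d ih =>
      intro i hi
      have e := ih (i + 1) (by omega)
      have h1 := H.bulge (i + 1) (by omega) (by omega)
      have h2 := H'.bulge (i + 1) (by omega) (by omega)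
      rw [e] at h1
      rw [Nat.add_sub_cancel] at h1 h2
      exact h1.eq_of_end h2 (H.one i (by omega)) (H'.one i (by omega))
  have hβ : ∀ d i, i + d = h - 1 → β i = β' i := by
    intro d
    induction d with
    | zero => intro i hi; rw [show i = h - 1 by omega, H.last, H'.last]
    | succ d ih =>
      intro i hi
      have e := ih (i + 1) (by omega)
      have h1 := H.dent (i + 1) (by omega)
      have h2 := H'.dent (i + 1) (by omega)
      rw [e] at h1
      simp only [dentStart, Nat.add_one_ne_zero, if_false, Nat.add_sub_cancel] at h1 h2
      exact h1.eq_of_end h2 (by simp [H.zero i (by omega)]) (by simp [H'.zero i (by omega)])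
  exact fun i hi => ⟨hα (h - 1 - i) i (by omega), hβ (h - 1 - i) i (by omega)⟩

/-! ### Gliders as chains of seats -/

/-- The steps `c 0 < ⋯ < c (2 * v - 1)` of a glider of speed `v`: their seats are
`v - 1, …, 0, v - 1, …, 0`, and the steps in between have seats below the next step. -/
structure IsChain (σ : ℤ → ℕ) (w : ℤ → Bool) (v : ℕ) (c : ℕ → ℤ) : Prop where
  pos : 1 ≤ v
  left : ∀ i < v, σ (c i) = v - 1 - i
  right : ∀ i < v, σ (c (v + i)) = v - 1 - i
  lt : ∀ i, i + 1 < 2 * v → c i < c (i + 1)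
  gap : ∀ i, i + 1 < 2 * v → ∀ p, c i < p → p < c (i + 1) → σ p < σ (c (i + 1))
  colour : ∀ i < v, w (c i) = w (c 0) ∧ w (c (v + i)) = !(w (c 0))

/-- The pair of position sets of a chain. -/
def chainGlider (v : ℕ) (c : ℕ → ℤ) : Glider :=
  ((Finset.range v).image c, (Finset.range v).image fun i => c (v + i))

theorem IsChain.compl {σ : ℤ → ℕ} {w : ℤ → Bool} {v : ℕ} {c : ℕ → ℤ}
    (h : IsChain σ (fun j => !(w j)) v c) : IsChain σ w v c :=
  { h with
    colour := fun i hi => by simpa using h.colour i hi }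

/-- The displayed steps of a decomposition, from left to right. -/
def displayed (h : ℕ) (α β : ℕ → ℤ) (i : ℕ) : ℤ := if i < h then α i else β (i - h)

theorem displayed_left {h : ℕ} {α β : ℕ → ℤ} {i : ℕ} (hi : i < h) : displayed h α β i = α i := by
  simp [displayed, hi]

theorem displayed_right {h : ℕ} {α β : ℕ → ℤ} (i : ℕ) : displayed h α β (h + i) = β i := by
  simp [displayed]

theorem chainGlider_displayed (h : ℕ) (α β : ℕ → ℤ) :
    chainGlider h (displayed h α β) = ((Finset.range h).image α, (Finset.range h).image β) := by
  unfold chainGlider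
  simp only [displayed_right]
  congr 1
  exact Finset.image_congr fun i hi => displayed_left (by simpa using hi)

/-- The steps strictly between two displayed steps form a bulge or a dent. -/
theorem HillDecomp.displayed_cases {h : ℕ} {α β : ℕ → ℤ} {i : ℕ} (hi : i + 1 < 2 * h) :
    (i + 1 < h ∧ displayed h α β i = α (i + 1 - 1) ∧ displayed h α β (i + 1) = α (i + 1)) ∨
      ∃ j < h, i + 1 = h + j ∧ displayed h α β i + 1 = dentStart h α β j ∧
        displayed h α β (i + 1) = β j := by
  rcases lt_or_ge (i + 1) h with h1 | h1
  · exact Or.inl ⟨h1, displayed_left (by omega), displayed_left h1⟩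
  · refine Or.inr ⟨i + 1 - h, by omega, by omega, ?_, ?_⟩
    · unfold dentStart displayed
      split_ifs with h2 h3 h3
      · rw [show i = h - 1 by omega]
      · omega
      · omega
      · rw [show i + 1 - h - 1 = i - h by omega]
    · rw [show i + 1 = h + (i + 1 - h) by omega, displayed_right]
      congr 1
      omega

theorem HillDecomp.displayed_lt {w : ℤ → Bool} {a b : ℤ} {h : ℕ} {α β : ℕ → ℤ}
    (H : HillDecomp w a b h α β) {i : ℕ} (hi : i + 1 < 2 * h) :
    displayed h α β i < displayed h α β (i + 1) := by
  rcases HillDecomp.displayed_cases (α := α) (β := β) hi with ⟨h1, h2, h3⟩ | ⟨j, h1, -, h2, h3⟩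
  · have := (H.bulge (i + 1) (by omega) h1).1
    omega
  · have := (H.dent j h1).1
    omega

theorem lt_of_lt_succ {c : ℕ → ℤ} {N : ℕ} (h : ∀ i, i + 1 < N → c i < c (i + 1)) {i j : ℕ}
    (hij : i < j) (hj : j < N) : c i < c j := by
  induction j with
  | zero => omega
  | succ j ih =>
    have := h j hj
    rcases (Nat.lt_succ_iff.1 hij).lt_or_eq with h1 | rfl
    · have := ih h1 (by omega)
      omega
    · exact this

theorem HillDecomp.displayed_zero {w : ℤ → Bool} {a b : ℤ} {h : ℕ} {α β : ℕ → ℤ}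
    (H : HillDecomp w a b h α β) : displayed h α β 0 = a := by
  rw [displayed_left (by have := H.pos; omega), H.first]

theorem HillDecomp.displayed_last {w : ℤ → Bool} {a b : ℤ} {h : ℕ} {α β : ℕ → ℤ}
    (H : HillDecomp w a b h α β) : displayed h α β (2 * h - 1) = b - 1 := by
  have := H.pos
  rw [show 2 * h - 1 = h + (h - 1) by omega, displayed_right, H.last]

/-- The seats of the displayed steps, bulges and dents of a hill. -/
theorem HillDecomp.seats {w : ℤ → Bool} {S : ℤ → ℕ → Bool} {σ : ℤ → ℕ} {a b : ℤ} {h : ℕ}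
    {α β : ℕ → ℤ} (H : HillDecomp w a b h α β) (hR : ∀ p, a ≤ p → p < b → SeatRule w S σ p)
    (he : ∀ j < h, S b j = false) :
    (∀ i < h, σ (β i) = h - 1 - i ∧ ∀ j < h, S (β i) j = decide (j < h - i)) ∧
    (∀ i < h, σ (α i) = h - 1 - i ∧ ∀ j < h, S (α i) j = decide (h - i ≤ j)) := by
  have hpos := H.pos
  -- Read from the right, the displayed 0s fill the seats `0, …, h - 1` in this order, and then the
  -- displayed 1s empty them in the same order; dents and bulges leave the state unchanged.
  have hright : ∀ i < h, (∀ j < h, S (β i + 1) j = decide (j < h - 1 - i)) →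
      σ (β i) = h - 1 - i ∧ ∀ j < h, S (β i) j = decide (j < h - i) := by
    intro i hi hs
    have hb := H.bounds.2 i hi
    have hd := (H.dent i hi).1
    have hr := hR (β i) (by omega) hb.2
    have hw := H.zero i hi
    have e : σ (β i) = h - 1 - i := hr.seat_eq (by rw [hs _ (by omega), hw]; simp)
      fun j hj => by rw [hs j (by omega), hw]; simp; omega
    refine ⟨e, fun j hj => ?_⟩
    by_cases hj' : j = σ (β i)
    · rw [hj', hr.new, hw, e]
      simp
      omega
    · rw [hr.other hj', hs j hj]
      congr 1
      rw [eq_iff_iff]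
      omega
  -- To the right of this dent the seats below `h - i` are occupied, so in the complement they are
  -- empty, and the complemented dent is a hill of height at most `h - 1 - i`.
  have hdent : ∀ i < h, (∀ j < h, S (β i) j = decide (j < h - i)) →
      S (dentStart h α β i) = S (β i) := by
    intro i hi hs
    have hb := H.bounds.2 i hi
    have := (H.dent i hi).state_eq (S := fun p j => !(S p j)) (σ := σ) (h := h - 1 - i)
      (fun p hp hpb => (hR p (by omega) (by omega)).compl) (fun j hj hji => H.dent_le hi hj hji)
      (fun j hj => by rw [hs j (by omega)]; simp; omega)
    funext j
    simpa using congrFun this j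
  have hβ : ∀ d i, i + d = h - 1 → σ (β i) = h - 1 - i ∧ ∀ j < h, S (β i) j = decide (j < h - i) := by
    intro d
    induction d with
    | zero =>
      intro i hi
      refine hright i (by omega) fun j hj => ?_
      rw [show i = h - 1 by omega, H.last, sub_add_cancel, he j hj]
      simp
    | succ d ih =>
      intro i hi
      have h1 := ih (i + 1) (by omega)
      refine hright i (by omega) fun j hj => ?_
      have h2 := hdent (i + 1) (by omega) h1.2
      simp only [dentStart, Nat.add_one_ne_zero, if_false, Nat.add_sub_cancel] at h2
      rw [h2, h1.2 j hj]
      congr 1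
      rw [eq_iff_iff]
      omega
  have hβ' : ∀ i < h, σ (β i) = h - 1 - i ∧ ∀ j < h, S (β i) j = decide (j < h - i) :=
    fun i hi => hβ (h - 1 - i) i (by omega)
  refine ⟨hβ', ?_⟩
  have hleft : ∀ i < h, (∀ j < h, S (α i + 1) j = decide (h - 1 - i ≤ j)) →
      σ (α i) = h - 1 - i ∧ ∀ j < h, S (α i) j = decide (h - i ≤ j) := by
    intro i hi hs
    have hb := H.bounds.1 i hi
    have hr := hR (α i) hb.1 hb.2
    have hw := H.one i hi
    have e : σ (α i) = h - 1 - i := hr.seat_eq (by rw [hs _ (by omega), hw]; simp)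
      fun j hj => by rw [hs j (by omega), hw]; simp; omega
    refine ⟨e, fun j hj => ?_⟩
    by_cases hj' : j = σ (α i)
    · rw [hj', hr.new, hw, e]
      simp
      omega
    · rw [hr.other hj', hs j hj]
      congr 1
      rw [eq_iff_iff]
      omega
  have hα : ∀ d i, i + d = h - 1 → σ (α i) = h - 1 - i ∧ ∀ j < h, S (α i) j = decide (h - i ≤ j) := by
    intro d
    induction d with
    | zero =>
      intro i hi
      refine hleft i (by omega) fun j hj => ?_
      have h2 := hdent 0 (by omega) (hβ' 0 (by omega)).2
      simp only [dentStart, if_true] at h2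
      rw [show i = h - 1 by omega, h2, (hβ' 0 (by omega)).2 j hj]
      simp [hj]
    | succ d ih =>
      intro i hi
      have h1 := ih (i + 1) (by omega)
      refine hleft i (by omega) fun j hj => ?_
      have hb := H.bounds.1 i (by omega)
      have hb' := H.bounds.1 (i + 1) (by omega)
      have h2 := (H.bulge (i + 1) (by omega) (by omega)).state_eq (σ := σ) (S := S)
        (h := h - 1 - (i + 1))
        (fun p hp hpb => hR p (by simp at hp; omega) (by omega))
        (fun j hj hji => H.bulge_le (by omega) (by omega) hj hji)
        (fun j hj => by rw [h1.2 j (by omega)]; simp; omega)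
      rw [Nat.add_sub_cancel] at h2
      rw [h2, h1.2 j hj]
      congr 1
      rw [eq_iff_iff]
      omega
  exact fun i hi => hα (h - 1 - i) i (by omega)

/-- The bulge before `α i` and the dent before `β i` have height at most `h - 1 - i`, which is the
seat of the displayed step that follows; this gives the gap condition. -/
theorem HillDecomp.isChain {w : ℤ → Bool} {S : ℤ → ℕ → Bool} {σ : ℤ → ℕ} {a b : ℤ} {h : ℕ}
    {α β : ℕ → ℤ} (H : HillDecomp w a b h α β) (hR : ∀ p, a ≤ p → p < b → SeatRule w S σ p)
    (he : ∀ j < h, S b j = false) : IsChain σ w h (displayed h α β) := by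
  have hs := H.seats hR he
  have hpos := H.pos
  refine ⟨hpos, fun i hi => ?_, fun i hi => ?_, fun i hi => H.displayed_lt hi,
    fun i hi p hp hpi => ?_, fun i hi => ?_⟩
  · rw [displayed_left hi, (hs.2 i hi).1]
  · rw [displayed_right, (hs.1 i hi).1]
  · rcases HillDecomp.displayed_cases (α := α) (β := β) hi with ⟨h1, h2, h3⟩ | ⟨j, h1, -, h2, h3⟩
    · rw [h3, (hs.2 _ h1).1]
      have hb := H.bounds.1 (i + 1 - 1) (by omega)
      have hb' := H.bounds.1 (i + 1) (by omega)
      exact ((H.bulge (i + 1) (by omega) (by omega)).seat_lt (σ := σ) (S := S)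
        (h := h - 1 - (i + 1))
        (fun p hp hpb => hR p (by omega) (by omega))
        (fun j hj hji => H.bulge_le (by omega) (by omega) hj hji)
        (fun j hj => by rw [(hs.2 _ h1).2 j (by omega)]; simp; omega)
        (by omega) (by omega)).2
    · rw [h3, (hs.1 _ h1).1]
      have hb := H.bounds.2 j h1
      exact ((H.dent j h1).seat_lt (S := fun p j => !(S p j)) (σ := σ) (h := h - 1 - j)
        (fun p hp hpb => (hR p (by omega) (by omega)).compl)
        (fun i hj hji => H.dent_le h1 hj hji)
        (fun i hi => by rw [(hs.1 _ h1).2 i (by omega)]; simp; omega)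
        (by omega) (by omega)).2
  · rw [displayed_right, displayed_left hi, displayed_left (by omega), H.one i hi,
      H.one 0 (by omega), H.zero i hi]
    simp

/-! ### The gliders of a hill -/

theorem GliderIn.exists_prime {w : ℤ → Bool} {a b : ℤ} {γ : Glider} (h : GliderIn w a b γ) :
    ∃ c d, a ≤ c ∧ d ≤ b ∧ bal w a c = 0 ∧ IsPrimeHill w c d ∧ GliderIn w c d γ := by
  have h' := h
  cases h with
  | factor _ h1 h2 h3 h4 h5 => exact ⟨_, _, h1, h2, h3, h4, h5⟩
  | self H => exact ⟨a, b, le_rfl, le_rfl, bal_self _ _, H.prime, h'⟩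
  | bulge i H => exact ⟨a, b, le_rfl, le_rfl, bal_self _ _, H.prime, h'⟩
  | dent i H => exact ⟨a, b, le_rfl, le_rfl, bal_self _ _, H.prime, h'⟩

/-- A prime hill has no proper prime factor at its initial height, so `factor` contributes nothing
new, and `HillDecomp.unique` identifies the data of the other constructors. -/
theorem GliderIn.prime_cases {w : ℤ → Bool} {a b : ℤ} {γ : Glider} (h : GliderIn w a b γ)
    {l : ℕ} {α β : ℕ → ℤ} (H : HillDecomp w a b l α β) :
    γ = ((Finset.range l).image α, (Finset.range l).image β) ∨
      (∃ i, 1 ≤ i ∧ i + 2 ≤ l ∧ GliderIn w (α (i - 1) + 1) (α i) γ) ∨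
      ∃ i, i + 2 ≤ l ∧ GliderIn (fun j => !(w j)) (dentStart l α β i) (β i) γ := by
  induction h with
  | @factor w a b c d γ h1 h2 h3 h4 h5 h6 ih =>
    have hP := H.prime
    have hca : c = a := by
      rcases h2.lt_or_eq with h | h
      · have := hP.2.2 c h (by have := h5.1; omega)
        omega
      · exact h.symm
    subst hca
    have hdb : d = b := by
      rcases h3.lt_or_eq with h | h
      · have := hP.2.2 d h5.1 h
        have := h5.2.1
        omega
      · exact h
    subst hdb
    exact ih H
  | @self w a b h' α' β' H' =>
    obtain ⟨rfl, hu⟩ := H.unique H'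
    left
    rw [Finset.image_congr (g := α) fun i hi => (hu i (by simpa using hi)).1.symm,
      Finset.image_congr (g := β) fun i hi => (hu i (by simpa using hi)).2.symm]
  | @bulge w a b h' α' β' γ i H' h1 h2 h3 _ =>
    obtain ⟨rfl, hu⟩ := H.unique H'
    rw [← (hu i (by omega)).1, ← (hu (i - 1) (by omega)).1] at h3
    exact Or.inr (Or.inl ⟨i, h1, h2, h3⟩)
  | @dent w a b h' α' β' γ i H' h1 h2 _ =>
    obtain ⟨rfl, hu⟩ := H.unique H'
    have e : dentStart l α' β' i = dentStart l α β i := by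
      unfold dentStart
      rw [(hu (l - 1) (by omega)).1, (hu (i - 1) (by omega)).2]
    rw [e, ← (hu i (by omega)).2] at h2
    exact Or.inr (Or.inr ⟨i, h1, h2⟩)

/-- A hill inside another one does not see the seats occupied before. -/
theorem IsHill.state_factor {w : ℤ → Bool} {S : ℤ → ℕ → Bool} {σ : ℤ → ℕ} {a b c d : ℤ} {h : ℕ}
    (hH : IsHill w a b) (hR : ∀ p, a ≤ p → p < b → SeatRule w S σ p)
    (hh : ∀ j, a ≤ j → j ≤ b → bal w a j ≤ h) (he : ∀ j < h, S b j = false)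
    (hac : a ≤ c) (hcd : c ≤ d) (hdb : d ≤ b) (h0 : bal w a c = 0) (h1 : bal w c d = 0) :
    (∀ j, c ≤ j → j ≤ d → bal w c j ≤ h) ∧ ∀ j < h, S d j = false := by
  refine ⟨fun j hj hjd => ?_, ?_⟩
  · have := bal_add w hac hj
    have := hh j (by omega) (by omega)
    omega
  · have hd : bal w a d = 0 := by
      have := bal_add w hac hcd
      omega
    rw [(hH.tail (by omega) hdb hd).state_eq (σ := σ) (S := S) (h := h)
      (fun p hp hpb => hR p (by omega) hpb) (fun j hj hjb => by
        have := bal_add w (by omega : a ≤ d) hj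
        have := hh j (by omega) (by omega)
        omega) he]
    exact he

/-- The states `S` are quantified inside because entering a dent complements them, whereas the seats
`σ` stay the same. The bound `h` becomes the height bound of the bulge or dent. -/
theorem GliderIn.exists_isChain {w : ℤ → Bool} {a b : ℤ} {γ : Glider} (hγ : GliderIn w a b γ) :
    ∀ {S : ℤ → ℕ → Bool} {σ : ℤ → ℕ} {h : ℕ}, (∀ p, a ≤ p → p < b → SeatRule w S σ p) →
      (∀ j, a ≤ j → j ≤ b → bal w a j ≤ h) → (∀ j < h, S b j = false) →
      ∃ v c, γ = chainGlider v c ∧ IsChain σ w v c := by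
  induction hγ with
  | @factor w a b c d γ h1 h2 h3 h4 h5 h6 ih =>
    intro S σ h hR hh he
    have := h1.state_factor hR hh he h2 h5.1.le h3 h4 h5.2.1
    exact ih (fun p hp hpd => hR p (by omega) (by omega)) this.1 this.2
  | @self w a b l α β H =>
    intro S σ h hR hh he
    refine ⟨l, displayed l α β, (chainGlider_displayed l α β).symm, H.isChain hR fun j hj => ?_⟩
    have := hh (α (l - 1) + 1) (by have := H.bounds.1 (l - 1) (by omega); omega)
      (by have := H.bounds.1 (l - 1) (by omega); omega)
    rw [H.height] at this
    exact he j (by omega)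
  | @bulge w a b l α β γ i H h1 h2 h3 ih =>
    intro S σ h hR hh he
    have hl := hh (α (l - 1) + 1) (by have := H.bounds.1 (l - 1) (by omega); omega)
      (by have := H.bounds.1 (l - 1) (by omega); omega)
    rw [H.height] at hl
    have hs := H.seats hR (fun j hj => he j (by omega))
    have hb := H.bounds.1 (i - 1) (by omega)
    have hb' := H.bounds.1 i (by omega)
    exact ih (h := l - 1 - i) (fun p hp hpb => hR p (by omega) (by omega))
      (fun j hj hji => H.bulge_le (by omega) (by omega) hj hji)
      (fun j hj => by rw [(hs.2 i (by omega)).2 j (by omega)]; simp; omega)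
  | @dent w a b l α β γ i H h1 h2 ih =>
    intro S σ h hR hh he
    have hl := hh (α (l - 1) + 1) (by have := H.bounds.1 (l - 1) (by omega); omega)
      (by have := H.bounds.1 (l - 1) (by omega); omega)
    rw [H.height] at hl
    have hs := H.seats hR (fun j hj => he j (by omega))
    have hb := H.bounds.2 i (by omega)
    obtain ⟨v, c, e, hc⟩ := ih (S := fun p j => !(S p j)) (σ := σ) (h := l - 1 - i)
      (fun p hp hpb => (hR p (by omega) (by omega)).compl)
      (fun j hj hji => H.dent_le (by omega) hj hji)
      (fun j hj => by rw [(hs.1 i (by omega)).2 j (by omega)]; simp; omega)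
    exact ⟨v, c, e, hc.compl⟩

/-- The step at `p` belongs to the glider `γ`. -/
def HasStep (γ : Glider) (p : ℤ) : Prop := p ∈ γ.1 ∨ p ∈ γ.2

theorem GliderIn.hasStep_mem {w : ℤ → Bool} {a b : ℤ} {γ : Glider} (h : GliderIn w a b γ) :
    ∀ p, HasStep γ p → a ≤ p ∧ p < b := by
  induction h with
  | factor _ h1 h2 _ _ _ ih =>
    intro p hp
    have := ih p hp
    exact ⟨by linarith, by linarith⟩
  | @self w a b h α β H =>
    rintro p (hp | hp)
    · simp only [Finset.mem_image, Finset.mem_range] at hp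
      obtain ⟨i, hi, rfl⟩ := hp
      exact H.bounds.1 i hi
    · simp only [Finset.mem_image, Finset.mem_range] at hp
      obtain ⟨i, hi, rfl⟩ := hp
      have := H.bounds.2 i hi
      have := (H.dent i hi).1
      exact ⟨by omega, by omega⟩
  | bulge i H h1 h2 _ ih =>
    intro p hp
    have := ih p hp
    have := H.bounds.1 i (by omega)
    have := H.bounds.1 (i - 1) (by omega)
    exact ⟨by linarith, by linarith⟩
  | dent i H h2 _ ih =>
    intro p hp
    have := ih p hp
    have := H.bounds.2 i (by omega)
    exact ⟨by linarith, by linarith⟩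

theorem HillDecomp.exists_displayed {w : ℤ → Bool} {a b : ℤ} {h : ℕ} {α β : ℕ → ℤ}
    (H : HillDecomp w a b h α β) {p : ℤ} (hp : a ≤ p) (hpb : p < b) :
    (∃ i < 2 * h, p = displayed h α β i) ∨
      ∃ i, i + 1 < 2 * h ∧ displayed h α β i < p ∧ p < displayed h α β (i + 1) := by
  have key : ∀ i < 2 * h, p ≤ displayed h α β i → (∃ i < 2 * h, p = displayed h α β i) ∨
      ∃ i, i + 1 < 2 * h ∧ displayed h α β i < p ∧ p < displayed h α β (i + 1) := by
    intro i
    induction i with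
    | zero =>
      intro hi h1
      rw [H.displayed_zero] at h1
      exact Or.inl ⟨0, hi, by rw [H.displayed_zero]; omega⟩
    | succ i ih =>
      intro hi h1
      rcases lt_or_ge (displayed h α β i) p with h2 | h2
      · rcases h1.lt_or_eq with h3 | h3
        · exact Or.inr ⟨i, hi, h2, h3⟩
        · exact Or.inl ⟨i + 1, hi, h3⟩
      · exact ih (by omega) h2
  have := H.pos
  exact key (2 * h - 1) (by omega) (by rw [H.displayed_last]; omega)

theorem HillDecomp.hasStep_displayed {h : ℕ} {α β : ℕ → ℤ} {p : ℤ} :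
    HasStep ((Finset.range h).image α, (Finset.range h).image β) p ↔
      ∃ i < 2 * h, p = displayed h α β i := by
  unfold HasStep
  simp only [Finset.mem_image, Finset.mem_range]
  constructor
  · rintro (⟨i, hi, rfl⟩ | ⟨i, hi, rfl⟩)
    · exact ⟨i, by omega, (displayed_left hi).symm⟩
    · exact ⟨h + i, by omega, (displayed_right i).symm⟩
  · rintro ⟨i, hi, rfl⟩
    rcases lt_or_ge i h with h1 | h1
    · exact Or.inl ⟨i, h1, (displayed_left h1).symm⟩
    · exact Or.inr ⟨i - h, by omega, (displayed_right (h := h) (α := α) (i - h)).symm.trans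
        (congrArg _ (by omega))⟩

/-- Every step of a hill belongs to a prime factor of the hill. -/
theorem IsHill.exists_prime {w : ℤ → Bool} {a b p : ℤ} (hH : IsHill w a b) (hp : a ≤ p)
    (hpb : p < b) : ∃ c d, a ≤ c ∧ c ≤ p ∧ p < d ∧ d ≤ b ∧ bal w a c = 0 ∧ IsPrimeHill w c d := by
  obtain ⟨c, ⟨h1, h2, h3⟩, h4⟩ := Int.exists_greatest_of_bdd
    (P := fun c => a ≤ c ∧ c ≤ p ∧ bal w a c = 0) ⟨p, fun z hz => hz.2.1⟩
    ⟨a, le_rfl, hp, bal_self _ _⟩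
  obtain ⟨d, ⟨g1, g2, g3⟩, g4⟩ := Int.exists_least_of_bdd
    (P := fun d => p < d ∧ d ≤ b ∧ bal w a d = 0) ⟨p, fun z hz => hz.1.le⟩
    ⟨b, hpb, le_rfl, hH.2.1⟩
  refine ⟨c, d, h1, h2, g1, g2, h3, by omega, ?_, fun j hj hjd => ?_⟩
  · have := bal_add w h1 (by omega : c ≤ d)
    omega
  · have h5 := bal_add w h1 hj.le
    have h6 := hH.2.2 j (by omega) (by omega)
    have h7 : bal w a j ≠ 0 := by
      intro h7
      rcases le_or_gt j p with h8 | h8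
      · have := h4 j ⟨by omega, h8, h7⟩
        omega
      · have := g4 j ⟨h8, by omega, h7⟩
        omega
    omega

/-- A step is displayed in the decomposition of its prime factor or lies in a shorter bulge or dent.
The last bulge and the last dent, which the recursion omits, are empty. -/
theorem IsHill.exists_glider {m : ℕ} : ∀ {w : ℤ → Bool} {a b p : ℤ}, b - a ≤ m → IsHill w a b →
    a ≤ p → p < b → ∃ γ, GliderIn w a b γ ∧ HasStep γ p := by
  induction m with
  | zero => intro w a b p hm _ hp hpb; simp at hm; omega
  | succ m ih =>
    intro w a b p hm hH hp hpb
    push_cast at hm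
    obtain ⟨c, d, h1, h2, h3, h4, h5, h6⟩ := hH.exists_prime hp hpb
    obtain ⟨l, α, β, H⟩ := h6.exists_hillDecomp
    suffices ∃ γ, GliderIn w c d γ ∧ HasStep γ p by
      obtain ⟨γ, h7, h8⟩ := this
      exact ⟨γ, .factor hH h1 h4 h5 h6 h7, h8⟩
    rcases H.exists_displayed h2 h3 with hi | ⟨i, hi, h7, h8⟩
    · exact ⟨_, .self H, HillDecomp.hasStep_displayed.2 hi⟩
    · rcases HillDecomp.displayed_cases (α := α) (β := β) hi with ⟨g1, g2, g3⟩ | ⟨j, g1, -, g2, g3⟩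
      · have hne : i + 1 + 2 ≤ l := by
          by_contra hc
          have := H.no_last_bulge (by omega)
          rw [show l - 1 = i + 1 by omega, show l - 2 = i + 1 - 1 by omega] at this
          omega
        have hb := H.bounds.1 (i + 1 - 1) (by omega)
        have hb' := H.bounds.1 (i + 1) (by omega)
        obtain ⟨γ, e1, e2⟩ := ih (by omega) (H.bulge (i + 1) (by omega) g1) (p := p) (by omega)
          (by omega)
        exact ⟨γ, .bulge (i + 1) H (by omega) hne e1, e2⟩
      · have hne : j + 2 ≤ l := by
          by_contra hc
          have := H.no_last_dent
          rw [show l - 1 = j by omega] at this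
          omega
        have hb := H.bounds.2 j g1
        obtain ⟨γ, e1, e2⟩ := ih (by omega) (H.dent j g1) (p := p) (by omega) (by omega)
        exact ⟨γ, .dent j H hne e1, e2⟩

theorem IsPrimeHill.eq_of_mem {w : ℤ → Bool} {a c d c' d' p : ℤ} (h : IsPrimeHill w c d)
    (h' : IsPrimeHill w c' d') (ha : a ≤ c) (ha' : a ≤ c') (h0 : bal w a c = 0)
    (h0' : bal w a c' = 0) (hp : c ≤ p) (hpd : p < d) (hp' : c' ≤ p) (hpd' : p < d') :
    c = c' ∧ d = d' := by
  have key : c = c' := by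
    rcases lt_trichotomy c c' with h1 | h1 | h1
    · have := h.2.2 c' h1 (by omega)
      have := bal_add w ha h1.le
      omega
    · exact h1
    · have := h'.2.2 c h1 (by omega)
      have := bal_add w ha' h1.le
      omega
  subst key
  refine ⟨rfl, ?_⟩
  rcases lt_trichotomy d d' with h1 | h1 | h1
  · have := h'.2.2 d h.1 h1
    have := h.2.1
    omega
  · exact h1
  · have := h.2.2 d' h'.1 h1
    have := h'.2.1
    omega

theorem HillDecomp.glider_cases {w : ℤ → Bool} {a b : ℤ} {l : ℕ} {α β : ℕ → ℤ}
    (H : HillDecomp w a b l α β) {γ : Glider} (h : GliderIn w a b γ) :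
    γ = ((Finset.range l).image α, (Finset.range l).image β) ∨
      ∃ i, i + 1 < 2 * l ∧ GliderIn (if i + 1 < l then w else fun j => !(w j))
        (displayed l α β i + 1) (displayed l α β (i + 1)) γ := by
  rcases h.prime_cases H with h | ⟨i, h1, h2, h3⟩ | ⟨i, h1, h2⟩
  · exact Or.inl h
  · refine Or.inr ⟨i - 1, by omega, ?_⟩
    rw [if_pos (by omega), displayed_left (by omega), displayed_left (by omega),
      Nat.sub_add_cancel h1]
    exact h3
  · refine Or.inr ⟨l + i - 1, by omega, ?_⟩
    rcases HillDecomp.displayed_cases (α := α) (β := β) (h := l) (i := l + i - 1) (by omega) with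
      ⟨g1, g2, g3⟩ | ⟨j, g1, g, g2, g3⟩
    · omega
    · obtain rfl : i = j := by omega
      rw [if_neg (by omega), g2, g3]
      exact h2

/-- The prime factor of a step, and the bulge or dent that contains it, are unique. With
`IsHill.exists_glider` this makes the gliders a partition of the steps. -/
theorem GliderIn.eq_of_hasStep {m : ℕ} : ∀ {w : ℤ → Bool} {a b p : ℤ} {γ γ' : Glider},
    b - a ≤ m → GliderIn w a b γ → GliderIn w a b γ' → HasStep γ p → HasStep γ' p → γ = γ' := by
  induction m with
  | zero =>
    intro w a b p γ γ' hm h h' hp hp'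
    have := h.hasStep_mem p hp
    simp at hm
    omega
  | succ m ih =>
    intro w a b p γ γ' hm h h' hp hp'
    push_cast at hm
    obtain ⟨c, d, h1, h2, h3, h4, h5⟩ := h.exists_prime
    obtain ⟨c', d', h1', h2', h3', h4', h5'⟩ := h'.exists_prime
    have hc := h5.hasStep_mem p hp
    have hc' := h5'.hasStep_mem p hp'
    obtain ⟨rfl, rfl⟩ := h4.eq_of_mem h4' h1 h1' h3 h3' hc.1 hc.2 hc'.1 hc'.2
    obtain ⟨l, α, β, H⟩ := h4.exists_hillDecomp
    have hlt : ∀ {i j}, i < j → j < 2 * l → displayed l α β i < displayed l α β j :=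
      fun hij hj => lt_of_lt_succ (c := displayed l α β) (fun i hi => H.displayed_lt hi) hij hj
    have hbd : ∀ i < 2 * l, c ≤ displayed l α β i ∧ displayed l α β i < d := by
      intro i hi
      have e1 := H.displayed_zero
      have e2 := H.displayed_last
      constructor
      · rcases Nat.eq_zero_or_pos i with rfl | h
        · omega
        · have := hlt h hi
          omega
      · rcases (show i ≤ 2 * l - 1 by omega).lt_or_eq with h | h
        · have := hlt h (by omega)
          omega
        · rw [h]
          omega
    -- a step cannot be both displayed and inside a bulge or dent
    have hno : ∀ {i k}, i + 1 < 2 * l → k < 2 * l → p = displayed l α β k →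
        ¬ (displayed l α β i + 1 ≤ p ∧ p < displayed l α β (i + 1)) := by
      rintro i k hi hk rfl ⟨e1, e2⟩
      rcases lt_trichotomy k i with h | rfl | h
      · have := hlt h (by omega)
        omega
      · omega
      · rcases (show i + 1 ≤ k from h).lt_or_eq with h | rfl
        · have := hlt h hk
          omega
        · omega
    rcases H.glider_cases h5 with rfl | ⟨i, hi, e⟩ <;> rcases H.glider_cases h5' with rfl | ⟨i', hi', e'⟩
    · rfl
    · obtain ⟨k, hk, hpk⟩ := HillDecomp.hasStep_displayed.1 hp
      exact absurd (e'.hasStep_mem p hp') (hno hi' hk hpk)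
    · obtain ⟨k, hk, hpk⟩ := HillDecomp.hasStep_displayed.1 hp'
      exact absurd (e.hasStep_mem p hp) (hno hi hk hpk)
    · have b1 := e.hasStep_mem p hp
      have b2 := e'.hasStep_mem p hp'
      obtain rfl : i = i' := by
        rcases lt_trichotomy i i' with h | h | h
        · rcases (show i + 1 ≤ i' from h).lt_or_eq with h | rfl
          · have := hlt h (by omega)
            omega
          · omega
        · exact h
        · rcases (show i' + 1 ≤ i from h).lt_or_eq with h | rfl
          · have := hlt h (by omega)
            omega
          · omega
      have := hbd i (by omega)
      have := hbd (i + 1) (by omega)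
      exact ih (by omega) e e' hp hp'

/-! ### The gliders of a cyclic string -/

theorem step_eq {n : ℕ} {x : ZMod n → Bool} (hd : Drift n (hat x)) (p : ℤ) :
    (Flat (hat x) p → step x p = 0) ∧
      (¬ Flat (hat x) p → step x p = if hat x p = true then 1 else -1) := by
  have hup : IsUp x p ↔ hat x p = true :=
    ⟨fun ⟨j, hj⟩ => hj.2.1, fun h => exists_isMatch_of_drift h (by omega) (hd.bal_lt p)⟩
  unfold step
  rw [hup, isDown_iff]
  constructor
  · intro h
    simp [h.bit, h]
  · intro h
    cases hw : hat x p <;> simp [h]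

theorem sum_step_of_flat {n : ℕ} {x : ZMod n → Bool} (hd : Drift n (hat x)) {q : ℤ}
    (hq : Flat (hat x) q) : ∑ j ∈ Finset.Ico q (q + 1), step x j = 0 := by
  rw [← Finset.insert_Ico_right_eq_Ico_add_one le_rfl, Finset.sum_insert (by simp),
    (step_eq hd q).1 hq]
  simp

/-- Complete hills between flat steps contribute 0, so the height at `a` is the balance since the
last flat step before `a`. -/
theorem sum_step_eq {n : ℕ} {x : ZMod n → Bool} (hd : Drift n (hat x)) {i : ℤ}
    (hi : Flat (hat x) i) {a : ℤ} (ha : i + 1 ≤ a) : ∀ {q}, q < a → Flat (hat x) q →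
      (∀ p, q < p → p < a → ¬ Flat (hat x) p) →
      ∑ j ∈ Finset.Ico i a, step x j = bal (hat x) (q + 1) a := by
  induction a, ha using Int.leInduction with
  | base =>
    intro q hq hqf hlt
    obtain rfl : q = i := by
      by_contra hc
      exact hlt i (by omega) (by omega) hi
    rw [bal_self, sum_step_of_flat hd hi]
  | succ a ha ih =>
    intro q hq hqf hlt
    rw [← Finset.insert_Ico_right_eq_Ico_add_one (by omega), Finset.sum_insert (by simp)]
    by_cases hf : Flat (hat x) a
    · obtain rfl : q = a := by
        by_contra hc
        exact hlt a (by omega) (by omega) hf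
      obtain ⟨q', h1, h2, h3⟩ := hd.exists_prevFlat q
      have hP : FlatPair (hat x) q' q := ⟨h1, h2, hf, h3⟩
      rw [ih h1 h2 h3, hP.isHill.2.1, (step_eq hd q).1 hf, bal_self]
      rfl
    · have hqa : q ≠ a := by rintro rfl; exact hf hqf
      rw [ih (by omega) hqf fun p hp hpa => hlt p hp (by omega), (step_eq hd a).2 hf,
        bal_succ _ (by omega), add_comm]

/-- A nonempty base hill lies between two consecutive flat steps and starts at height 0, so its
prime factors are prime factors of the whole hill between them. -/
theorem mem_gliders_iff {n : ℕ} {x : ZMod n → Bool} (hd : Drift n (hat x)) {γ : Glider} :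
    γ ∈ gliders x ↔ ∃ q r, FlatPair (hat x) q r ∧ GliderIn (hat x) (q + 1) r γ := by
  constructor
  · rintro ⟨a, b, ⟨⟨i, hia, hi, hsum⟩, hH⟩, hγ⟩
    rw [isFlat_iff] at hi
    obtain ⟨c, d, h1, h2, h3, h4, h5⟩ := hγ.exists_prime
    have hcd := h4.1
    obtain ⟨q, r, hP, hqc, hcr⟩ := hd.exists_flatPair (hH.not_flat h1 (by omega))
    have hnf : ∀ p, a ≤ p → p < b → ¬ Flat (hat x) p := fun p hp hpb => hH.not_flat hp hpb
    have hqa : q < a := by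
      by_contra hc
      exact hnf q (by omega) (by omega) hP.2.1
    have hbr : b ≤ r := by
      by_contra hc
      exact hnf r (by omega) (by omega) hP.2.2.1
    have hia' : i ≠ a := by
      rintro rfl
      exact hnf i le_rfl (by omega) hi
    rw [sum_step_eq hd hi (by omega) hqa hP.2.1
      fun p hp hpa => hP.2.2.2 p hp (by omega)] at hsum
    refine ⟨q, r, hP, .factor hP.isHill (by omega) (by omega) ?_ h4 h5⟩
    have := bal_add (hat x) (show q + 1 ≤ a from hqa) h1
    omega
  · rintro ⟨q, r, hP, hγ⟩
    refine ⟨q + 1, r, ⟨⟨q, by omega, isFlat_iff.2 hP.2.1, sum_step_of_flat hd hP.2.1⟩,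
      hP.isHill⟩, hγ⟩

theorem not_flat_of_hasStep {n : ℕ} {x : ZMod n → Bool} (hd : Drift n (hat x)) {γ : Glider}
    (hγ : γ ∈ gliders x) {p : ℤ} (hp : HasStep γ p) : ¬ Flat (hat x) p := by
  obtain ⟨q, r, hP, h⟩ := (mem_gliders_iff hd).1 hγ
  have := h.hasStep_mem p hp
  exact hP.2.2.2 p (by omega) this.2

theorem exists_glider {n : ℕ} {x : ZMod n → Bool} (hd : Drift n (hat x)) {p : ℤ}
    (hp : ¬ Flat (hat x) p) : ∃ γ ∈ gliders x, HasStep γ p := by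
  obtain ⟨q, r, hP, h1, h2⟩ := hd.exists_flatPair hp
  obtain ⟨γ, h3, h4⟩ := hP.isHill.exists_glider (m := (r - (q + 1)).toNat) (by omega) h1 h2
  exact ⟨γ, (mem_gliders_iff hd).2 ⟨q, r, hP, h3⟩, h4⟩

theorem glider_eq_of_hasStep {n : ℕ} {x : ZMod n → Bool} (hd : Drift n (hat x)) {γ γ' : Glider}
    (hγ : γ ∈ gliders x) (hγ' : γ' ∈ gliders x) {p : ℤ} (hp : HasStep γ p) (hp' : HasStep γ' p) :
    γ = γ' := by
  obtain ⟨q, r, hP, h⟩ := (mem_gliders_iff hd).1 hγ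
  obtain ⟨q', r', hP', h'⟩ := (mem_gliders_iff hd).1 hγ'
  have h1 := h.hasStep_mem p hp
  have h2 := h'.hasStep_mem p hp'
  obtain rfl : q = q' := by
    rcases lt_trichotomy q q' with h | h | h
    · exact absurd hP'.2.1 (hP.2.2.2 q' h (by omega))
    · exact h
    · exact absurd hP.2.1 (hP'.2.2.2 q h (by omega))
  obtain rfl : r = r' := by
    rcases lt_trichotomy r r' with h | h | h
    · exact absurd hP.2.2.1 (hP'.2.2.2 r (by omega) h)
    · exact h
    · exact absurd hP'.2.2.1 (hP.2.2.2 r' (by omega) h)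
  exact h.eq_of_hasStep (m := (r - (q + 1)).toNat) (by omega) h' hp hp'

theorem IsChain.strictMono {σ : ℤ → ℕ} {w : ℤ → Bool} {v : ℕ} {c : ℕ → ℤ} (h : IsChain σ w v c)
    {i j : ℕ} (hij : i < j) (hj : j < 2 * v) : c i < c j := lt_of_lt_succ h.lt hij hj

theorem IsChain.mono {σ : ℤ → ℕ} {w : ℤ → Bool} {v : ℕ} {c : ℕ → ℤ} (h : IsChain σ w v c)
    {i j : ℕ} (hij : i ≤ j) (hj : j < 2 * v) : c i ≤ c j := by
  rcases hij.lt_or_eq with h1 | rfl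
  · exact (h.strictMono h1 hj).le
  · exact le_rfl

theorem IsChain.injOn {σ : ℤ → ℕ} {w : ℤ → Bool} {v : ℕ} {c : ℕ → ℤ} (h : IsChain σ w v c)
    {i j : ℕ} (hi : i < 2 * v) (hj : j < 2 * v) (e : c i = c j) : i = j := by
  rcases lt_trichotomy i j with h1 | h1 | h1
  · have := h.strictMono h1 hj
    omega
  · exact h1
  · have := h.strictMono h1 hi
    omega

theorem IsChain.card_left {σ : ℤ → ℕ} {w : ℤ → Bool} {v : ℕ} {c : ℕ → ℤ} (h : IsChain σ w v c) :
    speed (chainGlider v c) = v := by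
  unfold speed chainGlider
  rw [Finset.card_image_of_injOn, Finset.card_range]
  intro i hi j hj e
  simp only [Finset.coe_range, Set.mem_Iio] at hi hj
  exact h.injOn (by omega) (by omega) e

theorem hasStep_chainGlider {v : ℕ} {c : ℕ → ℤ} {p : ℤ} :
    HasStep (chainGlider v c) p ↔ ∃ i < 2 * v, p = c i := by
  unfold HasStep chainGlider
  simp only [Finset.mem_image, Finset.mem_range]
  constructor
  · rintro (⟨i, hi, rfl⟩ | ⟨i, hi, rfl⟩)
    · exact ⟨i, by omega, rfl⟩
    · exact ⟨v + i, by omega, rfl⟩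
  · rintro ⟨i, hi, rfl⟩
    rcases lt_or_ge i v with h1 | h1
    · exact Or.inl ⟨i, h1, rfl⟩
    · exact Or.inr ⟨i - v, by omega, by congr 1; omega⟩

theorem exists_isChain {n : ℕ} {x : ZMod n → Bool} (hd : Drift n (hat x)) {γ : Glider}
    (hγ : γ ∈ gliders x) :
    ∃ c, γ = chainGlider (speed γ) c ∧ IsChain (seat n (hat x)) (hat x) (speed γ) c := by
  obtain ⟨q, r, hP, h⟩ := (mem_gliders_iff hd).1 hγ
  obtain ⟨v, c, rfl, hc⟩ := h.exists_isChain (hP.rule hd) (hP.bal_le hd)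
    (by simp [state_of_flat hP.2.2.1])
  rw [hc.card_left]
  exact ⟨c, rfl, hc⟩

/-- The gap condition makes each step of a chain the next position whose seat is at least the
prescribed one, so the first step determines all others. -/
theorem IsChain.unique {σ : ℤ → ℕ} {w : ℤ → Bool} {v : ℕ} {c c' : ℕ → ℤ} (h : IsChain σ w v c)
    (h' : IsChain σ w v c') (h0 : c 0 = c' 0) : ∀ i < 2 * v, c i = c' i := by
  have hs : ∀ i < 2 * v, σ (c i) = σ (c' i) := by
    intro i hi
    rcases lt_or_ge i v with h1 | h1
    · rw [h.left i h1, h'.left i h1]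
    · have e1 := h.right (i - v) (by omega)
      have e2 := h'.right (i - v) (by omega)
      rw [show v + (i - v) = i by omega] at e1 e2
      rw [e1, e2]
  intro i
  induction i with
  | zero => exact fun _ => h0
  | succ i ih =>
    intro hi
    have e := ih (by omega)
    have hs' := hs (i + 1) hi
    have l1 := h.lt i hi
    have l2 := h'.lt i hi
    rcases lt_trichotomy (c (i + 1)) (c' (i + 1)) with h1 | h1 | h1
    · have := h'.gap i hi (c (i + 1)) (by omega) h1
      omega
    · exact h1
    · have := h.gap i hi (c' (i + 1)) (by omega) h1
      omega

theorem IsChain.shift {n : ℕ} {w : ℤ → Bool} (hd : Drift n w) {v : ℕ} {c : ℕ → ℤ}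
    (h : IsChain (seat n w) w v c) (t : ℤ) :
    IsChain (seat n w) w v (fun i => c i + n * t) := by
  refine ⟨h.pos, fun i hi => ?_, fun i hi => ?_, fun i hi => ?_, fun i hi p hp hpc => ?_,
    fun i hi => ?_⟩
  · rw [seat_add hd, h.left i hi]
  · rw [seat_add hd, h.right i hi]
  · have := h.lt i hi
    omega
  · have := h.gap i hi (p - n * t) (by omega) (by omega)
    rwa [← seat_add hd _ t, sub_add_cancel, ← seat_add hd (c (i + 1)) t] at this
  · simp only [hd.periodic_mul]
    exact h.colour i hi

/-! ### Marks and slots -/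

/-- The step at `p` uses the highest seat of a glider of speed `v`. -/
def Mark (n : ℕ) (w : ℤ → Bool) (v : ℕ) (p : ℤ) : Prop := seat n w p + 1 = v

/-- All steps from `p` to `q` use seats that a glider of speed `v` may use. -/
def NoSlot (n : ℕ) (w : ℤ → Bool) (v : ℕ) (p q : ℤ) : Prop :=
  ∀ i, p ≤ i → i ≤ q → seat n w i < v

/-- The mark `z` is the last one before a step with a higher seat. -/
def LastMark (n : ℕ) (w : ℤ → Bool) (v : ℕ) (z : ℤ) : Prop :=
  Mark n w v z ∧ ∃ s, z < s ∧ v ≤ seat n w s ∧ ∀ i, z < i → i < s → seat n w i + 1 < v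

/-- A glider of speed `v` has its first step at `p`. -/
def IsFirst {n : ℕ} (x : ZMod n → Bool) (v : ℕ) (p : ℤ) : Prop :=
  ∃ γ ∈ gliders x, speed γ = v ∧ IsLeast (γ.1 : Set ℤ) p

/-- Flat steps need no exception: the carrier is empty on both sides of them. -/
theorem state_eq_of_no_change {n : ℕ} {w : ℤ → Bool} (hd : Drift n w) {u : ℕ} {a b : ℤ}
    (hab : a ≤ b) (h : ∀ i, a ≤ i → i < b → seat n w i ≠ u) : state w a u = state w b u := by
  induction b, hab using Int.leInduction with
  | base => rfl
  | succ b hb ih =>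
    rw [ih fun i hi hib => h i hi (by omega)]
    by_cases hf : Flat w b
    · rw [state_of_flat hf, state_succ_of_flat hd hf]
    · exact (seatRule hd hf).other (h b hb (by omega)).symm

theorem Mark.not_flat {n : ℕ} {w : ℤ → Bool} {v : ℕ} (hv : v ≤ n) {p : ℤ} (h : Mark n w v p) :
    ¬ Flat w p := by
  intro hf
  rw [Mark, seat_of_flat hf] at h
  omega

/-- The bits at consecutive marks differ. -/
theorem Mark.alternate {n : ℕ} {w : ℤ → Bool} (hd : Drift n w) {v : ℕ} (hv : v ≤ n) {p q : ℤ}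
    (hp : Mark n w v p) (hq : Mark n w v q) (hpq : p < q)
    (h : ∀ i, p < i → i < q → ¬ Mark n w v i) : w p = !(w q) := by
  have hp' := hp.not_flat hv
  have hq' := hq.not_flat hv
  -- Seat `v - 1` is untouched between consecutive marks, so the value that `q` leaves there is the
  -- one that `p` finds.
  have h1 := state_eq_of_no_change hd (u := v - 1) (show p + 1 ≤ q from hpq) fun i hi hiq e =>
    h i (by omega) hiq (by rw [Mark] at *; omega)
  have e1 : seat n w p = v - 1 := by rw [Mark] at hp; omega
  have e2 : seat n w q = v - 1 := by rw [Mark] at hq; omega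
  rw [← e1, state_seat hd hp', e1, ← e2, (seatRule hd hq').new] at h1
  exact h1

theorem IsChain.locate {σ : ℤ → ℕ} {w : ℤ → Bool} {v : ℕ} {c : ℕ → ℤ} (h : IsChain σ w v c)
    {p : ℤ} (h0 : c 0 ≤ p) (h1 : p ≤ c (2 * v - 1)) :
    (∃ i < 2 * v, p = c i) ∨ ∃ i, i + 1 < 2 * v ∧ c i < p ∧ p < c (i + 1) := by
  have key : ∀ i < 2 * v, p ≤ c i → (∃ i < 2 * v, p = c i) ∨
      ∃ i, i + 1 < 2 * v ∧ c i < p ∧ p < c (i + 1) := by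
    intro i
    induction i with
    | zero => exact fun hi h1 => Or.inl ⟨0, hi, by omega⟩
    | succ i ih =>
      intro hi h1
      rcases lt_or_ge (c i) p with h2 | h2
      · rcases h1.lt_or_eq with h3 | h3
        · exact Or.inr ⟨i, hi, h2, h3⟩
        · exact Or.inl ⟨i + 1, hi, h3⟩
      · exact ih (by omega) h2
  have := h.pos
  exact key (2 * v - 1) (by omega) h1

theorem IsChain.seat_eq {σ : ℤ → ℕ} {w : ℤ → Bool} {v : ℕ} {c : ℕ → ℤ} (h : IsChain σ w v c)
    {i : ℕ} (hi : i < 2 * v) : σ (c i) = if i < v then v - 1 - i else 2 * v - 1 - i := by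
  split_ifs with h1
  · exact h.left i h1
  · have := h.right (i - v) (by omega)
    rw [show v + (i - v) = i by omega] at this
    omega

/-- All steps between the first and the last step of a glider have seats below its speed, and only
two of them have the highest possible seat. -/
theorem IsChain.seat_lt {σ : ℤ → ℕ} {w : ℤ → Bool} {v : ℕ} {c : ℕ → ℤ} (h : IsChain σ w v c)
    {p : ℤ} (h0 : c 0 ≤ p) (h1 : p ≤ c (2 * v - 1)) :
    σ p < v ∧ (σ p + 1 = v ↔ p = c 0 ∨ p = c v) := by
  have hv := h.pos
  rcases h.locate h0 h1 with ⟨i, hi, rfl⟩ | ⟨i, hi, h2, h3⟩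
  · have e := h.seat_eq hi
    refine ⟨by split_ifs at e <;> omega, fun h4 => ?_, ?_⟩
    · split_ifs at e
      · left
        congr 1
        omega
      · right
        congr 1
        omega
    · rintro (h4 | h4)
      · have := h.injOn hi (by omega) h4
        subst this
        rw [if_pos (by omega)] at e
        omega
      · have := h.injOn hi (by omega) h4
        subst this
        rw [if_neg (by omega)] at e
        omega
  · have e := h.seat_eq hi
    have h4 := h.gap i hi p h2 h3
    have h5 : σ p + 1 < v := by split_ifs at e <;> omega
    refine ⟨by omega, fun h6 => by omega, ?_⟩
    rintro (rfl | rfl)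
    · have := h.left 0 (by omega)
      omega
    · have := h.right 0 (by omega)
      simp only [add_zero] at this
      omega

theorem chainGlider_isLeast {σ : ℤ → ℕ} {w : ℤ → Bool} {v : ℕ} {c : ℕ → ℤ} (h : IsChain σ w v c) :
    IsLeast ((chainGlider v c).1 : Set ℤ) (c 0) := by
  have := h.pos
  refine ⟨by simpa [chainGlider] using ⟨0, by omega, rfl⟩, fun p hp => ?_⟩
  simp only [chainGlider, Finset.coe_image, Set.mem_image, Finset.mem_coe, Finset.mem_range] at hp
  obtain ⟨i, hi, rfl⟩ := hp
  exact h.mono (Nat.zero_le _) (by omega)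

theorem chainGlider_isGreatest {σ : ℤ → ℕ} {w : ℤ → Bool} {v : ℕ} {c : ℕ → ℤ}
    (h : IsChain σ w v c) : IsGreatest ((chainGlider v c).2 : Set ℤ) (c (2 * v - 1)) := by
  have := h.pos
  refine ⟨?_, fun p hp => ?_⟩
  · simp only [chainGlider, Finset.coe_image, Set.mem_image, Finset.mem_coe, Finset.mem_range]
    exact ⟨v - 1, by omega, by congr 1; omega⟩
  · simp only [chainGlider, Finset.coe_image, Set.mem_image, Finset.mem_coe, Finset.mem_range] at hp
    obtain ⟨i, hi, rfl⟩ := hp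
    exact h.mono (by omega) (by omega)

/-- The chain of a glider of speed `v` with first step at `p`. -/
theorem IsFirst.exists_chain {n : ℕ} {x : ZMod n → Bool} (hd : Drift n (hat x)) {v : ℕ} {p : ℤ}
    (h : IsFirst x v p) : ∃ c, chainGlider v c ∈ gliders x ∧
      IsChain (seat n (hat x)) (hat x) v c ∧ c 0 = p := by
  obtain ⟨γ, hγ, rfl, hp⟩ := h
  obtain ⟨c, e, hc⟩ := exists_isChain hd hγ
  refine ⟨c, by rwa [← e], hc, ?_⟩
  rw [e] at hp
  exact (chainGlider_isLeast hc).unique hp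

theorem IsChain.isFirst {n : ℕ} {x : ZMod n → Bool} {v : ℕ} {c : ℕ → ℤ}
    (hc : IsChain (seat n (hat x)) (hat x) v c) (h : chainGlider v c ∈ gliders x) :
    IsFirst x v (c 0) := ⟨_, h, hc.card_left, chainGlider_isLeast hc⟩

theorem IsChain.speed_le {n : ℕ} {x : ZMod n → Bool} (hd : Drift n (hat x)) {v : ℕ} {c : ℕ → ℤ}
    (hc : IsChain (seat n (hat x)) (hat x) v c) (h : chainGlider v c ∈ gliders x) : v ≤ n := by
  have hv := hc.pos
  have h1 := not_flat_of_hasStep hd h (hasStep_chainGlider.2 ⟨0, by omega, rfl⟩)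
  have := KneserGliders.seat_lt hd h1
  rw [hc.left 0 (by omega)] at this
  omega

theorem IsChain.mark {n : ℕ} {w : ℤ → Bool} {v : ℕ} {c : ℕ → ℤ} (hc : IsChain (seat n w) w v c) :
    Mark n w v (c 0) ∧ Mark n w v (c v) := by
  have hv := hc.pos
  have h0 := hc.left 0 (by omega)
  have h1 := hc.right 0 (by omega)
  simp only [add_zero] at h1
  constructor <;> rw [Mark] <;> omega

/-- Two gliders of a string with a common step have the same chain. -/
theorem chain_eq_of_common {n : ℕ} {x : ZMod n → Bool} (hd : Drift n (hat x)) {v v' : ℕ}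
    {c c' : ℕ → ℤ} (hc : IsChain (seat n (hat x)) (hat x) v c)
    (hc' : IsChain (seat n (hat x)) (hat x) v' c') (h : chainGlider v c ∈ gliders x)
    (h' : chainGlider v' c' ∈ gliders x) {i j : ℕ} (hi : i < 2 * v) (hj : j < 2 * v')
    (e : c i = c' j) : v = v' ∧ c 0 = c' 0 := by
  have := glider_eq_of_hasStep hd h h' (hasStep_chainGlider.2 ⟨i, hi, rfl⟩)
    (hasStep_chainGlider.2 ⟨j, hj, e⟩)
  refine ⟨by rw [← hc.card_left, this, hc'.card_left], ?_⟩
  have h1 := chainGlider_isLeast hc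
  rw [this] at h1
  exact h1.unique (chainGlider_isLeast hc')

/-- A slot to the right of `p` exists because flat steps have seat `n`; `z` is the last mark before
the first such slot. -/
theorem exists_lastMark {n : ℕ} {w : ℤ → Bool} (hd : Drift n w) {v : ℕ} (hv : v ≤ n) {p : ℤ}
    (hp : Mark n w v p) : ∃ z, p ≤ z ∧ NoSlot n w v p z ∧ LastMark n w v z := by
  obtain ⟨r, hr1, hr2⟩ := hd.exists_flat_ge p
  obtain ⟨s, ⟨hs1, hs2⟩, hs3⟩ := Int.exists_least_of_bdd (P := fun s => p ≤ s ∧ v ≤ seat n w s)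
    ⟨p, fun z hz => hz.1⟩ ⟨r, hr1, by rw [seat_of_flat hr2]; exact hv⟩
  have hps : p < s := by
    rcases hs1.lt_or_eq with h | rfl
    · exact h
    · rw [Mark] at hp
      omega
  obtain ⟨z, ⟨hz1, hz2⟩, hz3⟩ := Int.exists_greatest_of_bdd
    (P := fun z => z < s ∧ Mark n w v z) ⟨s, fun z hz => hz.1.le⟩ ⟨p, hps, hp⟩
  have hlt : ∀ i, p ≤ i → i < s → seat n w i < v := by
    intro i hi his
    by_contra hc
    have := hs3 i ⟨hi, by omega⟩
    omega
  have hpz := hz3 p ⟨hps, hp⟩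
  refine ⟨z, hpz, fun i hi hiz => hlt i hi (by omega), hz2, s, hz1, hs2, fun i hi his => ?_⟩
  have h1 := hlt i (by omega) his
  have h2 : ¬ Mark n w v i := fun h => by
    have := hz3 i ⟨his, h⟩
    omega
  rw [Mark] at h2
  omega

/-- A mark is the first step of a glider if and only if its bit differs from that of the last mark
before the next higher seat. -/
theorem isFirst_iff {n : ℕ} {x : ZMod n → Bool} (hd : Drift n (hat x)) {v : ℕ} (hv : v ≤ n)
    {z : ℤ} (hz : LastMark n (hat x) v z) : ∀ {m : ℕ} {p : ℤ}, z - p ≤ m → p ≤ z →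
      Mark n (hat x) v p → NoSlot n (hat x) v p z → (IsFirst x v p ↔ hat x p ≠ hat x z) := by
  intro m
  induction m with
  | zero =>
    intro p hm hpz _ _
    obtain rfl : p = z := by simp at hm; omega
    simp only [ne_eq, not_true, iff_false]
    -- A glider that starts at the last mark would need a second mark before the next slot.
    intro h
    obtain ⟨c, hc1, hc, rfl⟩ := h.exists_chain hd
    obtain ⟨-, s, hs1, hs2, hs3⟩ := hz
    have hv1 := hc.pos
    have h1 := hc.strictMono (show 0 < v by omega) (by omega)
    have h2 := hc.mono (show v ≤ 2 * v - 1 by omega) (by omega)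
    rcases lt_or_ge (c v) s with h3 | h3
    · have := hs3 _ h1 h3
      have := hc.mark.2
      rw [Mark] at this
      omega
    · have := (hc.seat_lt hs1.le (by omega)).1
      omega
  | succ m ih =>
    intro p hm hpz hp hns
    push_cast at hm
    rcases hpz.lt_or_eq with hlt | rfl
    swap
    · exact ih (by omega) le_rfl hp hns
    obtain ⟨p₁, ⟨h1, h2⟩, h3⟩ := Int.exists_least_of_bdd
      (P := fun i => p < i ∧ Mark n (hat x) v i) ⟨p, fun z hz => hz.1.le⟩ ⟨z, hlt, hz.1⟩
    have h4 := h3 z ⟨hlt, hz.1⟩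
    have hno : ∀ i, p < i → i < p₁ → ¬ Mark n (hat x) v i := by
      intro i hi hip hm
      have := h3 i ⟨hi, hm⟩
      omega
    have halt := hp.alternate hd hv h2 h1 hno
    have hih := ih (p := p₁) (by omega) h4 h2 fun i hi hiz => hns i (by omega) hiz
    -- In a stretch without slots the marks are paired from the right: a mark is a first step
    -- exactly if the next mark is not. Since the bits alternate, this propagates the claim to the
    -- left.
    have key : IsFirst x v p ↔ ¬ IsFirst x v p₁ := by
      constructor
      · intro hf hf₁
        obtain ⟨c, hc1, hc, rfl⟩ := hf.exists_chain hd
        obtain ⟨c', hc1', hc', rfl⟩ := hf₁.exists_chain hd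
        have hv1 := hc.pos
        have g1 := hc.strictMono (show 0 < v by omega) (by omega)
        have g2 := hc.mono (show v ≤ 2 * v - 1 by omega) (by omega)
        have g3 := h3 _ ⟨g1, hc.mark.2⟩
        have g4 := (hc.seat_lt h1.le (by omega)).2.1 h2
        rcases g4 with g4 | g4
        · omega
        · have := chain_eq_of_common hd hc hc' hc1 hc1' (i := v) (j := 0) (by omega) (by omega)
            g4.symm
          omega
      · intro hf₁
        obtain ⟨δ, hδ, hs⟩ := exists_glider hd (h2.not_flat hv)
        obtain ⟨d, e, hd'⟩ := exists_isChain hd hδ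
        set l := speed δ
        rw [e] at hδ hs
        obtain ⟨j, hj, rfl⟩ := hasStep_chainGlider.1 hs
        have e1 := hd'.seat_eq hj
        have h2' := h2
        rw [Mark] at h2'
        rcases lt_trichotomy l v with hl | rfl | hl
        · split_ifs at e1 <;> omega
        · have : j = 0 ∨ j = l := by split_ifs at e1 <;> omega
          rcases this with rfl | rfl
          · exact absurd (hd'.isFirst hδ) hf₁
          · have g1 := hd'.strictMono (show 0 < l by omega) (by omega)
            have g2 := hd'.mono (show l ≤ 2 * l - 1 by omega) (by omega)
            rcases lt_trichotomy (d 0) p with g | g | g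
            · rcases (hd'.seat_lt g.le (by omega)).2.1 hp with g' | g' <;> omega
            · rw [← g]
              exact hd'.isFirst hδ
            · exact absurd hd'.mark.1 (hno _ g g1)
        -- In a faster glider the step before this one has seat `v`. To the left of `p` it would
        -- make the mark `p` violate the gap condition; from `p` on it would be a slot before `z`.
        · exfalso
          have hj0 : j ≠ 0 := by
            rintro rfl
            rw [if_pos (by omega)] at e1
            omega
          obtain ⟨i, rfl⟩ := Nat.exists_eq_succ_of_ne_zero hj0
          rw [Nat.succ_eq_add_one] at *
          have e2 := hd'.seat_eq (show i < 2 * l by omega)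
          have e3 : seat n (hat x) (d i) = v := by split_ifs at e1 e2 <;> omega
          have g1 := hd'.lt i hj
          rcases lt_or_ge (d i) p with g | g
          · have g3 := hd'.gap i hj p g h1
            rw [Mark] at hp
            omega
          · have := hns (d i) g (by omega)
            omega
    rw [key, hih, halt]
    cases hat x p₁ <;> cases hat x z <;> simp

theorem Mark.add {n : ℕ} {w : ℤ → Bool} (hd : Drift n w) {v : ℕ} {p : ℤ} (h : Mark n w v p)
    (t : ℤ) : Mark n w v (p + n * t) := by rwa [Mark, seat_add hd]

theorem NoSlot.add {n : ℕ} {w : ℤ → Bool} (hd : Drift n w) {v : ℕ} {p q : ℤ}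
    (h : NoSlot n w v p q) (t : ℤ) : NoSlot n w v (p + n * t) (q + n * t) := by
  intro i hi hiq
  have := h (i - n * t) (by omega) (by omega)
  rwa [← seat_add hd _ t, sub_add_cancel] at this

theorem LastMark.add {n : ℕ} {w : ℤ → Bool} (hd : Drift n w) {v : ℕ} {p : ℤ}
    (h : LastMark n w v p) (t : ℤ) : LastMark n w v (p + n * t) := by
  obtain ⟨h1, s, h2, h3, h4⟩ := h
  refine ⟨h1.add hd t, s + n * t, by omega, by rwa [seat_add hd], fun i hi his => ?_⟩
  have := h4 (i - n * t) (by omega) (by omega)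
  rwa [← seat_add hd _ t, sub_add_cancel] at this

theorem IsFirst.mark {n : ℕ} {x : ZMod n → Bool} (hd : Drift n (hat x)) {v : ℕ} {p : ℤ}
    (h : IsFirst x v p) : v ≤ n ∧ Mark n (hat x) v p := by
  obtain ⟨c, hc1, hc, rfl⟩ := h.exists_chain hd
  exact ⟨hc.speed_le hd hc1, hc.mark.1⟩

/-- By `isFirst_iff` the first steps depend only on seats and bits, which are periodic; the
recursive definition of gliders need not be translated. -/
theorem IsFirst.add {n : ℕ} {x : ZMod n → Bool} (hd : Drift n (hat x)) {v : ℕ} {p : ℤ}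
    (h : IsFirst x v p) (t : ℤ) : IsFirst x v (p + n * t) := by
  obtain ⟨hv, hp⟩ := h.mark hd
  obtain ⟨z, h1, h2, h3⟩ := exists_lastMark hd hv hp
  rw [isFirst_iff hd hv (h3.add hd t) (m := (z - p).toNat) (by omega) (by omega) (hp.add hd t)
    (h2.add hd t), hd.periodic_mul, hd.periodic_mul,
    ← isFirst_iff hd hv h3 (m := (z - p).toNat) (by omega) h1 hp h2]
  exact h

theorem shift_mem_gliders {n : ℕ} {x : ZMod n → Bool} (hd : Drift n (hat x)) {v : ℕ} {c : ℕ → ℤ}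
    (hc : IsChain (seat n (hat x)) (hat x) v c) (h : chainGlider v c ∈ gliders x) (t : ℤ) :
    chainGlider v (fun i => c i + n * t) ∈ gliders x := by
  obtain ⟨c', h1, h2, h3⟩ := ((hc.isFirst h).add hd t).exists_chain hd
  have e := (hc.shift hd t).unique h2 h3.symm
  have : chainGlider v (fun i => c i + n * t) = chainGlider v c' := by
    unfold chainGlider
    congr 1
    · exact Finset.image_congr fun i hi => e i (by simp at hi; omega)
    · exact Finset.image_congr fun i hi => e (v + i) (by simp at hi; omega)
  rwa [this]

/-- A mark belongs to a glider of speed `v` if and only if there is a mark before it, or its bit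
differs from that of the last mark. -/
theorem mem_glider_iff {n : ℕ} {x : ZMod n → Bool} (hd : Drift n (hat x)) {v : ℕ} (hv : v ≤ n)
    {z q : ℤ} (hz : LastMark n (hat x) v z) (hqz : q ≤ z) (hq : Mark n (hat x) v q)
    (hns : NoSlot n (hat x) v q z) :
    (∃ γ ∈ gliders x, speed γ = v ∧ HasStep γ q) ↔
      (∃ p < q, Mark n (hat x) v p ∧ NoSlot n (hat x) v p q) ∨ hat x q ≠ hat x z := by
  have hq1 := isFirst_iff hd hv hz (m := (z - q).toNat) (by omega) hqz hq hns
  constructor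
  · rintro ⟨γ, hγ, rfl, hs⟩
    obtain ⟨c, e, hc⟩ := exists_isChain hd hγ
    set v := speed γ
    have hv1 := hc.pos
    rw [e] at hγ hs
    obtain ⟨j, hj, rfl⟩ := hasStep_chainGlider.1 hs
    have h1 := hc.mono (Nat.zero_le j) hj
    have h2 := hc.mono (show j ≤ 2 * v - 1 by omega) (by omega)
    rcases (hc.seat_lt h1 h2).2.1 hq with h3 | h3
    · right
      rw [← hq1, h3]
      exact hc.isFirst hγ
    · left
      rw [h3]
      rw [h3] at h2
      exact ⟨c 0, hc.strictMono (by omega) (by omega), hc.mark.1,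
        fun i hi hi' => (hc.seat_lt hi (by omega)).1⟩
  · have hfirst : IsFirst x v q → ∃ γ ∈ gliders x, speed γ = v ∧ HasStep γ q :=
      fun ⟨γ, h1, h2, h3⟩ => ⟨γ, h1, h2, Or.inl h3.1⟩
    rintro (⟨p, h1, h2, h3⟩ | h)
    -- If the nearest mark `p'` to the left of `q` starts a glider, then `q` is its second mark;
    -- otherwise `q` starts one, by alternation of the bits.
    · obtain ⟨p', ⟨g1, g2, g3⟩, g4⟩ := Int.exists_greatest_of_bdd
        (P := fun p => p < q ∧ Mark n (hat x) v p ∧ NoSlot n (hat x) v p q)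
        ⟨q, fun z hz => hz.1.le⟩ ⟨p, h1, h2, h3⟩
      have hno : ∀ i, p' < i → i < q → ¬ Mark n (hat x) v i := by
        intro i hi hiq hm
        have := g4 i ⟨hiq, hm, fun j hj hjq => g3 j (by omega) hjq⟩
        omega
      have halt := g2.alternate hd hv hq g1 hno
      have hp' := isFirst_iff hd hv hz (m := (z - p').toNat) (by omega) (by omega) g2
        fun i hi hiz => by
          rcases le_or_gt i q with h | h
          · exact g3 i hi h
          · exact hns i h.le hiz
      by_cases hf : IsFirst x v p'
      · obtain ⟨c, hc1, hc, rfl⟩ := hf.exists_chain hd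
        have hv1 := hc.pos
        have k1 := hc.strictMono (show 0 < v by omega) (by omega)
        have k2 := hc.mono (show v ≤ 2 * v - 1 by omega) (by omega)
        rcases lt_trichotomy (c v) q with k | k | k
        · exact absurd hc.mark.2 (hno _ k1 k)
        · exact ⟨_, hc1, hc.card_left, hasStep_chainGlider.2 ⟨v, by omega, k.symm⟩⟩
        · rcases (hc.seat_lt g1.le (by omega)).2.1 hq with k' | k' <;> omega
      · rw [hp'] at hf
        refine hfirst (hq1.2 ?_)
        rw [halt] at hf
        cases h1 : hat x q <;> cases h2 : hat x z <;> simp_all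
    · exact hfirst (hq1.2 h)

/-! ### Coupled gliders -/

/-- Gliders of the same speed do not interleave. -/
theorem chain_last_lt {n : ℕ} {x : ZMod n → Bool} (hd : Drift n (hat x)) {v : ℕ} {c c' : ℕ → ℤ}
    (hc : IsChain (seat n (hat x)) (hat x) v c) (hc' : IsChain (seat n (hat x)) (hat x) v c')
    (h : chainGlider v c ∈ gliders x) (h' : chainGlider v c' ∈ gliders x) (hlt : c 0 < c' 0) :
    c (2 * v - 1) < c' 0 := by
  have hv := hc.pos
  by_contra hcon
  rcases (hc.seat_lt hlt.le (by omega)).2.1 hc'.mark.1 with h1 | h1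
  · omega
  · have := chain_eq_of_common hd hc hc' h h' (i := v) (j := 0) (by omega) (by omega) h1.symm
    omega

/-- If a glider that is at least as fast has a step to the right of the glider `c`, then its first
such step uses the highest seat of the glider `c` or a higher one. -/
theorem exists_seat_ge {n : ℕ} {x : ZMod n → Bool} (hd : Drift n (hat x)) {v m : ℕ}
    {c d : ℕ → ℤ} (hc : IsChain (seat n (hat x)) (hat x) v c)
    (hc' : IsChain (seat n (hat x)) (hat x) m d) (h : chainGlider v c ∈ gliders x)
    (h' : chainGlider m d ∈ gliders x) (hvm : v < m) {k : ℕ} (hk : k < 2 * m)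
    (hlt : c (2 * v - 1) < d k) :
    ∃ j ≤ k, c (2 * v - 1) < d j ∧ v ≤ seat n (hat x) (d j) := by
  have hv := hc.pos
  obtain ⟨j, hj1, hj2⟩ : ∃ j ≤ k, c (2 * v - 1) < d j ∧ ∀ i < j, d i ≤ c (2 * v - 1) := by
    classical
    have hex : ∃ j, c (2 * v - 1) < d j := ⟨k, hlt⟩
    exact ⟨Nat.find hex, Nat.find_min' hex hlt, Nat.find_spec hex,
      fun i hi => not_lt.1 (Nat.find_min hex hi)⟩
  refine ⟨j, hj1, hj2.1, ?_⟩
  have e1 := hc'.seat_eq (show j < 2 * m by omega)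
  rcases j with - | i
  · rw [if_pos (by omega)] at e1
    omega
  · have h1 := hj2.2 i (by omega)
    have hne : ∀ a < 2 * v, d i ≠ c a := by
      intro a ha e
      have := chain_eq_of_common hd hc hc' h h' ha (j := i) (by omega) e.symm
      omega
    have hgap := hc'.gap i (by omega)
    rcases lt_or_ge (d i) (c 0) with h2 | h2
    · have h3 := hc.mono (Nat.zero_le (2 * v - 1)) (by omega)
      have h4 := hgap (c 0) h2 (by omega)
      have h5 := hc.left 0 (by omega)
      omega
    · rcases hc.locate h2 h1 with ⟨a, ha, e⟩ | ⟨a, ha, h3, h4⟩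
      · exact absurd e (hne a ha)
      -- Here the seat increases from `d i` to `d (i + 1)`, which happens only at the turn from `0`
      -- to `m - 1`, and `v ≤ m - 1`.
      · have h5 := hc.gap a ha _ h3 h4
        have h6 := hc.mono (show a + 1 ≤ 2 * v - 1 by omega) (by omega)
        have h7 := hgap (c (a + 1)) h4 (by omega)
        have e2 := hc'.seat_eq (show i < 2 * m by omega)
        split_ifs at e1 e2 <;> omega

/-- Steps of slower gliders have seats below `v - 1`. Conversely, a step of a faster glider between
the two gliders comes with a slot (`exists_seat_ge`), and a step of another glider of speed `v`
comes with a first step. -/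
theorem coupled_iff {n : ℕ} {x : ZMod n → Bool} (hd : Drift n (hat x)) {v : ℕ} {c c' : ℕ → ℤ}
    (hc : IsChain (seat n (hat x)) (hat x) v c) (hc' : IsChain (seat n (hat x)) (hat x) v c')
    (h : chainGlider v c ∈ gliders x) (h' : chainGlider v c' ∈ gliders x) :
    Coupled x (chainGlider v c) (chainGlider v c') ↔ c 0 < c' 0 ∧
      NoSlot n (hat x) v (c 0) (c' 0) ∧ ∀ i, c 0 < i → i < c' 0 → ¬ IsFirst x v i := by
  have hv := hc.pos
  have hle := hc.mono (Nat.zero_le (2 * v - 1)) (by omega)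
  constructor
  · rintro ⟨-, -, -, p, q, hp, hq, hpq, hsmall⟩
    obtain rfl := hp.unique (chainGlider_isGreatest hc)
    obtain rfl := hq.unique (chainGlider_isLeast hc')
    rw [hc.card_left] at hsmall
    have hlow : ∀ i, c (2 * v - 1) < i → i < c' 0 → seat n (hat x) i + 1 < v := by
      intro i hi hi'
      obtain ⟨δ, hδ, hs, hsp⟩ := hsmall i hi hi'
      obtain ⟨d, e, hd'⟩ := exists_isChain hd hδ
      change HasStep δ i at hs
      rw [e] at hs
      obtain ⟨j, hj, rfl⟩ := hasStep_chainGlider.1 hs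
      have := hd'.seat_eq hj
      split_ifs at this <;> omega
    refine ⟨by omega, fun i hi hi' => ?_, fun i hi hi' hf => ?_⟩
    · rcases le_or_gt i (c (2 * v - 1)) with h1 | h1
      · exact (hc.seat_lt hi h1).1
      · rcases hi'.lt_or_eq with h2 | rfl
        · have := hlow i h1 h2
          omega
        · have := hc'.mark.1
          rw [Mark] at this
          omega
    · obtain ⟨d, hd1, hd', rfl⟩ := hf.exists_chain hd
      have hm := hd'.mark.1
      rcases le_or_gt (d 0) (c (2 * v - 1)) with h1 | h1
      · rcases (hc.seat_lt hi.le h1).2.1 hm with h2 | h2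
        · omega
        · have := chain_eq_of_common hd hd' hc hd1 h (i := 0) (j := v) (by omega) (by omega) h2
          omega
      · have := hlow _ h1 hi'
        rw [Mark] at hm
        omega
  · rintro ⟨h1, h2, h3⟩
    have hlast := chain_last_lt hd hc hc' h h' h1
    refine ⟨h, h', by rw [hc.card_left, hc'.card_left], _, _, chainGlider_isGreatest hc,
      chainGlider_isLeast hc', hlast, fun i hi hi' => ?_⟩
    have hvn := hc.speed_le hd h
    have hi2 := h2 i (by omega) hi'.le
    have hnf : ¬ Flat (hat x) i := (seat_lt_iff hd).1 (by omega)
    obtain ⟨δ, hδ, hs⟩ := exists_glider hd hnf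
    refine ⟨δ, hδ, hs, ?_⟩
    rw [hc.card_left]
    by_contra hcon
    obtain ⟨d, e, hd'⟩ := exists_isChain hd hδ
    set m := speed δ
    rw [e] at hδ hs
    obtain ⟨j, hj, rfl⟩ := hasStep_chainGlider.1 hs
    rcases (not_lt.1 hcon).lt_or_eq with hvm | rfl
    · obtain ⟨k, hk, g1, g2⟩ := exists_seat_ge hd hc hd' h hδ hvm hj hi
      have g3 := hd'.mono hk hj
      have := h2 (d k) (by omega) (by omega)
      omega
    · have g1 := hd'.mono (Nat.zero_le j) hj
      have g2 := hd'.mono (show j ≤ 2 * m - 1 by omega) (by omega)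
      rcases lt_trichotomy (d 0) (c 0) with g | g | g
      · have := chain_last_lt hd hd' hc hδ h g
        omega
      · have := hd'.unique hc g (2 * m - 1) (by omega)
        omega
      · exact h3 (d 0) g (by omega) (hd'.isFirst hδ)

/-! ### Trains -/

theorem exists_slot_left {n : ℕ} {w : ℤ → Bool} (hd : Drift n w) {v : ℕ} (hv : v ≤ n) (p : ℤ) :
    ∃ s < p, v ≤ seat n w s := by
  obtain ⟨s, h1, h2⟩ := hd.exists_flat_lt p
  exact ⟨s, h1, by rwa [seat_of_flat h2]⟩

/-- The partner is the glider with the rightmost first step before `c' 0`. -/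
theorem coupled_of_noSlot {n : ℕ} {x : ZMod n → Bool} (hd : Drift n (hat x)) {v : ℕ} {c' : ℕ → ℤ}
    (hc' : IsChain (seat n (hat x)) (hat x) v c') (h' : chainGlider v c' ∈ gliders x) {p : ℤ}
    (hp : IsFirst x v p) (hpc : p < c' 0) (hns : NoSlot n (hat x) v p (c' 0)) :
    ∃ c, chainGlider v c ∈ gliders x ∧ IsChain (seat n (hat x)) (hat x) v c ∧ p ≤ c 0 ∧
      c 0 < c' 0 ∧ Coupled x (chainGlider v c) (chainGlider v c') := by
  obtain ⟨p', ⟨h1, h2⟩, h3⟩ := Int.exists_greatest_of_bdd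
    (P := fun i => i < c' 0 ∧ IsFirst x v i) ⟨c' 0, fun z hz => hz.1.le⟩ ⟨p, hpc, hp⟩
  have hpp := h3 p ⟨hpc, hp⟩
  obtain ⟨c, hc1, hc, rfl⟩ := h2.exists_chain hd
  refine ⟨c, hc1, hc, hpp, h1, (coupled_iff hd hc hc' hc1 h').2
    ⟨h1, fun i hi hi' => hns i (by omega) hi', fun i hi hi' hf => ?_⟩⟩
  have := h3 i ⟨hi', hf⟩
  omega

theorem mem_train_of_noSlot {n : ℕ} {x : ZMod n → Bool} (hd : Drift n (hat x)) {v : ℕ}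
    {c : ℕ → ℤ} (hc : IsChain (seat n (hat x)) (hat x) v c) (h : chainGlider v c ∈ gliders x)
    {m : ℕ} : ∀ {c' : ℕ → ℤ}, IsChain (seat n (hat x)) (hat x) v c' →
      chainGlider v c' ∈ gliders x → c' 0 - c 0 ≤ m → c 0 ≤ c' 0 →
      NoSlot n (hat x) v (c 0) (c' 0) → chainGlider v c' ∈ train x (chainGlider v c) := by
  have hpos := hc.pos
  have hsame : ∀ {c' : ℕ → ℤ}, IsChain (seat n (hat x)) (hat x) v c' →
      chainGlider v c' ∈ gliders x → c 0 = c' 0 →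
      chainGlider v c' ∈ train x (chainGlider v c) := by
    intro c' hc' h' e
    rw [glider_eq_of_hasStep hd h h' (hasStep_chainGlider.2 ⟨0, by omega, rfl⟩)
      (hasStep_chainGlider.2 ⟨0, by omega, e⟩)]
    exact .refl _
  induction m with
  | zero =>
    intro c' hc' h' hm hle _
    exact hsame hc' h' (by simp at hm; omega)
  | succ m ih =>
    intro c' hc' h' hm hle hns
    push_cast at hm
    rcases hle.lt_or_eq with hlt | e
    · obtain ⟨c'', g1, g2, g3, g4, g5⟩ := coupled_of_noSlot hd hc' h' (hc.isFirst h) hlt hns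
      have := ih g2 g1 (by omega) g3 fun i hi hi' => hns i hi (by omega)
      exact .trans _ _ _ this (.rel _ _ g5)
    · exact hsame hc' h' e

/-- The slots to the left of a glider. -/
def leftSlots {n : ℕ} (x : ZMod n → Bool) (γ : Glider) : Set ℤ :=
  {s | γ ∈ gliders x ∧ speed γ ≤ seat n (hat x) s ∧ ∀ p ∈ γ.1, s < p}

theorem mem_leftSlots {n : ℕ} {x : ZMod n → Bool} {v : ℕ} {c : ℕ → ℤ}
    (hc : IsChain (seat n (hat x)) (hat x) v c) (h : chainGlider v c ∈ gliders x) {s : ℤ} :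
    s ∈ leftSlots x (chainGlider v c) ↔ v ≤ seat n (hat x) s ∧ s < c 0 := by
  have hl := chainGlider_isLeast hc
  constructor
  · rintro ⟨-, h1, h2⟩
    rw [hc.card_left] at h1
    exact ⟨h1, h2 _ (by simpa using hl.1)⟩
  · rintro ⟨h1, h2⟩
    refine ⟨h, by rwa [hc.card_left], fun p hp => ?_⟩
    have := hl.2 (by simpa using hp)
    omega

/-- The set of slots to the left is the invariant that passes through the equivalence relation
generated by coupling: there is no slot between the first steps of coupled gliders. -/
theorem leftSlots_eq_of_coupled {n : ℕ} {x : ZMod n → Bool} (hd : Drift n (hat x)) {γ γ' : Glider}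
    (h : Coupled x γ γ') : speed γ = speed γ' ∧ leftSlots x γ = leftSlots x γ' := by
  have h' := h
  obtain ⟨h1, h2, h3, -⟩ := h'
  refine ⟨h3, ?_⟩
  obtain ⟨c, e, hc⟩ := exists_isChain hd h1
  obtain ⟨c', e', hc'⟩ := exists_isChain hd h2
  rw [← h3] at e' hc'
  set v := speed γ
  rw [e] at h1 h
  rw [e'] at h2 h
  rw [coupled_iff hd hc hc' h1 h2] at h
  rw [e, e']
  ext s
  rw [mem_leftSlots hc h1, mem_leftSlots hc' h2]
  refine ⟨fun g => ⟨g.1, by omega⟩, fun g => ⟨g.1, ?_⟩⟩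
  by_contra hcon
  have := h.2.1 s (by omega) g.2.le
  omega

theorem leftSlots_eq_of_mem_train {n : ℕ} {x : ZMod n → Bool} (hd : Drift n (hat x))
    {γ γ' : Glider} (h : γ' ∈ train x γ) : speed γ = speed γ' ∧ leftSlots x γ = leftSlots x γ' := by
  change Relation.EqvGen (Coupled x) γ γ' at h
  induction h with
  | rel a b h => exact leftSlots_eq_of_coupled hd h
  | refl a => exact ⟨rfl, rfl⟩
  | symm a b _ ih => exact ⟨ih.1.symm, ih.2.symm⟩
  | trans a b c _ _ h1 h2 => exact ⟨h1.1.trans h2.1, h1.2.trans h2.2⟩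

theorem noSlot_of_mem_train {n : ℕ} {x : ZMod n → Bool} (hd : Drift n (hat x)) {v : ℕ}
    {c : ℕ → ℤ} (hc : IsChain (seat n (hat x)) (hat x) v c) (h : chainGlider v c ∈ gliders x)
    {γ : Glider} (hγ : γ ∈ train x (chainGlider v c)) :
    ∃ c', γ = chainGlider v c' ∧ γ ∈ gliders x ∧ IsChain (seat n (hat x)) (hat x) v c' ∧
      NoSlot n (hat x) v (c 0) (c' 0) ∧ NoSlot n (hat x) v (c' 0) (c 0) := by
  obtain ⟨h1, h2⟩ := leftSlots_eq_of_mem_train hd hγ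
  rw [hc.card_left] at h1
  obtain ⟨s, hs1, hs2⟩ := exists_slot_left hd (hc.speed_le hd h) (c 0)
  have hs3 := (mem_leftSlots hc h).2 ⟨hs2, hs1⟩
  rw [h2] at hs3
  -- `leftSlots` is empty for a pair that is not a glider, so the slot `s` shows that `γ` is one.
  have hγ' := hs3.1
  obtain ⟨c', e, hc'⟩ := exists_isChain hd hγ'
  rw [← h1] at e hc'
  refine ⟨c', e, hγ', hc', fun i hi hi' => ?_, fun i hi hi' => ?_⟩
  · by_contra hcon
    have hm := hc'.mark.1
    have : i ≠ c' 0 := by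
      rintro rfl
      rw [Mark] at hm
      omega
    rw [e] at h2 hγ'
    have g := (mem_leftSlots hc' hγ').2 ⟨not_lt.1 hcon, by omega⟩
    rw [← h2, mem_leftSlots hc h] at g
    omega
  · by_contra hcon
    have hm := hc.mark.1
    have : i ≠ c 0 := by
      rintro rfl
      rw [Mark] at hm
      omega
    have g := (mem_leftSlots hc h).2 ⟨not_lt.1 hcon, by omega⟩
    rw [e] at h2 hγ'
    rw [h2, mem_leftSlots hc' hγ'] at g
    omega

/-- The elements of `T` that are not related to an earlier one. -/
def IsHeadOf (T : Set ℤ) (R : ℤ → ℤ → Prop) (q : ℤ) : Prop := q ∈ T ∧ ¬ ∃ p ∈ T, p < q ∧ R p q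

/-- The number of elements of `T` from `q` on that are related to `q`. -/
noncomputable def sizeOf (T : Set ℤ) (R : ℤ → ℤ → Prop) (q : ℤ) : ℕ :=
  {p | p ∈ T ∧ q ≤ p ∧ R q p}.ncard

theorem exists_isHead_iff {n : ℕ} {x : ZMod n → Bool} (hd : Drift n (hat x)) {v : ℕ} {p : ℤ} :
    (∃ γ, IsHead x v p γ) ↔ IsHeadOf {p | IsFirst x v p} (NoSlot n (hat x) v) p := by
  constructor
  · rintro ⟨γ, h1, h2, h3, h4⟩
    have hf : IsFirst x v p := ⟨γ, h1, h2, h3⟩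
    refine ⟨hf, ?_⟩
    rintro ⟨p', h5, h6, h7⟩
    obtain ⟨c, g1, g2, rfl⟩ := hf.exists_chain hd
    obtain ⟨c', k1, k2, k3, k4, k5⟩ := coupled_of_noSlot hd g2 g1 h5 h6 h7
    have : γ = chainGlider v c := glider_eq_of_hasStep hd h1 g1 (Or.inl h3.1)
      (Or.inl (chainGlider_isLeast g2).1)
    exact h4 ⟨_, this ▸ k5⟩
  · rintro ⟨hf, h⟩
    obtain ⟨c, g1, g2, rfl⟩ := IsFirst.exists_chain hd hf
    refine ⟨_, g1, g2.card_left, chainGlider_isLeast g2, ?_⟩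
    rintro ⟨γ, hγ⟩
    have hγ' := hγ
    obtain ⟨h1, -, h2, -⟩ := hγ'
    rw [g2.card_left] at h2
    obtain ⟨c', e, hc'⟩ := exists_isChain hd h1
    rw [h2] at e hc'
    rw [e] at h1 hγ
    rw [coupled_iff hd hc' g2 h1 g1] at hγ
    exact h ⟨c' 0, hc'.isFirst h1, hγ.1, hγ.2.1⟩

theorem trainSize_eq {n : ℕ} {x : ZMod n → Bool} (hd : Drift n (hat x)) {v : ℕ} {p : ℤ}
    (hp : IsHeadOf {p | IsFirst x v p} (NoSlot n (hat x) v) p) :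
    trainSize x v p = sizeOf {p | IsFirst x v p} (NoSlot n (hat x) v) p := by
  obtain ⟨γ, hγ⟩ := (exists_isHead_iff hd).2 hp
  have hγ' := hγ
  obtain ⟨h1, h2, h3, h4⟩ := hγ'
  obtain ⟨c, e, hc⟩ := exists_isChain hd h1
  rw [h2] at e hc
  subst e
  obtain rfl := h3.unique (chainGlider_isLeast hc)
  unfold trainSize sizeOf
  have hfirst : ∀ {γ' : Glider}, (∃ γ, IsHead x v (c 0) γ ∧ γ' ∈ train x γ) →
      γ' ∈ train x (chainGlider v c) := by
    rintro γ' ⟨γ, ⟨g1, g2, g3, g4⟩, g5⟩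
    rwa [glider_eq_of_hasStep hd g1 h1 (Or.inl g3.1) (Or.inl h3.1)] at g5
  symm
  refine Set.ncard_congr' (Equiv.ofBijective
    (α := {p | p ∈ {p | IsFirst x v p} ∧ c 0 ≤ p ∧ NoSlot n (hat x) v (c 0) p})
    (fun q => ⟨chainGlider v (IsFirst.exists_chain hd q.2.1).choose, ?_⟩) ⟨?_, ?_⟩)
  · obtain ⟨g1, g2, g3⟩ := (IsFirst.exists_chain hd q.2.1).choose_spec
    exact ⟨_, hγ, mem_train_of_noSlot hd hc h1 g2 g1 (m := (q.1 - c 0).toNat)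
      (by have := q.2.2.1; omega) (by rw [g3]; exact q.2.2.1) (by rw [g3]; exact q.2.2.2)⟩
  · intro q q' hq
    have hq := congrArg Subtype.val hq
    simp only at hq
    obtain ⟨g1, g2, g3⟩ := (IsFirst.exists_chain hd q.2.1).choose_spec
    obtain ⟨g1', g2', g3'⟩ := (IsFirst.exists_chain hd q'.2.1).choose_spec
    have k := chainGlider_isLeast g2
    rw [hq] at k
    have := k.unique (chainGlider_isLeast g2')
    rw [g3, g3'] at this
    exact Subtype.ext this
  · rintro ⟨γ', hγ'⟩
    obtain ⟨c', rfl, g1, g2, g3, g4⟩ := noSlot_of_mem_train hd hc h1 (hfirst hγ')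
    have hle : c 0 ≤ c' 0 := by
      by_contra hcon
      exact hp.2 ⟨c' 0, g2.isFirst g1, by omega, g4⟩
    refine ⟨⟨c' 0, g2.isFirst g1, hle, g3⟩, Subtype.ext ?_⟩
    obtain ⟨k1, k2, k3⟩ := (g2.isFirst g1).exists_chain hd |>.choose_spec
    exact glider_eq_of_hasStep hd k1 g1 (Or.inl (chainGlider_isLeast k2).1)
      (Or.inl (by rw [k3]; exact (chainGlider_isLeast g2).1))

open Classical in
/-- The cyclic list of the sizes of the classes of `T`. -/
noncomputable def cycleOf (n : ℕ) (T : Set ℤ) (R : ℤ → ℤ → Prop) : Cycle ℕ :=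
  ((((Finset.Icc (1 : ℤ) n).filter fun p => IsHeadOf T R p).sort (· ≤ ·)).map (sizeOf T R) :
    List ℕ)

theorem trainSizes_eq_cycleOf {n : ℕ} {x : ZMod n → Bool} (hd : Drift n (hat x)) (v : ℕ) :
    trainSizes x v = cycleOf n {p | IsFirst x v p} (NoSlot n (hat x) v) := by
  classical
  have e : ((Finset.Icc (1 : ℤ) n).filter fun p => ∃ γ, IsHead x v p γ) =
      (Finset.Icc (1 : ℤ) n).filter fun p =>
        IsHeadOf {p | IsFirst x v p} (NoSlot n (hat x) v) p :=
    Finset.filter_congr fun p _ => exists_isHead_iff hd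
  unfold trainSizes cycleOf
  rw [e]
  congr 1
  refine List.map_congr_left fun p hp => trainSize_eq hd ?_
  have := (Finset.mem_sort _).1 hp
  exact (Finset.mem_filter.1 this).2

/-! ### Cyclic lists -/

theorem sort_insert_max {s : Finset ℤ} {a : ℤ} (h : ∀ b ∈ s, b < a) :
    (insert a s).sort (· ≤ ·) = s.sort (· ≤ ·) ++ [a] := by
  refine List.Perm.eq_of_pairwise' (r := (· ≤ ·)) (Finset.pairwise_sort _ _) ?_ ?_
  · rw [List.pairwise_append]
    refine ⟨Finset.pairwise_sort _ _, by simp, fun b hb c hc => ?_⟩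
    have := h b ((Finset.mem_sort _).1 hb)
    simp at hc
    omega
  · refine List.perm_of_nodup_nodup_toFinset_eq (Finset.sort_nodup _ _) ?_ ?_
    · rw [List.nodup_append]
      refine ⟨Finset.sort_nodup _ _, by simp, fun b hb c hc => ?_⟩
      have := h b ((Finset.mem_sort _).1 hb)
      simp at hc
      omega
    · ext b
      simp

theorem sort_image {s : Finset ℤ} {e : ℤ → ℤ} (h : StrictMonoOn e s) :
    (s.image e).sort (· ≤ ·) = (s.sort (· ≤ ·)).map e := by
  refine List.Perm.eq_of_pairwise' (r := (· ≤ ·)) (Finset.pairwise_sort _ _) ?_ ?_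
  · rw [List.pairwise_map]
    refine (Finset.pairwise_sort s (· ≤ ·)).imp_of_mem fun {a b} ha hb hab => ?_
    exact h.monotoneOn (by simpa using ha) (by simpa using hb) hab
  · refine List.perm_of_nodup_nodup_toFinset_eq (Finset.sort_nodup _ _) ?_ ?_
    · refine List.Nodup.map_on (fun a ha b hb e => ?_) (Finset.sort_nodup _ _)
      exact h.injOn (by simpa using ha) (by simpa using hb) e
    · ext b
      simp

open Classical in
/-- The values of `s` on the elements of `H` in a window of length `n`. -/
noncomputable def window (n : ℕ) (H : Set ℤ) (s : ℤ → ℕ) (a : ℤ) : Cycle ℕ :=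
  ((((Finset.Ioc a (a + n)).filter (· ∈ H)).sort (· ≤ ·)).map s : List ℕ)

/-- Moving the window by one changes nothing or moves the first entry to the end, which is a
rotation of the list. -/
theorem window_succ {n : ℕ} (hn : 0 < n) {H : Set ℤ} {s : ℤ → ℕ} (hH : ∀ p : ℤ, p + n ∈ H ↔ p ∈ H)
    (hs : ∀ p ∈ H, s (p + n) = s p) (a : ℤ) : window n H s a = window n H s (a + 1) := by
  classical
  unfold window
  have e1 : Finset.Ioc a (a + n) = insert (a + 1) (Finset.Ioc (a + 1) (a + n)) := by
    ext i
    simp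
    omega
  have e2 : Finset.Ioc (a + 1) (a + 1 + n) = insert (a + 1 + n) (Finset.Ioc (a + 1) (a + n)) := by
    ext i
    simp
    omega
  rw [e1, e2, Finset.filter_insert, Finset.filter_insert]
  by_cases ha : a + 1 ∈ H
  · rw [if_pos ha, if_pos ((hH _).2 ha), Finset.sort_insert, sort_insert_max, List.map_cons,
      List.map_append, Cycle.coe_cons_eq_coe_append]
    · simp [hs _ ha]
    · intro b hb
      simp at hb
      omega
    · intro b hb
      simp at hb
      omega
    · simp
  · rw [if_neg ha, if_neg (by rwa [hH])]

theorem window_eq {n : ℕ} (hn : 0 < n) {H : Set ℤ} {s : ℤ → ℕ} (hH : ∀ p : ℤ, p + n ∈ H ↔ p ∈ H)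
    (hs : ∀ p ∈ H, s (p + n) = s p) (a : ℤ) : window n H s a = window n H s 0 := by
  induction a with
  | zero => rfl
  | succ a ih => rw [← window_succ hn hH hs, ih]
  | pred a ih => rw [window_succ hn hH hs, sub_add_cancel, ih]

theorem cycleOf_eq_window (n : ℕ) (T : Set ℤ) (R : ℤ → ℤ → Prop) :
    cycleOf n T R = window n {p | IsHeadOf T R p} (sizeOf T R) 0 := by
  classical
  have : Finset.Icc (1 : ℤ) n = Finset.Ioc (0 : ℤ) (0 + n) := by
    ext i
    simp
    omega
  unfold cycleOf window
  rw [this]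
  rfl

/-- An increasing change of representatives that commutes with translation by `n` only affects where
the period is cut, and `window_eq` makes the cut irrelevant. -/
theorem cycleOf_image {n : ℕ} (hn : 0 < n) {T : Set ℤ} {R R' : ℤ → ℤ → Prop} {e : ℤ → ℤ}
    (hT : ∀ p : ℤ, p + n ∈ T ↔ p ∈ T) (hR : ∀ p q, R (p + n) (q + n) ↔ R p q)
    (he : StrictMonoOn e T) (hen : ∀ p ∈ T, e (p + n) = e p + n)
    (hRR : ∀ p ∈ T, ∀ q ∈ T, p ≤ q → (R' (e p) (e q) ↔ R p q)) :
    cycleOf n T R = cycleOf n (e '' T) R' := by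
  classical
  have hhead : ∀ p ∈ T, IsHeadOf (e '' T) R' (e p) ↔ IsHeadOf T R p := by
    intro p hp
    unfold IsHeadOf
    refine and_congr (iff_of_true (Set.mem_image_of_mem _ hp) hp) (not_congr ⟨?_, ?_⟩)
    · rintro ⟨_, ⟨q, hq, rfl⟩, h1, h2⟩
      rw [he.lt_iff_lt hq hp] at h1
      exact ⟨q, hq, h1, (hRR q hq p hp h1.le).1 h2⟩
    · rintro ⟨q, hq, h1, h2⟩
      exact ⟨e q, Set.mem_image_of_mem _ hq, he hq hp h1, (hRR q hq p hp h1.le).2 h2⟩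
  have hsize : ∀ p ∈ T, sizeOf (e '' T) R' (e p) = sizeOf T R p := by
    intro p hp
    unfold sizeOf
    rw [← Set.InjOn.ncard_image (f := e) (s := {q | q ∈ T ∧ p ≤ q ∧ R p q})
      (he.injOn.mono fun q hq => hq.1)]
    congr 1
    ext r
    constructor
    · rintro ⟨⟨q, hq, rfl⟩, h1, h2⟩
      rw [he.le_iff_le hp hq] at h1
      exact ⟨q, ⟨hq, h1, (hRR p hp q hq h1).1 h2⟩, rfl⟩
    · rintro ⟨q, ⟨hq, h1, h2⟩, rfl⟩
      exact ⟨⟨q, hq, rfl⟩, he.monotoneOn hp hq h1, (hRR p hp q hq h1).2 h2⟩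
  have hH : ∀ p : ℤ, p + n ∈ {p | IsHeadOf T R p} ↔ p ∈ {p | IsHeadOf T R p} := by
    intro p
    refine and_congr (hT p) (not_congr ⟨?_, ?_⟩)
    · rintro ⟨q, hq, h1, h2⟩
      refine ⟨q - n, ?_, by omega, ?_⟩
      · rwa [← hT, sub_add_cancel]
      · rwa [← hR, sub_add_cancel]
    · rintro ⟨q, hq, h1, h2⟩
      exact ⟨q + n, (hT q).2 hq, by omega, (hR q p).2 h2⟩
  have hs : ∀ p ∈ {p | IsHeadOf T R p}, sizeOf T R (p + n) = sizeOf T R p := by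
    intro p hp
    unfold sizeOf
    rw [← Set.ncard_image_of_injective {q | q ∈ T ∧ p ≤ q ∧ R p q} (add_left_injective (n : ℤ))]
    congr 1
    ext r
    constructor
    · rintro ⟨hr, h1, h2⟩
      refine ⟨r - n, ⟨?_, by omega, ?_⟩, by simp⟩
      · rwa [← hT, sub_add_cancel]
      · rwa [← hR, sub_add_cancel]
    · rintro ⟨q, ⟨hq, h1, h2⟩, rfl⟩
      exact ⟨(hT q).2 hq, by simpa using h1, (hR p q).2 h2⟩
  rw [cycleOf_eq_window]
  rcases Set.eq_empty_or_nonempty {p | IsHeadOf T R p} with h0 | ⟨p₀, hp₀⟩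
  · have h0' : ∀ q, ¬ IsHeadOf (e '' T) R' q := by
      intro q hq
      obtain ⟨p, hp, rfl⟩ := hq.1
      exact Set.eq_empty_iff_forall_notMem.1 h0 p ((hhead p hp).1 hq)
    rw [h0]
    unfold cycleOf window
    simp [h0']
  · have hmul : ∀ (t : ℕ), (p₀ + n * t ∈ {p | IsHeadOf T R p} ∧ e (p₀ + n * t) = e p₀ + n * t) ∧
        (p₀ - n * t ∈ {p | IsHeadOf T R p} ∧ e (p₀ - n * t) = e p₀ - n * t) := by
      intro t
      induction t with
      | zero => simpa using hp₀
      | succ t ih =>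
        obtain ⟨⟨h1, h2⟩, h3, h4⟩ := ih
        have e1 : p₀ + n * ((t + 1 : ℕ) : ℤ) = p₀ + n * t + n := by push_cast; ring
        have e2 : p₀ - n * (t : ℤ) = p₀ - n * ((t + 1 : ℕ) : ℤ) + n := by push_cast; ring
        rw [e1]
        refine ⟨⟨(hH _).2 h1, ?_⟩, ?_, ?_⟩
        · rw [hen _ h1.1, h2]
          push_cast
          ring
        · rw [e2] at h3
          exact (hH _).1 h3
        · have h5 := h3
          rw [e2, hH] at h5
          rw [e2, hen _ h5.1] at h4
          push_cast at h4 ⊢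
          linarith
    -- `m` is the first head with image at least 1, so the heads in the period from `m` on are those
    -- with image in `1, …, n`. The translates of `p₀` show that such heads exist and are bounded
    -- below.
    obtain ⟨m, ⟨hm1, hm2⟩, hm3⟩ := Int.exists_least_of_bdd
      (P := fun p => p ∈ {p | IsHeadOf T R p} ∧ 1 ≤ e p)
      ⟨p₀ - n * (e p₀).toNat, fun z hz => by
        by_contra hc
        obtain ⟨-, h3, h4⟩ := hmul (e p₀).toNat
        have := he hz.1.1 h3.1 (not_le.1 hc)
        have h6 : (1 : ℤ) ≤ n := by omega
        have h7 := Int.self_le_toNat (e p₀)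
        have h8 := hz.2
        nlinarith⟩
      ⟨p₀ + n * (1 - e p₀).toNat, (hmul _).1.1, by
        obtain ⟨⟨h1, h2⟩, -⟩ := hmul (1 - e p₀).toNat
        rw [h2]
        have h6 : (1 : ℤ) ≤ n := by omega
        have h7 := Int.self_le_toNat (1 - e p₀)
        nlinarith⟩
    rw [← window_eq hn hH hs (m - 1)]
    have hset : (Finset.Icc (1 : ℤ) n).filter (fun p => IsHeadOf (e '' T) R' p) =
        ((Finset.Ioc (m - 1) (m - 1 + n)).filter (· ∈ {p | IsHeadOf T R p})).image e := by
      ext q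
      simp only [Finset.mem_filter, Finset.mem_Icc, Finset.mem_image, Finset.mem_Ioc]
      constructor
      · rintro ⟨⟨h1, h2⟩, h3⟩
        obtain ⟨p, hp, rfl⟩ := h3.1
        have hpH := (hhead p hp).1 h3
        have h4 := hm3 p ⟨hpH, h1⟩
        refine ⟨p, ⟨⟨by omega, ?_⟩, hpH⟩, rfl⟩
        by_contra hc
        have h5 : p - n ∈ {p | IsHeadOf T R p} := by rwa [← hH, sub_add_cancel]
        have h6 := he.monotoneOn hm1.1 h5.1 (by omega)
        have h7 := hen _ h5.1
        rw [sub_add_cancel] at h7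
        omega
      · rintro ⟨p, ⟨⟨h1, h2⟩, h3⟩, rfl⟩
        have h4 := he.monotoneOn hm1.1 h3.1 (by omega)
        have h5 : p - n ∈ {p | IsHeadOf T R p} := by rwa [← hH, sub_add_cancel]
        have h7 := hen _ h5.1
        rw [sub_add_cancel] at h7
        refine ⟨⟨by omega, ?_⟩, (hhead p h3.1).2 h3⟩
        by_contra hc
        have := hm3 (p - n) ⟨h5, by omega⟩
        omega
    unfold cycleOf window
    rw [hset, sort_image (he.mono fun p hp => by simp at hp; exact hp.2.1), List.map_map]
    congr 1
    refine List.map_congr_left fun p hp => ?_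
    have := (Finset.mem_sort _).1 hp
    simp only [Finset.mem_filter] at this
    exact (hsize p this.2.1).symm

/-! ### Gliders represented by marks of a given bit -/

/-- The marks with bit `b` that belong to gliders of speed `v`. -/
def gliderMarks {n : ℕ} (x : ZMod n → Bool) (v : ℕ) (b : Bool) : Set ℤ :=
  {q | Mark n (hat x) v q ∧ hat x q = b ∧ ∃ γ ∈ gliders x, speed γ = v ∧ HasStep γ q}

/-- The glider of speed `v` with first step `p` has its mark with bit `b` at `q`. -/
def IsRep {n : ℕ} (x : ZMod n → Bool) (v : ℕ) (b : Bool) (p q : ℤ) : Prop :=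
  ∃ c, chainGlider v c ∈ gliders x ∧ IsChain (seat n (hat x)) (hat x) v c ∧ c 0 = p ∧
    (q = c 0 ∨ q = c v) ∧ hat x q = b

/-- The two marks `c 0` and `c v` of a glider have opposite bits. -/
theorem IsFirst.exists_isRep {n : ℕ} {x : ZMod n → Bool} (hd : Drift n (hat x)) {v : ℕ} {p : ℤ}
    (h : IsFirst x v p) (b : Bool) : ∃ q, IsRep x v b p q := by
  obtain ⟨c, h1, h2, h3⟩ := h.exists_chain hd
  have hv := h2.pos
  have h4 := (h2.colour 0 (by omega)).2
  simp only [add_zero] at h4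
  by_cases hb : hat x (c 0) = b
  · exact ⟨c 0, c, h1, h2, h3, Or.inl rfl, hb⟩
  · refine ⟨c v, c, h1, h2, h3, Or.inr rfl, ?_⟩
    rw [h4]
    cases b <;> simpa using hb

theorem IsRep.isFirst {n : ℕ} {x : ZMod n → Bool} {v : ℕ} {b : Bool} {p q : ℤ}
    (h : IsRep x v b p q) : IsFirst x v p := by
  obtain ⟨c, h1, h2, rfl, -⟩ := h
  exact h2.isFirst h1

theorem IsRep.mem {n : ℕ} {x : ZMod n → Bool} {v : ℕ} {b : Bool} {p q : ℤ}
    (h : IsRep x v b p q) : q ∈ gliderMarks x v b := by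
  obtain ⟨c, h1, h2, rfl, h3, h4⟩ := h
  have hv := h2.pos
  rcases h3 with rfl | rfl
  · exact ⟨h2.mark.1, h4, _, h1, h2.card_left, hasStep_chainGlider.2 ⟨0, by omega, rfl⟩⟩
  · exact ⟨h2.mark.2, h4, _, h1, h2.card_left, hasStep_chainGlider.2 ⟨v, by omega, rfl⟩⟩

theorem exists_isRep_of_mem {n : ℕ} {x : ZMod n → Bool} (hd : Drift n (hat x)) {v : ℕ} {b : Bool}
    {q : ℤ} (h : q ∈ gliderMarks x v b) : ∃ p, IsRep x v b p q := by
  obtain ⟨h1, h2, γ, h3, rfl, h4⟩ := h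
  obtain ⟨c, e, hc⟩ := exists_isChain hd h3
  set v := speed γ
  rw [e] at h3 h4
  obtain ⟨i, hi, rfl⟩ := hasStep_chainGlider.1 h4
  exact ⟨c 0, c, h3, hc, rfl, (hc.seat_lt (hc.mono (Nat.zero_le i) hi)
    (hc.mono (by omega) (by omega))).2.1 h1, h2⟩

theorem IsRep.unique {n : ℕ} {x : ZMod n → Bool} {v : ℕ} {b : Bool}
    {p q q' : ℤ} (h : IsRep x v b p q) (h' : IsRep x v b p q') : q = q' := by
  obtain ⟨c, h1, h2, rfl, h3, h4⟩ := h
  obtain ⟨c', h1', h2', h0, h3', h4'⟩ := h'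
  have hv := h2.pos
  have e := h2.unique h2' h0.symm
  rw [← e 0 (by omega), ← e v (by omega)] at h3'
  have h5 := (h2.colour 0 (by omega)).2
  simp only [add_zero] at h5
  rcases h3 with rfl | rfl <;> rcases h3' with rfl | rfl
  · rfl
  · rw [h4, h4'] at h5
    simp at h5
  · rw [h4, h4'] at h5
    simp at h5
  · rfl

theorem IsRep.bounds {n : ℕ} {x : ZMod n → Bool} {v : ℕ} {b : Bool}
    {p q : ℤ} (h : IsRep x v b p q) : p ≤ q ∧ NoSlot n (hat x) v p q := by
  obtain ⟨c, h1, h2, rfl, h3, h4⟩ := h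
  have hv := h2.pos
  have hle : c 0 ≤ q ∧ q ≤ c (2 * v - 1) := by
    rcases h3 with rfl | rfl
    · exact ⟨le_rfl, h2.mono (by omega) (by omega)⟩
    · exact ⟨h2.mono (by omega) (by omega), h2.mono (by omega) (by omega)⟩
  exact ⟨hle.1, fun i hi hi' => (h2.seat_lt hi (by omega)).1⟩

theorem IsRep.lt {n : ℕ} {x : ZMod n → Bool} (hd : Drift n (hat x)) {v : ℕ} {b : Bool}
    {p q p' q' : ℤ} (h : IsRep x v b p q) (h' : IsRep x v b p' q') (hlt : p < p') : q < p' := by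
  obtain ⟨c, h1, h2, rfl, h3, h4⟩ := h
  obtain ⟨c', h1', h2', rfl, h3', h4'⟩ := h'
  have hv := h2.pos
  have := chain_last_lt hd h2 h2' h1 h1' hlt
  have h5 := h2.mono (show v ≤ 2 * v - 1 by omega) (by omega)
  have h6 := h2.mono (show 0 ≤ 2 * v - 1 by omega) (by omega)
  rcases h3 with rfl | rfl <;> omega

theorem IsRep.add {n : ℕ} {x : ZMod n → Bool} (hd : Drift n (hat x)) {v : ℕ} {b : Bool}
    {p q : ℤ} (h : IsRep x v b p q) (t : ℤ) : IsRep x v b (p + n * t) (q + n * t) := by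
  obtain ⟨c, h1, h2, rfl, h3, h4⟩ := h
  refine ⟨_, shift_mem_gliders hd h2 h1 t, h2.shift hd t, rfl, ?_, by rwa [hd.periodic_mul]⟩
  rcases h3 with rfl | rfl <;> simp

/-- Both marks of a glider precede the next glider of the same speed, and no slot separates them, so
either can replace the first step. The bit `b` is free because a common mark has bit 0 before one
step of `f` and bit 1 after it. -/
theorem trainSizes_eq {n : ℕ} {x : ZMod n → Bool} (hd : Drift n (hat x)) (v : ℕ) (b : Bool) :
    trainSizes x v = cycleOf n (gliderMarks x v b) (NoSlot n (hat x) v) := by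
  have hex : ∀ p, ∃ q, IsFirst x v p → IsRep x v b p q := fun p => by
    by_cases h : IsFirst x v p
    · obtain ⟨q, hq⟩ := h.exists_isRep hd b
      exact ⟨q, fun _ => hq⟩
    · exact ⟨0, fun h' => absurd h' h⟩
  choose e he using hex
  have himage : e '' {p | IsFirst x v p} = gliderMarks x v b := by
    ext q
    constructor
    · rintro ⟨p, hp, rfl⟩
      exact (he p hp).mem
    · intro hq
      obtain ⟨p, hp⟩ := exists_isRep_of_mem hd hq
      exact ⟨p, hp.isFirst, (he p hp.isFirst).unique hp⟩
  rw [trainSizes_eq_cycleOf hd, ← himage]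
  refine cycleOf_image hd.pos (fun p => ⟨fun h => ?_, fun h => ?_⟩) (fun p q => ⟨fun h => ?_, fun h => ?_⟩)
    (fun p hp q hq hpq => ?_) (fun p hp => ?_) fun p hp q hq hpq => ⟨fun h => ?_, fun h => ?_⟩
  · have := IsFirst.add hd (show IsFirst x v (p + n) from h) (-1)
    rwa [mul_neg_one, add_neg_cancel_right] at this
  · simpa using IsFirst.add hd h 1
  · have := h.add hd (-1)
    rwa [mul_neg_one, add_neg_cancel_right, add_neg_cancel_right] at this
  · simpa using h.add hd 1
  · have h1 := (he p hp).lt hd (he q hq) hpq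
    have h2 := (he q hq).bounds.1
    omega
  · have h1 := (he p hp).add hd 1
    rw [mul_one] at h1
    exact (he _ h1.isFirst).unique h1
  · have h1 := (he p hp).bounds
    have h2 := (he q hq).bounds
    intro i hi hi'
    rcases le_or_gt i (e p) with h3 | h3
    · exact h1.2 i hi h3
    · exact h i h3.le (by omega)
  · have h1 := (he p hp).bounds
    have h2 := (he q hq).bounds
    intro i hi hi'
    rcases le_or_gt i q with h3 | h3
    · exact h i (by omega) h3
    · exact h2.2 i h3.le hi'

/-- The cyclic list of class sizes only depends on how the relation compares elements of `T`. -/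
theorem cycleOf_congr {n : ℕ} {T : Set ℤ} {R R' : ℤ → ℤ → Prop}
    (h : ∀ p ∈ T, ∀ q ∈ T, p ≤ q → (R p q ↔ R' p q)) : cycleOf n T R = cycleOf n T R' := by
  classical
  have hhead : ∀ p, IsHeadOf T R p ↔ IsHeadOf T R' p := by
    intro p
    refine and_congr_right fun hp => not_congr (exists_congr fun q => and_congr_right fun hq =>
      and_congr_right fun hqp => h q hq p hp hqp.le)
  unfold cycleOf
  rw [Finset.filter_congr fun p _ => hhead p]
  congr 1
  refine List.map_congr_left fun p hp => ?_
  have hp' := ((Finset.mem_filter.1 ((Finset.mem_sort _).1 hp)).2).1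
  unfold sizeOf
  congr 1
  ext q
  exact and_congr_right fun hq => and_congr_right fun hpq => h p hp' q hq hpq

/-! ### One step of the cycle factor -/

/-- The infinite string `w'` arises from `w` by complementing all matched bits. -/
structure Evolves (n : ℕ) (w w' : ℤ → Bool) : Prop where
  drift : Drift n w
  drift' : Drift n w'
  iff : ∀ p, w' p = true ↔ w p = false ∧ ¬ Flat w p

/-- The relation between the states of the carriers of `w` and `w'`: below an occupied seat of the
second carrier the two carriers are complementary, and no seat is occupied in both. -/
def Linked (s s' : ℕ → Bool) : Prop :=
  (∀ i j, i < j → s' j = true → s i = !(s' i)) ∧ ∀ j, s' j = true → s j = false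

/-- At a 1 of `w'` with seat `k`, the seats below `k` are empty in `w'`, hence occupied in `w`, and
`k` is empty in `w`; so the 0 of `w` takes `k` as well. At a matched 0 of `w'` the seats below `k`
are empty in `w`; if `w` is not flat there, its 1 frees `k` whenever an occupied seat of `w'` above
`k` forces `k` to be occupied in `w`, and possibly a higher seat otherwise. -/
theorem Evolves.linked_step {n : ℕ} {w w' : ℤ → Bool} (h : Evolves n w w') {p : ℤ}
    (hl : Linked (state w (p + 1)) (state w' (p + 1))) :
    Linked (state w p) (state w' p) ∧
      (w' p = true → seat n w p = seat n w' p) ∧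
      (w' p = false → ¬ Flat w' p → (∃ j, seat n w' p < j ∧ state w' (p + 1) j = true) →
        seat n w p = seat n w' p) := by
  obtain ⟨l1, l2⟩ := hl
  by_cases hf : Flat w' p
  · refine ⟨⟨fun i j _ hj => ?_, fun j hj => ?_⟩, fun hw => ?_, fun _ hf' => absurd hf hf'⟩
    · rw [state_of_flat hf] at hj
      simp at hj
    · rw [state_of_flat hf] at hj
      simp at hj
    · rw [hf.bit] at hw
      simp at hw
  have r' := seatRule h.drift' hf
  have s' := state_seat h.drift' hf
  generalize hk : seat n w' p = k at *
  have hk' : seat n w' p = k := hk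
  have below' : ∀ j < k, state w' (p + 1) j = !(w' p) := fun j hj => r'.below (by omega)
  have new' : state w' p k = !(w' p) := by rw [← hk]; exact r'.new
  have other' : ∀ j, j ≠ k → state w' p j = state w' (p + 1) j :=
    fun j hj => r'.other (by omega)
  cases hw' : w' p
  · rw [hw'] at s' below' new'
    simp only [Bool.not_false] at below' new'
    by_cases hfw : Flat w p
    -- With the carrier of `w` empty, the occupied seats of `w'` form an initial segment, which the
    -- 0 of `w'` extends by one.
    · have e1 : state w (p + 1) = fun _ => false := state_succ_of_flat h.drift hfw
      have e2 : state w p = fun _ => false := state_of_flat hfw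
      rw [e1] at l1 l2
      rw [e2]
      refine ⟨⟨fun i j hij hj => ?_, fun j hj => rfl⟩, by simp, fun _ _ ⟨j, hj, hj'⟩ => ?_⟩
      · by_cases hik : i = k
        · by_cases hjk : j = k
          · omega
          · rw [other' j hjk] at hj
            have := l1 k j (by omega) hj
            rw [s'] at this
            simp at this
        · rw [other' i hik]
          by_cases hjk : j = k
          · rw [below' i (by omega)]
            rfl
          · rw [other' j hjk] at hj
            exact l1 i j hij hj
      · have := l1 k j hj hj'
        rw [s'] at this
        simp at this
    · have hwt : w p = true := by
        by_contra hc
        have := (h.iff p).2 ⟨by simpa using hc, hfw⟩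
        rw [hw'] at this
        simp at this
      have r := seatRule h.drift hfw
      have s := state_seat h.drift hfw
      generalize hl : seat n w p = l at *
      have below : ∀ j < l, state w (p + 1) j = !(w p) := fun j hj => r.below (by omega)
      have new : state w p l = !(w p) := by rw [← hl]; exact r.new
      have other : ∀ j, j ≠ l → state w p j = state w (p + 1) j := fun j hj => r.other (by omega)
      rw [hwt] at s below new
      simp only [Bool.not_true] at below new
      have hkl : k ≤ l := by
        by_contra hc
        have h1 := l2 l (below' l (by omega))
        rw [s] at h1
        simp at h1
      have heq : (∃ j, k < j ∧ state w' (p + 1) j = true) → l = k := by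
        rintro ⟨j, hj, hj'⟩
        by_contra hc
        have h1 := l1 k j hj hj'
        rw [s', below k (by omega)] at h1
        simp at h1
      refine ⟨⟨fun i j hij hj => ?_, fun j hj => ?_⟩, by simp, fun _ _ hex => heq hex⟩
      · by_cases hjk : j = k
        · rw [other' i (by omega), other i (by omega), below' i (by omega), below i (by omega)]
          rfl
        · rw [other' j hjk] at hj
          rcases lt_or_gt_of_ne hjk with hlt | hgt
          · rw [other' i (by omega), other i (by omega)]
            exact l1 i j hij hj
          · have e := heq ⟨j, hgt, hj⟩
            by_cases hik : i = k
            · rw [hik, new', ← e, new]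
              rfl
            · rw [other' i hik, other i (by omega)]
              exact l1 i j hij hj
      · by_cases hjl : j = l
        · rw [hjl, new]
        · rw [other j hjl]
          by_cases hjk : j = k
          · exact below j (by omega)
          · rw [other' j hjk] at hj
            exact l2 j hj
  · rw [hw'] at s' below' new'
    simp only [Bool.not_true] at below' new'
    obtain ⟨hwf, hfw⟩ := (h.iff p).1 hw'
    have r := seatRule h.drift hfw
    have e : seat n w p = k := r.seat_eq (by rw [hwf]; exact l2 k s') fun j hj => by
      rw [hwf, l1 j k hj s', below' j hj]
    have new : state w p k = !(w p) := by rw [← e]; exact r.new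
    have other : ∀ j, j ≠ k → state w p j = state w (p + 1) j := fun j hj => r.other (by omega)
    rw [hwf] at new
    refine ⟨⟨fun i j hij hj => ?_, fun j hj => ?_⟩, fun _ => e, by simp⟩
    · have hjk : j ≠ k := by
        rintro rfl
        rw [new'] at hj
        simp at hj
      rw [other' j hjk] at hj
      by_cases hik : i = k
      · rw [hik, new, new']
      · rw [other i hik, other' i hik]
        exact l1 i j hij hj
    · have hjk : j ≠ k := by
        rintro rfl
        rw [new'] at hj
        simp at hj
      rw [other' j hjk] at hj
      rw [other j hjk]
      exact l2 j hj

/-- The propagation starts at a flat step of `w'`, where its carrier is empty and nothing is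
required of `w`. -/
theorem Evolves.linked {n : ℕ} {w w' : ℤ → Bool} (h : Evolves n w w') (p : ℤ) :
    Linked (state w p) (state w' p) := by
  obtain ⟨r, hr, hf⟩ := h.drift'.exists_flat_ge p
  induction p, hr using Int.leInductionDown with
  | base => simp [Linked, state_of_flat hf]
  | pred p hp ih => exact (h.linked_step (p := p - 1) (by rwa [sub_add_cancel])).1

theorem Evolves.seat_eq {n : ℕ} {w w' : ℤ → Bool} (h : Evolves n w w') {p : ℤ} (hp : w' p = true) :
    seat n w p = seat n w' p := (h.linked_step (h.linked (p + 1))).2.1 hp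

theorem Evolves.seat_eq_of_occupied {n : ℕ} {w w' : ℤ → Bool} (h : Evolves n w w') {p : ℤ}
    (hf : ¬ Flat w' p) {j : ℕ} (hj : seat n w' p < j) (hs : state w' (p + 1) j = true) :
    seat n w p = seat n w' p := by
  have := (h.linked_step (h.linked (p + 1))).2
  cases hw : w' p
  · exact this.2 hw hf ⟨j, hj, hs⟩
  · exact this.1 hw

theorem Evolves.bit_ne {n : ℕ} {w w' : ℤ → Bool} (h : Evolves n w w') {p : ℤ}
    (hf : ¬ Flat w p) : w p = !(w' p) := by
  have := h.iff p
  cases h1 : w p <;> cases h2 : w' p <;> simp_all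

/-! ### Stretches on which the two carriers change the same seats -/

/-- The two carriers are complementary on the seats up to `u`. -/
def CompUpTo (u : ℕ) (s s' : ℕ → Bool) : Prop := ∀ j ≤ u, s j = !(s' j)

theorem Evolves.compUpTo_iff {n : ℕ} {w w' : ℤ → Bool} (h : Evolves n w w') {u : ℕ} {p : ℤ}
    (hf : ¬ Flat w p) (hf' : ¬ Flat w' p) (e : seat n w p = seat n w' p) :
    CompUpTo u (state w p) (state w' p) ↔ CompUpTo u (state w (p + 1)) (state w' (p + 1)) := by
  have r := seatRule h.drift hf
  have r' := seatRule h.drift' hf'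
  have s := state_seat h.drift hf
  have s' := state_seat h.drift' hf'
  have hb := h.bit_ne hf
  refine forall_congr' fun j => imp_congr_right fun hj => ?_
  by_cases hk : j = seat n w p
  · rw [hk, r.new, s, e, r'.new, s', hb]
    simp
  · rw [r.other hk, r'.other (by rwa [← e])]

/-- Complementary bits on complementary states choose the same seat. At a 0 of `w'`, `w` is not
flat, because the seat taken in `w'` is occupied in `w`. -/
theorem Evolves.step_left {n : ℕ} {w w' : ℤ → Bool} (h : Evolves n w w') {u : ℕ} (hu : u < n)
    {p : ℤ} (hc : CompUpTo u (state w (p + 1)) (state w' (p + 1))) (hs : seat n w' p ≤ u) :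
    seat n w p = seat n w' p ∧ CompUpTo u (state w p) (state w' p) := by
  have hf' : ¬ Flat w' p := (seat_lt_iff h.drift').1 (by omega)
  have s' := state_seat h.drift' hf'
  have r' := seatRule h.drift' hf'
  suffices ¬ Flat w p ∧ seat n w p = seat n w' p from
    ⟨this.2, (h.compUpTo_iff this.1 hf' this.2).2 hc⟩
  cases hw : w' p
  · have hk := hc _ hs
    rw [s', hw] at hk
    have hf : ¬ Flat w p := by
      intro hf
      rw [state_succ_of_flat h.drift hf] at hk
      simp at hk
    have hwt := h.bit_ne hf
    rw [hw] at hwt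
    refine ⟨hf, (seatRule h.drift hf).seat_eq (by rw [hwt, hk]) fun i hi => ?_⟩
    rw [hc i (by omega), r'.below hi, hwt, hw]
  · exact ⟨((h.iff p).1 hw).2, h.seat_eq hw⟩

theorem Evolves.step_left' {n : ℕ} {w w' : ℤ → Bool} (h : Evolves n w w') {u : ℕ} (hu : u < n)
    {p : ℤ} (hc : CompUpTo u (state w (p + 1)) (state w' (p + 1))) (hs : seat n w p ≤ u)
    (hf' : ¬ Flat w' p) :
    seat n w p = seat n w' p ∧ CompUpTo u (state w p) (state w' p) := by
  have hf : ¬ Flat w p := (seat_lt_iff h.drift).1 (by omega)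
  have s := state_seat h.drift hf
  have r := seatRule h.drift hf
  suffices seat n w p = seat n w' p from ⟨this, (h.compUpTo_iff hf hf' this).2 hc⟩
  cases hw : w' p
  · have hwt := h.bit_ne hf
    rw [hw] at hwt
    symm
    refine (seatRule h.drift' hf').seat_eq ?_ fun i hi => ?_
    · have := hc _ hs
      rw [s, hwt] at this
      rw [hw]
      simpa using this
    · have := hc i (by omega)
      rw [r.below hi, hwt] at this
      rw [hw]
      simpa using this
  · exact h.seat_eq hw

/-- If the seats differed at a 0 of `w'`, the seat freed by `w` would be occupied in both carriers
at `p + 1`, against `Linked`. -/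
theorem Evolves.step_right {n : ℕ} {w w' : ℤ → Bool} (h : Evolves n w w') {u : ℕ} (hu : u < n)
    {p : ℤ} (hc : CompUpTo u (state w p) (state w' p)) (hs : seat n w p ≤ u) :
    seat n w p = seat n w' p ∧ CompUpTo u (state w (p + 1)) (state w' (p + 1)) := by
  have hf : ¬ Flat w p := (seat_lt_iff h.drift).1 (by omega)
  have r := seatRule h.drift hf
  have hb := h.bit_ne hf
  suffices ¬ Flat w' p ∧ seat n w p = seat n w' p from
    ⟨this.2, (h.compUpTo_iff hf this.1 this.2).1 hc⟩
  cases hw : w' p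
  · rw [hw] at hb
    have hl := hc _ hs
    rw [r.new, hb] at hl
    simp only [Bool.not_false, Bool.not_true, Bool.false_eq, Bool.not_eq_false'] at hl
    have hf' : ¬ Flat w' p := by
      intro hf'
      rw [state_of_flat hf'] at hl
      simp at hl
    refine ⟨hf', ?_⟩
    by_contra hne
    have r' := seatRule h.drift' hf'
    have hl' : state w' (p + 1) (seat n w p) = true := by rw [← r'.other hne, hl]
    rcases lt_or_gt_of_ne hne with hlt | hgt
    · have h1 := (h.linked (p + 1)).2 _ hl'
      rw [state_seat h.drift hf, hb] at h1
      simp at h1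
    · exact hne (h.seat_eq_of_occupied hf' hgt hl')
  · refine ⟨fun hf' => ?_, h.seat_eq hw⟩
    rw [hf'.bit] at hw
    simp at hw

/-- `Linked` determines the seat of `w` at a 0 of `w'` only below an occupied seat of `w'`; hence
the second alternative. -/
theorem Evolves.step_right' {n : ℕ} {w w' : ℤ → Bool} (h : Evolves n w w') {u : ℕ} (hu : u < n)
    {p : ℤ} (hc : CompUpTo u (state w p) (state w' p)) (hs : seat n w' p ≤ u) :
    (seat n w p = seat n w' p ∧ CompUpTo u (state w (p + 1)) (state w' (p + 1))) ∨
      ∀ j, seat n w' p < j → state w' p j = false := by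
  have hf' : ¬ Flat w' p := (seat_lt_iff h.drift').1 (by omega)
  have r' := seatRule h.drift' hf'
  by_cases hex : ∃ j, seat n w' p < j ∧ state w' p j = true
  · obtain ⟨j, hj, hj'⟩ := hex
    rw [r'.other hj.ne'] at hj'
    have e := h.seat_eq_of_occupied hf' hj hj'
    have hf : ¬ Flat w p := (seat_lt_iff h.drift).1 (by omega)
    exact Or.inl ⟨e, (h.compUpTo_iff hf hf' e).1 hc⟩
  · push Not at hex
    exact Or.inr fun j hj => by simpa using hex j hj

theorem Evolves.lockstep_left {n : ℕ} {w w' : ℤ → Bool} (h : Evolves n w w') {u : ℕ} (hu : u < n)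
    {a b : ℤ} (hab : a ≤ b) (hc : CompUpTo u (state w b) (state w' b))
    (hs : ∀ i, a ≤ i → i < b → seat n w' i ≤ u) :
    CompUpTo u (state w a) (state w' a) ∧ ∀ i, a ≤ i → i < b → seat n w i = seat n w' i := by
  induction a, hab using Int.leInductionDown with
  | base => exact ⟨hc, fun i hi hi' => by omega⟩
  | pred a ha ih =>
    obtain ⟨h1, h2⟩ := ih fun i hi hi' => hs i (by omega) hi'
    obtain ⟨h3, h4⟩ := h.step_left hu (p := a - 1) (by rwa [sub_add_cancel])
      (hs _ le_rfl (by omega))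
    refine ⟨h4, fun i hi hi' => ?_⟩
    rcases hi.lt_or_eq with h5 | rfl
    · exact h2 i (by omega) hi'
    · exact h3

theorem Evolves.lockstep_left' {n : ℕ} {w w' : ℤ → Bool} (h : Evolves n w w') {u : ℕ} (hu : u < n)
    {a b : ℤ} (hab : a ≤ b) (hc : CompUpTo u (state w b) (state w' b))
    (hs : ∀ i, a ≤ i → i < b → seat n w i ≤ u) (hf : ∀ i, a ≤ i → i < b → ¬ Flat w' i) :
    CompUpTo u (state w a) (state w' a) ∧ ∀ i, a ≤ i → i < b → seat n w i = seat n w' i := by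
  induction a, hab using Int.leInductionDown with
  | base => exact ⟨hc, fun i hi hi' => by omega⟩
  | pred a ha ih =>
    obtain ⟨h1, h2⟩ := ih (fun i hi hi' => hs i (by omega) hi') fun i hi hi' => hf i (by omega) hi'
    obtain ⟨h3, h4⟩ := h.step_left' hu (p := a - 1) (by rwa [sub_add_cancel])
      (hs _ le_rfl (by omega)) (hf _ le_rfl (by omega))
    refine ⟨h4, fun i hi hi' => ?_⟩
    rcases hi.lt_or_eq with h5 | rfl
    · exact h2 i (by omega) hi'
    · exact h3

theorem Evolves.lockstep_right {n : ℕ} {w w' : ℤ → Bool} (h : Evolves n w w') {u : ℕ} (hu : u < n)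
    {a b : ℤ} (hab : a ≤ b) (hc : CompUpTo u (state w a) (state w' a))
    (hs : ∀ i, a ≤ i → i < b → seat n w i ≤ u) :
    CompUpTo u (state w b) (state w' b) ∧ ∀ i, a ≤ i → i < b → seat n w i = seat n w' i := by
  induction b, hab using Int.leInduction with
  | base => exact ⟨hc, fun i hi hi' => by omega⟩
  | succ b hb ih =>
    obtain ⟨h1, h2⟩ := ih fun i hi hi' => hs i hi (by omega)
    obtain ⟨h3, h4⟩ := h.step_right hu h1 (hs _ hb (by omega))
    refine ⟨h4, fun i hi hi' => ?_⟩
    rcases lt_or_ge i b with h5 | h5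
    · exact h2 i hi h5
    · rw [show i = b by omega]
      exact h3

/-- A common mark of `w` and `w'`: a mark with bit 0 in `w` and bit 1 in `w'`. -/
def CommonMark (n : ℕ) (w' : ℤ → Bool) (u : ℕ) (q : ℤ) : Prop := seat n w' q = u ∧ w' q = true

theorem Evolves.commonMark_iff {n : ℕ} {w w' : ℤ → Bool} (h : Evolves n w w') {u : ℕ} (hu : u < n)
    {q : ℤ} : CommonMark n w' u q ↔ seat n w q = u ∧ w q = false := by
  constructor
  · rintro ⟨h1, h2⟩
    exact ⟨by rw [h.seat_eq h2, h1], ((h.iff q).1 h2).1⟩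
  · rintro ⟨h1, h2⟩
    have hf : ¬ Flat w q := (seat_lt_iff h.drift).1 (by omega)
    have h3 := (h.iff q).2 ⟨h2, hf⟩
    exact ⟨by rw [← h.seat_eq h3, h1], h3⟩

/-- At `q + 1` the seats below `u` are empty in `w'`, as its 1 frees `u`, and occupied in `w`, as
its 0 takes `u`. So a common mark starts a lockstep in both directions. -/
theorem Evolves.compUpTo_commonMark {n : ℕ} {w w' : ℤ → Bool} (h : Evolves n w w') {u : ℕ}
    (hu : u < n) {q : ℤ} (hq : CommonMark n w' u q) :
    CompUpTo u (state w q) (state w' q) ∧ CompUpTo u (state w (q + 1)) (state w' (q + 1)) ∧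
      (∀ j ≤ u, state w' q j = false) ∧ state w' (q + 1) u = true ∧ state w q u = true := by
  have hq' := (h.commonMark_iff hu).1 hq
  obtain ⟨h1, h2⟩ := hq
  have hf' : ¬ Flat w' q := (seat_lt_iff h.drift').1 (by omega)
  have hf : ¬ Flat w q := (seat_lt_iff h.drift).1 (by omega)
  have r := seatRule h.drift hf
  have r' := seatRule h.drift' hf'
  have s := state_seat h.drift hf
  have s' := state_seat h.drift' hf'
  have hC : CompUpTo u (state w (q + 1)) (state w' (q + 1)) := by
    intro j hj
    rcases hj.lt_or_eq with hj | rfl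
    · rw [r.below (by omega), r'.below (by omega), hq'.2, h2]
      rfl
    · rw [← hq'.1, s, hq'.1, ← h1, s', hq'.2, h2]
      rfl
  refine ⟨(h.compUpTo_iff hf hf' (by rw [h1, hq'.1])).2 hC, hC, fun j hj => ?_, ?_, ?_⟩
  · rcases hj.lt_or_eq with hj | rfl
    · rw [r'.other (by omega), r'.below (by omega), h2]
      rfl
    · rw [← h1, r'.new, h2]
      rfl
  · rw [← h1, s', h2]
  · have := r.new
    rw [hq'.1, hq'.2] at this
    exact this

/-- The lockstep runs to the right from `p` if the seats of `w` are bounded, and to the left from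
`q` if those of `w'` are. -/
theorem Evolves.noSlot_iff {n : ℕ} {w w' : ℤ → Bool} (h : Evolves n w w') {u : ℕ} (hu : u < n)
    {p q : ℤ} (hp : CommonMark n w' u p) (hq : CommonMark n w' u q) (hpq : p ≤ q) :
    NoSlot n w (u + 1) p q ↔ NoSlot n w' (u + 1) p q := by
  have hp' := (h.commonMark_iff hu).1 hp
  have hq' := (h.commonMark_iff hu).1 hq
  constructor
  · intro hs i hi hiq
    rcases hi.lt_or_eq with h1 | rfl
    · rw [← (h.lockstep_right hu (show p + 1 ≤ q + 1 by omega) (h.compUpTo_commonMark hu hp).2.1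
        fun i hi hi' => Nat.lt_succ_iff.1 (hs i (by omega) (by omega))).2 i h1 (by omega)]
      exact hs i (by omega) hiq
    · rw [hp.1]
      omega
  · intro hs i hi hiq
    rcases hiq.lt_or_eq with h1 | rfl
    · rw [(h.lockstep_left hu hpq (h.compUpTo_commonMark hu hq).1
        fun i hi hi' => Nat.lt_succ_iff.1 (hs i (by omega) (by omega))).2 i hi h1]
      exact hs i hi hiq
    · rw [hq'.1]
      omega

/-- Without seat changes above `u`, the occupation above `u` does not change. -/
theorem state_above_eq {n : ℕ} {w : ℤ → Bool} (hd : Drift n w) {u m : ℕ} (hm : u < m) {a b : ℤ}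
    (hab : a ≤ b) (h : ∀ i, a ≤ i → i < b → seat n w i ≤ u) : state w a m = state w b m :=
  state_eq_of_no_change hd hab fun i hi hi' => by
    have := h i hi hi'
    omega

/-! ### Gliders of a given speed before and after one step -/

theorem NoSlot.trans {n : ℕ} {w : ℤ → Bool} {v : ℕ} {a b c : ℤ} (h : NoSlot n w v a b)
    (h' : NoSlot n w v b c) : NoSlot n w v a c := fun i hi hic => by
  rcases le_or_gt i b with h1 | h1
  · exact h i hi h1
  · exact h' i h1.le hic

/-- Whether the bit of a mark agrees with that of the last mark, in terms of the last mark with the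
same bit. -/
theorem bit_ne_lastMark_iff {n : ℕ} {w : ℤ → Bool} {v : ℕ} {q z z₁ : ℤ}
    (hz : LastMark n w v z) (hqz : q ≤ z) (hns : NoSlot n w v q z) (hm₁ : Mark n w v z₁) (hw₁ : w z₁ = w q)
    (hqz₁ : q ≤ z₁) (hns₁ : NoSlot n w v q z₁)
    (hmax : ∀ p, z₁ < p → Mark n w v p → NoSlot n w v q p → w p ≠ w q) :
    w q ≠ w z ↔ ∃ p, z₁ < p ∧ Mark n w v p ∧ NoSlot n w v z₁ p := by
  obtain ⟨hz1, s, hs1, hs2, hs3⟩ := hz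
  have hle : ∀ p, q ≤ p → Mark n w v p → NoSlot n w v q p → p ≤ z := by
    intro p hqp hp hnp
    by_contra hc
    rcases lt_or_ge p s with h | h
    · have := hs3 p (by omega) h
      rw [Mark] at hp
      omega
    · have := hnp s (by omega) h
      omega
  constructor
  · intro hne
    have h1 := hle z₁ hqz₁ hm₁ hns₁
    rcases h1.lt_or_eq with h2 | rfl
    · exact ⟨z, h2, hz1, fun i hi hiz => hns i (by omega) hiz⟩
    · exact absurd hw₁.symm hne
  · rintro ⟨p, h1, h2, h3⟩
    have := hle p (by omega) h2 (hns₁.trans h3)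
    exact (hmax z (by omega) hz1 hns).symm

/-! ### Marks to the left and to the right of a run of common marks -/

section

variable {n : ℕ} {w w' : ℤ → Bool} {u : ℕ} {q z₁ : ℤ}

theorem Evolves.mark_left_of (h : Evolves n w w') (hu : u < n) (hq : CommonMark n w' u q)
    (hL : ∃ p, p < q ∧ Mark n w' (u + 1) p ∧ NoSlot n w' (u + 1) p q) :
    ∃ p, p < q ∧ Mark n w (u + 1) p ∧ NoSlot n w (u + 1) p q := by
  obtain ⟨p, h1, h2, h3⟩ := hL
  have hs := (h.lockstep_left hu h1.le (h.compUpTo_commonMark hu hq).1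
    fun i hi hi' => Nat.lt_succ_iff.1 (h3 i hi hi'.le)).2
  refine ⟨p, h1, by rw [Mark, hs p le_rfl h1]; exact h2, fun i hi hiq => ?_⟩
  rcases hiq.lt_or_eq with h4 | rfl
  · rw [hs i hi h4]
    exact h3 i hi hiq
  · rw [((h.commonMark_iff hu).1 hq).1]
    omega

theorem Evolves.mark_right_of (h : Evolves n w w') (hu : u < n) (hz : CommonMark n w' u z₁)
    (hR : ∃ p, z₁ < p ∧ Mark n w (u + 1) p ∧ NoSlot n w (u + 1) z₁ p) :
    ∃ p, z₁ < p ∧ Mark n w' (u + 1) p ∧ NoSlot n w' (u + 1) z₁ p := by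
  obtain ⟨p, h1, h2, h3⟩ := hR
  have hs := (h.lockstep_right hu (show z₁ + 1 ≤ p + 1 by omega)
    (h.compUpTo_commonMark hu hz).2.1
    fun i hi hi' => Nat.lt_succ_iff.1 (h3 i (by omega) (by omega))).2
  refine ⟨p, h1, by rw [Mark, ← hs p (by omega) (by omega)]; exact h2, fun i hi hip => ?_⟩
  rcases hi.lt_or_eq with h4 | rfl
  · rw [← hs i (by omega) (by omega)]
    exact h3 i (by omega) hip
  · rw [hz.1]
    omega

/-- If the carrier of `w'` is empty just before a common mark, then a mark of `w` precedes it. -/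
theorem Evolves.mark_left_of_empty (h : Evolves n w w') (hu : u < n) (hq : CommonMark n w' u q)
    (he : ∀ j, u < j → state w' q j = false) :
    ∃ p, p < q ∧ Mark n w (u + 1) p ∧ NoSlot n w (u + 1) p q := by
  obtain ⟨-, -, -, -, hsq⟩ := h.compUpTo_commonMark hu hq
  obtain ⟨τ, hτ, hfτ⟩ := h.drift.exists_flat_lt q
  -- Seat `u` of `w` is occupied at `q` and empty at the earlier flat step `τ`, so it changes in
  -- between.
  have hex : ∃ t, t < q ∧ seat n w t = u := by
    by_contra! hc
    have := state_eq_of_no_change h.drift hτ.le fun i _ hi => hc i hi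
    rw [state_of_flat hfτ, hsq] at this
    simp at this
  obtain ⟨t, ⟨ht, htu⟩, hmax⟩ := Int.exists_greatest_of_bdd (P := fun t => t < q ∧ seat n w t = u)
    ⟨q, fun z hz => hz.1.le⟩ hex
  have hocc : ∀ i, t < i → i ≤ q → state w i u = true := fun i hi hiq => by
    rw [state_eq_of_no_change h.drift hiq fun j hj hjq e => ?_, hsq]
    have := hmax j ⟨hjq, e⟩
    omega
  have hocc' : ∀ i, t < i → i ≤ q → state w' i u = false := fun i hi hiq => by
    by_contra hc
    have := (h.linked i).2 u (by simpa using hc)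
    rw [hocc i hi hiq] at this
    simp at this
  -- Right of `t`, seat `u` is occupied in `w`, hence empty in `w'`. So no 0 of `w'` takes a seat
  -- above `u`, and the seats above `u` stay empty in `w'`. A 1 of `w` frees a seat up to `u`, and a
  -- 0 of `w` is a 1 of `w'` with the same seat.
  have key : ∀ i, t + 1 ≤ i → i ≤ q →
      (∀ m, u < m → state w' i m = false) ∧ ∀ k, i ≤ k → k < q → seat n w k ≤ u := by
    intro i hti hiq
    induction i, hiq using Int.leInductionDown with
    | base => exact ⟨he, fun k hk hk' => by omega⟩
    | pred i hiq ih =>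
      obtain ⟨h1, h2⟩ := ih (by omega)
      have o := hocc i (by omega) hiq
      have o1 := hocc (i - 1) (by omega) (by omega)
      have o' := hocc' i (by omega) hiq
      obtain ⟨p, rfl⟩ : ∃ p, i = p + 1 := ⟨i - 1, by ring⟩
      rw [add_sub_cancel_right] at *
      have hf : ¬ Flat w p := by
        intro hf
        rw [state_of_flat hf] at o1
        simp at o1
      have hle : seat n w p ≤ u := by
        cases hw : w p
        · have hw' := (h.iff p).2 ⟨hw, hf⟩
          rw [h.seat_eq hw']
          by_contra hc
          have hf' : ¬ Flat w' p := by
            intro hf'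
            rw [hf'.bit] at hw'
            simp at hw'
          have := h1 _ (not_le.1 hc)
          rw [state_seat h.drift' hf', hw'] at this
          simp at this
        · exact ((seatRule h.drift hf).seat (j := u) (by rw [hw, o])).2
      refine ⟨fun m hm => ?_, fun k hk hkq => ?_⟩
      · by_cases hf' : Flat w' p
        · rw [state_of_flat hf']
        · have r' := seatRule h.drift' hf'
          by_cases hmk : m = seat n w' p
          · rw [hmk, r'.new]
            by_contra hc
            have := (r'.seat (j := u) (by cases hw : w' p <;> simp_all)).2
            omega
          · rw [r'.other hmk, h1 m hm]
      · rcases hk.lt_or_eq with h4 | rfl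
        · exact h2 k (by omega) hkq
        · exact hle
  refine ⟨t, ht, by rw [Mark, htu], fun i hi hiq => ?_⟩
  rcases hi.lt_or_eq with h1 | rfl
  · rcases hiq.lt_or_eq with h2 | rfl
    · exact Nat.lt_succ_iff.2 ((key (t + 1) le_rfl (by omega)).2 i (by omega) h2)
    · rw [((h.commonMark_iff hu).1 hq).1]
      omega
  · omega

/-- The lockstep right of `z₁` fails only where `w'` has no occupied seat above the current one.
Before the next mark of `w'` seat `u` is occupied, so it can fail only at that mark. Then nothing
above `u` is occupied in `w'` at `q` either, and `Evolves.mark_left_of_empty` applies. -/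
theorem Evolves.mark_of_mark_right (h : Evolves n w w') (hu : u < n) (hq : CommonMark n w' u q)
    (hz : CommonMark n w' u z₁) (hqz : q ≤ z₁) (hns : NoSlot n w' (u + 1) q z₁)
    (hR : ∃ p, z₁ < p ∧ Mark n w' (u + 1) p ∧ NoSlot n w' (u + 1) z₁ p) :
    (∃ p, p < q ∧ Mark n w (u + 1) p ∧ NoSlot n w (u + 1) p q) ∨
      ∃ p, z₁ < p ∧ Mark n w (u + 1) p ∧ NoSlot n w (u + 1) z₁ p := by
  obtain ⟨p, ⟨hp1, hp2, hp3⟩, hmin⟩ := Int.exists_least_of_bdd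
    (P := fun p => z₁ < p ∧ Mark n w' (u + 1) p ∧ NoSlot n w' (u + 1) z₁ p)
    ⟨z₁, fun z hz => hz.1.le⟩ hR
  obtain ⟨-, hc, -, hs, -⟩ := h.compUpTo_commonMark hu hz
  have hne : ∀ i, z₁ < i → i < p → seat n w' i < u := by
    intro i hi hip
    have h1 := hp3 i hi.le hip.le
    by_contra hcon
    have := hmin i ⟨hi, by rw [Mark]; omega, fun j hj hji => hp3 j hj (by omega)⟩
    omega
  have key : ∀ b, z₁ + 1 ≤ b → b ≤ p → CompUpTo u (state w b) (state w' b) ∧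
      ∀ i, z₁ < i → i < b → seat n w i = seat n w' i := by
    intro b hb hbp
    induction b, hb using Int.leInduction with
    | base => exact ⟨hc, fun i hi hi' => by omega⟩
    | succ b hb ih =>
      obtain ⟨h1, h2⟩ := ih (by omega)
      have hlt := hne b (by omega) (by omega)
      rcases h.step_right' hu h1 hlt.le with ⟨h3, h4⟩ | h3
      · refine ⟨h4, fun i hi hib => ?_⟩
        rcases (show i ≤ b by omega).lt_or_eq with h5 | rfl
        · exact h2 i hi h5
        · exact h3
      · have h5 := h3 u hlt
        rw [← state_eq_of_no_change h.drift' hb fun i hi hib => (hne i (by omega) (by omega)).ne,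
          hs] at h5
        simp at h5
  obtain ⟨h1, h2⟩ := key p (by omega) le_rfl
  have hpu : seat n w' p = u := by rw [Mark] at hp2; omega
  rcases h.step_right' hu h1 hpu.le with ⟨h3, -⟩ | h3
  · refine Or.inr ⟨p, hp1, by rw [Mark, h3]; exact hp2, fun i hi hip => ?_⟩
    rcases hi.lt_or_eq with h4 | rfl
    · rcases hip.lt_or_eq with h5 | rfl
      · rw [h2 i h4 h5]
        exact hp3 i hi hip
      · omega
    · rw [((h.commonMark_iff hu).1 hz).1]
      omega
  · refine Or.inl (h.mark_left_of_empty hu hq fun j hj => ?_)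
    rw [state_above_eq h.drift' hj (show q ≤ p by omega) fun i hi hip =>
      Nat.lt_succ_iff.1 (hns.trans hp3 i hi hip.le)]
    exact h3 j (by omega)

/-- Some step right of `z₁` occupied seat `u`. Up to the nearest such step no higher seat changes:
none may remain occupied, and a 1 frees `u` before any higher seat. -/
theorem Drift.mark_right_of_empty {w : ℤ → Bool} (hd : Drift n w)
    (hz : seat n w z₁ = u) (hs : state w (z₁ + 1) u = true)
    (he : ∀ j, u < j → state w (z₁ + 1) j = false) :
    ∃ p, z₁ < p ∧ Mark n w (u + 1) p ∧ NoSlot n w (u + 1) z₁ p := by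
  obtain ⟨r, hr, hfr⟩ := hd.exists_flat_ge (z₁ + 1)
  have hex : ∃ s, z₁ < s ∧ seat n w s = u := by
    by_contra! hc
    have := state_eq_of_no_change hd hr fun i hi _ => hc i hi
    rw [state_of_flat hfr, hs] at this
    simp at this
  obtain ⟨s, ⟨hs1, hs2⟩, hmin⟩ := Int.exists_least_of_bdd (P := fun s => z₁ < s ∧ seat n w s = u)
    ⟨z₁, fun z hz => hz.1.le⟩ hex
  have hocc : ∀ i, z₁ + 1 ≤ i → i ≤ s → state w i u = true := fun i hi his => by
    rw [← state_eq_of_no_change hd hi fun j hj hji e => ?_, hs]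
    have := hmin j ⟨hj, e⟩
    omega
  have key : ∀ b, z₁ + 1 ≤ b → b ≤ s → (∀ m, u < m → state w b m = false) ∧
      ∀ k, z₁ < k → k < b → seat n w k ≤ u := by
    intro b hb hbs
    induction b, hb using Int.leInduction with
    | base => exact ⟨he, fun k hk hk' => by omega⟩
    | succ b hb ih =>
      obtain ⟨h1, h2⟩ := ih (by omega)
      have o := hocc b hb (by omega)
      have o1 := hocc (b + 1) (by omega) hbs
      have hf : ¬ Flat w b := by
        intro hf
        rw [state_of_flat hf] at o
        simp at o
      have r := seatRule hd hf
      have hle : seat n w b ≤ u := by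
        by_contra hc
        have h3 := h1 _ (not_le.1 hc)
        rw [r.new] at h3
        have h4 := r.below (not_le.1 hc)
        rw [o1, h3] at h4
        simp at h4
      refine ⟨fun m hm => by rw [← r.other (by omega), h1 m hm], fun k hk hkb => ?_⟩
      rcases (show k ≤ b by omega).lt_or_eq with h5 | rfl
      · exact h2 k hk h5
      · exact hle
  refine ⟨s, hs1, by rw [Mark, hs2], fun i hi his => ?_⟩
  rcases hi.lt_or_eq with h1 | rfl
  · rcases his.lt_or_eq with h2 | rfl
    · exact Nat.lt_succ_iff.2 ((key s (by omega) le_rfl).2 i h1 h2)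
    · omega
  · omega

/-- Only a flat step of `w'` can stop the lockstep left of `q`. Right of the last such step the
carrier of `w'` is empty and the seats up to `z₁` are at most `u`, so `Drift.mark_right_of_empty`
gives a mark on the other side. -/
theorem Evolves.mark_of_mark_left (h : Evolves n w w') (hu : u < n) (hq : CommonMark n w' u q)
    (hz : CommonMark n w' u z₁) (hqz : q ≤ z₁) (hns : NoSlot n w' (u + 1) q z₁)
    (hL : ∃ p, p < q ∧ Mark n w (u + 1) p ∧ NoSlot n w (u + 1) p q) :
    (∃ p, p < q ∧ Mark n w' (u + 1) p ∧ NoSlot n w' (u + 1) p q) ∨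
      ∃ p, z₁ < p ∧ Mark n w' (u + 1) p ∧ NoSlot n w' (u + 1) z₁ p := by
  obtain ⟨t, ht1, ht2, ht3⟩ := hL
  obtain ⟨hc, -⟩ := h.compUpTo_commonMark hu hq
  have hle : ∀ i, t ≤ i → i < q → seat n w i ≤ u :=
    fun i hi hiq => Nat.lt_succ_iff.1 (ht3 i hi hiq.le)
  by_cases hex : ∃ τ, (t ≤ τ ∧ τ < q) ∧ Flat w' τ
  · right
    obtain ⟨τ, ⟨⟨hτ1, hτ2⟩, hτ3⟩, hmax⟩ := Int.exists_greatest_of_bdd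
      (P := fun τ => (t ≤ τ ∧ τ < q) ∧ Flat w' τ) ⟨q, fun z hz => hz.1.2.le⟩ hex
    have hs := (h.lockstep_left' hu (show τ + 1 ≤ q by omega) hc (fun i hi hiq =>
      hle i (by omega) hiq) fun i hi hiq hf => by
        have := hmax i ⟨⟨by omega, hiq⟩, hf⟩
        omega).2
    refine h.drift'.mark_right_of_empty hz.1 (h.compUpTo_commonMark hu hz).2.2.2.1
      fun j hj => ?_
    rw [← state_above_eq h.drift' hj (show τ + 1 ≤ z₁ + 1 by omega) fun i hi hiz => ?_,
      state_succ_of_flat h.drift' hτ3]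
    rcases lt_or_ge i q with h1 | h1
    · rw [← hs i hi h1]
      exact hle i (by omega) h1
    · exact Nat.lt_succ_iff.1 (hns i h1 (by omega))
  · push Not at hex
    have hs := (h.lockstep_left' hu ht1.le hc hle fun i hi hiq => hex i ⟨hi, hiq⟩).2
    refine Or.inl ⟨t, ht1, by rw [Mark, ← hs t le_rfl ht1]; exact ht2, fun i hi hiq => ?_⟩
    rcases hiq.lt_or_eq with h4 | rfl
    · rw [← hs i hi h4]
      exact ht3 i hi hiq
    · rw [hq.1]
      omega

/-- Let `z₁` be the last common mark reachable from `q` without a slot. In both strings the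
condition says that there is a mark left of `q` or right of `z₁` (`bit_ne_lastMark_iff`). Such a
mark may change sides under one step, but it does not disappear. -/
theorem Evolves.marked_iff (h : Evolves n w w') (hu : u < n) (hq : CommonMark n w' u q)
    {z z' : ℤ} (hz : LastMark n w (u + 1) z) (hle : q ≤ z) (hqz : NoSlot n w (u + 1) q z)
    (hz' : LastMark n w' (u + 1) z') (hle' : q ≤ z') (hqz' : NoSlot n w' (u + 1) q z') :
    (∃ p < q, Mark n w (u + 1) p ∧ NoSlot n w (u + 1) p q) ∨ w q ≠ w z ↔
      (∃ p < q, Mark n w' (u + 1) p ∧ NoSlot n w' (u + 1) p q) ∨ w' q ≠ w' z' := by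
  obtain ⟨r, hr1, hr2⟩ := h.drift'.exists_flat_ge q
  obtain ⟨z₁, ⟨h1, h2, h3⟩, hmax⟩ := Int.exists_greatest_of_bdd
    (P := fun p => q ≤ p ∧ CommonMark n w' u p ∧ NoSlot n w' (u + 1) q p)
    ⟨r, fun p hp => by
      by_contra hc
      have := hp.2.2 r hr1 (by omega)
      rw [seat_of_flat hr2] at this
      omega⟩ ⟨q, le_rfl, hq, fun i hi hi' => by
        rw [show i = q by omega, hq.1]
        omega⟩
  have hqw := (h.commonMark_iff hu).1 hq
  have hzw := (h.commonMark_iff hu).1 h2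
  rw [bit_ne_lastMark_iff hz hle hqz (z₁ := z₁) (by rw [Mark, hzw.1]) (by rw [hzw.2, hqw.2]) h1
      ((h.noSlot_iff hu hq h2 h1).2 h3) fun p hp hpm hns e => ?_,
    bit_ne_lastMark_iff hz' hle' hqz' (z₁ := z₁) (by rw [Mark, h2.1]) (by rw [h2.2, hq.2]) h1 h3
      fun p hp hpm hns e => ?_]
  · exact ⟨fun hh => hh.elim (h.mark_of_mark_left hu hq h2 h1 h3)
      fun hh => Or.inr (h.mark_right_of hu h2 hh), fun hh => hh.elim
      (fun hh => Or.inl (h.mark_left_of hu hq hh)) (h.mark_of_mark_right hu hq h2 h1 h3)⟩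
  · have := hmax p ⟨by omega, ⟨by rw [Mark] at hpm; omega, by rw [e, hq.2]⟩, hns⟩
    omega
  · have hp' : CommonMark n w' u p :=
      (h.commonMark_iff hu).2 ⟨by rw [Mark] at hpm; omega, by rw [e, hqw.2]⟩
    have := hmax p ⟨by omega, hp', (h.noSlot_iff hu hq hp' (by omega)).1 hns⟩
    omega

end

/-- The marks with bit 0 in the gliders of speed `v` of `x` are the marks with bit 1 in the gliders of
speed `v` of `y`. -/
theorem Evolves.gliderMarks_eq {n : ℕ} {x y : ZMod n → Bool} (h : Evolves n (hat x) (hat y)) (v : ℕ) :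
    gliderMarks x v false = gliderMarks y v true := by
  have hle : ∀ x : ZMod n → Bool, Drift n (hat x) → ∀ b q, q ∈ gliderMarks x v b → v ≤ n := by
    rintro x hd b q ⟨-, -, γ, hγ, hs, -⟩
    obtain ⟨c, e, hc⟩ := exists_isChain hd hγ
    rw [e] at hγ
    rw [← hs]
    exact hc.speed_le hd hγ
  ext q
  rcases v with - | u
  · simp [gliderMarks, Mark]
  by_cases hu : u < n
  swap
  · exact ⟨fun hq => absurd (hle x h.drift _ _ hq) hu, fun hq => absurd (hle y h.drift' _ _ hq) hu⟩
  have hcm : (Mark n (hat x) (u + 1) q ∧ hat x q = false) ↔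
      (Mark n (hat y) (u + 1) q ∧ hat y q = true) := by
    simpa [Mark, CommonMark] using (h.commonMark_iff hu (q := q)).symm
  by_cases hq : CommonMark n (hat y) u q
  swap
  · have hq' : ¬ (Mark n (hat y) (u + 1) q ∧ hat y q = true) := by simpa [CommonMark, Mark] using hq
    exact ⟨fun h' => absurd (hcm.1 ⟨h'.1, h'.2.1⟩) hq', fun h' => absurd ⟨h'.1, h'.2.1⟩ hq'⟩
  have hm' : Mark n (hat y) (u + 1) q := by rw [Mark, hq.1]
  obtain ⟨hm, hb⟩ := hcm.2 ⟨hm', hq.2⟩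
  obtain ⟨z, hz1, hz2, hz3⟩ := exists_lastMark h.drift hu hm
  obtain ⟨z', hz1', hz2', hz3'⟩ := exists_lastMark h.drift' hu hm'
  have := h.marked_iff hu hq hz3 hz1 hz2 hz3' hz1' hz2'
  rw [← mem_glider_iff h.drift hu hz3 hz1 hm hz2, ← mem_glider_iff h.drift' hu hz3' hz1' hm' hz2']
    at this
  simp only [gliderMarks, Set.mem_ofPred_eq, hm, hm', hb, hq.2, true_and, this]

theorem Evolves.trainSizes_eq {n : ℕ} {x y : ZMod n → Bool} (h : Evolves n (hat x) (hat y)) (v : ℕ) :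
    trainSizes y v = trainSizes x v := by
  rw [KneserGliders.trainSizes_eq h.drift v false, KneserGliders.trainSizes_eq h.drift' v true,
    h.gliderMarks_eq v]
  refine cycleOf_congr fun p hp q hq hpq => ?_
  obtain ⟨γ, hγ, hs, -⟩ := hp.2.2
  obtain ⟨c, e, hc⟩ := exists_isChain h.drift' hγ
  rw [e] at hγ
  have hv := hc.speed_le h.drift' hγ
  have hv1 := hc.pos
  rw [hs] at hv hv1
  obtain ⟨u, rfl⟩ : ∃ u, v = u + 1 := ⟨v - 1, by omega⟩
  have hcm : ∀ p ∈ gliderMarks y (u + 1) true, CommonMark n (hat y) u p :=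
    fun p hp => ⟨by have := hp.1; rw [Mark] at this; omega, hp.2.1⟩
  exact (h.noSlot_iff hv (hcm p hp) (hcm q hq) hpq).symm

/-! ### Positions modulo `n` -/

theorem sum_Ico_intCast {n : ℕ} [NeZero n] (g : ZMod n → ℤ) (a : ℤ) :
    ∑ i ∈ Finset.Ico a (a + n), g i = ∑ i, g i := by
  refine Finset.sum_nbij (fun i : ℤ => (i : ZMod n)) (by simp) (fun i hi j hj e => ?_)
    (fun z _ => ⟨a + ((z - a).val : ℤ), ?_, ?_⟩) fun _ _ => rfl
  · obtain ⟨c, hc⟩ := (ZMod.intCast_eq_intCast_iff_dvd_sub i j n).1 e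
    simp only [Finset.coe_Ico, Set.mem_Ico] at hi hj
    have : c = 0 := by
      by_contra h0
      rcases lt_or_gt_of_ne h0 with h | h <;> nlinarith
    subst this
    omega
  · have := ZMod.val_lt (z - (a : ZMod n))
    simp only [Finset.coe_Ico, Set.mem_Ico]
    omega
  · simp

theorem exists_eq_add_of_intCast_eq {n : ℕ} {p q : ℤ} (h : (p : ZMod n) = q) :
    ∃ t : ℤ, q = p + n * t := by
  obtain ⟨t, ht⟩ := (ZMod.intCast_eq_intCast_iff_dvd_sub p q n).1 h
  exact ⟨t, by omega⟩

theorem drift_hat {n k : ℕ} [NeZero n] (hn : 2 * k + 1 ≤ n) {x : ZMod n → Bool} (hx : x ∈ X n k) :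
    Drift n (hat x) := by
  refine ⟨by omega, fun i => by simp [hat], fun a => ?_⟩
  have h1 : bal (hat x) a (a + n) = ∑ i, if x i = true then (1 : ℤ) else -1 :=
    sum_Ico_intCast (fun i => if x i = true then (1 : ℤ) else -1) a
  have h2 : ∀ i, (if x i = true then (1 : ℤ) else -1) = 2 * (if x i = true then 1 else 0) - 1 :=
    fun i => by split_ifs <;> norm_num
  have h3 : {i | x i = true}.ncard = (Finset.univ.filter fun i => x i = true).card := by
    rw [← Set.ncard_coe_finset]
    congr 1
    ext i
    simp
  have h4 : {i | x i = true}.ncard = k := hx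
  rw [h1, Finset.sum_congr rfl fun i _ => h2 i, Finset.sum_sub_distrib, ← Finset.mul_sum,
    Finset.sum_boole, ← h3, h4]
  simp
  omega

theorem matched_iff {n : ℕ} {x : ZMod n → Bool} (hd : Drift n (hat x)) (p : ℤ) :
    IsUp x p ∨ IsDown x p ↔ ¬ Flat (hat x) p := by
  have hup : IsUp x p ↔ hat x p = true :=
    ⟨fun ⟨j, hj⟩ => hj.2.1, fun h => exists_isMatch_of_drift h (by omega) (hd.bal_lt p)⟩
  rw [hup, isDown_iff]
  constructor
  · rintro (h | h) hf
    · rw [hf.bit] at h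
      simp at h
    · exact h.2 hf
  · intro h
    cases hw : hat x p <;> simp [h]

theorem f_apply {n : ℕ} {x : ZMod n → Bool} (hd : Drift n (hat x)) (i : ZMod n) :
    f x i = true ↔ x i = false ∧ ∃ p : ℤ, (p : ZMod n) = i ∧ ¬ Flat (hat x) p := by
  have e : (∃ p : ℤ, (p : ZMod n) = i ∧ (IsUp x p ∨ IsDown x p)) ↔
      ∃ p : ℤ, (p : ZMod n) = i ∧ ¬ Flat (hat x) p :=
    exists_congr fun p => and_congr_right fun _ => matched_iff hd p
  unfold f
  split_ifs with h <;> rw [e] at h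
  · simp [h]
  · simp only [h, and_false, iff_false, Bool.not_eq_true]
    obtain ⟨p, rfl⟩ := ZMod.intCast_surjective i
    push Not at h
    exact (h p rfl).bit

theorem evolves_f {n : ℕ} {x : ZMod n → Bool} (hd : Drift n (hat x))
    (hd' : Drift n (hat (f x))) : Evolves n (hat x) (hat (f x)) := by
  refine ⟨hd, hd', fun p => ?_⟩
  rw [hat, f_apply hd]
  refine and_congr_right fun _ => ⟨?_, fun h => ⟨p, rfl, h⟩⟩
  rintro ⟨p', e, h⟩
  obtain ⟨t, rfl⟩ := exists_eq_add_of_intCast_eq e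
  rwa [hd.flat_add_iff]

/-! ### The speed set -/

section

variable {n : ℕ} {x : ZMod n → Bool}

/-- A glider in the class `c` has a step at a position in the class `i` modulo `n`. -/
def ClassHasStep (c : GliderClass x) (i : ZMod n) : Prop :=
  ∃ γ : gliders x, (⟦γ⟧ : GliderClass x) = c ∧ ∃ p : ℤ, HasStep γ.1 p ∧ (p : ZMod n) = i

theorem classHasStep_mk {γ : gliders x} {i : ZMod n} :
    ClassHasStep (⟦γ⟧ : GliderClass x) i ↔ ∃ p : ℤ, HasStep γ.1 p ∧ (p : ZMod n) = i := by
  refine ⟨?_, fun h => ⟨γ, rfl, h⟩⟩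
  have hres : ∀ δ : gliders x, (∃ p : ℤ, HasStep δ.1 p ∧ (p : ZMod n) = i) ↔
      i ∈ δ.1.1.image (fun i : ℤ => (i : ZMod n)) ∨ i ∈ δ.1.2.image (fun i : ℤ => (i : ZMod n)) :=
    fun δ => by simp only [HasStep, Finset.mem_image, or_and_right, exists_or]
  rintro ⟨δ, e, h⟩
  have e' := Setoid.ker_def.1 (Quotient.exact e)
  simp only [Prod.mk.injEq] at e'
  rw [hres] at h ⊢
  rwa [← e'.1, ← e'.2]

/-- Gliders with steps at positions that agree modulo `n` are equivalent. -/
theorem ClassHasStep.unique (hd : Drift n (hat x)) {c c' : GliderClass x} {i : ZMod n}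
    (h : ClassHasStep c i) (h' : ClassHasStep c' i) : c = c' := by
  obtain ⟨⟨γ, hγ⟩, rfl, p, hp, rfl⟩ := h
  obtain ⟨⟨γ', hγ'⟩, rfl, p', hp', e⟩ := h'
  obtain ⟨t, rfl⟩ := exists_eq_add_of_intCast_eq e.symm
  obtain ⟨c, ec, hc⟩ := exists_isChain hd hγ
  have hp2 : HasStep γ p := hp
  rw [ec] at hp2
  obtain ⟨i, hi, rfl⟩ := hasStep_chainGlider.1 hp2
  have e2 := glider_eq_of_hasStep hd (shift_mem_gliders hd hc (ec ▸ hγ) t) hγ'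
    (hasStep_chainGlider.2 ⟨i, hi, rfl⟩) hp'
  have hres : ∀ v, (((chainGlider v c).1.image (fun i : ℤ => (i : ZMod n)),
      (chainGlider v c).2.image (fun i : ℤ => (i : ZMod n))) : Finset (ZMod n) × Finset (ZMod n)) =
      ((chainGlider v fun i => c i + n * t).1.image (fun i : ℤ => (i : ZMod n)),
        (chainGlider v fun i => c i + n * t).2.image (fun i : ℤ => (i : ZMod n))) := fun v => by
    simp only [chainGlider, Finset.image_image, Function.comp_def, Int.cast_add, Int.cast_mul,
      Int.cast_natCast, CharP.cast_eq_zero, zero_mul, add_zero]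
  have := hres (speed γ)
  rw [← ec, e2] at this
  exact Quotient.sound (Setoid.ker_def.2 this)

/-- Different steps of a glider are at different positions modulo `n`. -/
theorem eq_of_hasStep_of_intCast_eq (hd : Drift n (hat x)) {γ : Glider} (hγ : γ ∈ gliders x)
    {p p' : ℤ} (hp : HasStep γ p) (hp' : HasStep γ p') (e : (p : ZMod n) = p') : p = p' := by
  obtain ⟨q, r, hP, h⟩ := (mem_gliders_iff hd).1 hγ
  have h1 := h.hasStep_mem p hp
  have h2 := h.hasStep_mem p' hp'
  have h3 := hP.length_le hd
  obtain ⟨t, rfl⟩ := exists_eq_add_of_intCast_eq e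
  have : t = 0 := by
    by_contra h0
    rcases lt_or_gt_of_ne h0 with h | h <;> nlinarith
  simp [this]

/-- A chain of a glider of speed `v` has exactly `v` steps with a given bit. -/
theorem IsChain.card_bit {σ : ℤ → ℕ} {w : ℤ → Bool} {v : ℕ} {c : ℕ → ℤ} (h : IsChain σ w v c)
    (b : Bool) : ((Finset.range (2 * v)).filter fun i => w (c i) = b).card = v := by
  have hl : ∀ i < v, w (c i) = w (c 0) := fun i hi => (h.colour i hi).1
  have hr : ∀ i, v ≤ i → i < 2 * v → w (c i) = !(w (c 0)) := fun i hi hi' => by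
    have := (h.colour (i - v) (by omega)).2
    rwa [Nat.add_sub_cancel' hi] at this
  by_cases hb : w (c 0) = b
  · have : (Finset.range (2 * v)).filter (fun i => w (c i) = b) = Finset.range v := by
      ext i
      simp only [Finset.mem_filter, Finset.mem_range]
      refine ⟨fun ⟨h1, h2⟩ => ?_, fun h1 => ⟨by omega, by rw [hl i h1, hb]⟩⟩
      by_contra hc
      rw [hr i (by omega) h1, hb] at h2
      simp at h2
    rw [this, Finset.card_range]
  · have : (Finset.range (2 * v)).filter (fun i => w (c i) = b) = Finset.Ico v (2 * v) := by
      ext i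
      simp only [Finset.mem_filter, Finset.mem_range, Finset.mem_Ico]
      refine ⟨fun ⟨h1, h2⟩ => ⟨?_, h1⟩, fun ⟨h1, h2⟩ => ⟨h2, ?_⟩⟩
      · by_contra hc
        rw [hl i (by omega)] at h2
        exact hb h2
      · rw [hr i h1 h2]
        cases b <;> simpa using hb
    rw [this, Nat.card_Ico]
    omega

variable [NeZero n]

open Classical in
/-- The matched positions with bit `b` modulo `n`. -/
noncomputable def matched (x : ZMod n → Bool) (b : Bool) : Finset (ZMod n) :=
  Finset.univ.filter fun i => x i = b ∧ ∃ p : ℤ, (p : ZMod n) = i ∧ ¬ Flat (hat x) p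

/-- Double counting of incidences: a class of speed `v` covers `v` matched positions with bit `b`,
and every matched position lies in exactly one class. -/
theorem sum_V (hd : Drift n (hat x)) (b : Bool) : (V x).sum = (matched x b).card := by
  classical
  have h := Finset.sum_card_bipartiteAbove_eq_sum_card_bipartiteBelow
    (s := (Finset.univ : Finset (GliderClass x))) (t := matched x b) ClassHasStep
  rw [Finset.sum_congr (s₁ := matched x b) (g := fun _ => 1) rfl fun i hi => ?_] at h
  · rw [Finset.sum_const, smul_eq_mul, mul_one] at h
    rw [← h]
    refine Finset.sum_congr rfl fun c _ => ?_
    induction c using Quotient.inductionOn with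
    | h γ =>
      obtain ⟨γ, hγ⟩ := γ
      obtain ⟨c, e, hc⟩ := exists_isChain hd hγ
      have hsp : classSpeed (⟦⟨γ, hγ⟩⟧ : GliderClass x) = speed γ := rfl
      rw [hsp]
      conv_lhs => rw [← hc.card_bit b]
      have hstep : ∀ i < 2 * speed γ, HasStep γ (c i) := fun i hi => by
        rw [e]
        exact hasStep_chainGlider.2 ⟨i, hi, rfl⟩
      rw [← Finset.card_image_of_injOn (f := fun i => ((c i : ℤ) : ZMod n))]
      · congr 1
        ext z
        simp only [Finset.mem_image, Finset.mem_filter, Finset.mem_range,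
          Finset.mem_bipartiteAbove, classHasStep_mk, matched, Finset.mem_univ, true_and]
        constructor
        · rintro ⟨i, ⟨hi, hb⟩, rfl⟩
          exact ⟨⟨hb, _, rfl, not_flat_of_hasStep hd hγ (hstep i hi)⟩, _, hstep i hi, rfl⟩
        · rintro ⟨⟨hb, -⟩, p, hp, rfl⟩
          rw [e] at hp
          obtain ⟨i, hi, rfl⟩ := hasStep_chainGlider.1 hp
          exact ⟨i, ⟨hi, hb⟩, rfl⟩
      · intro i hi j hj hij
        simp only [Finset.coe_filter, Finset.mem_range, Set.mem_ofPred_eq] at hi hj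
        exact hc.injOn hi.1 hj.1
          (eq_of_hasStep_of_intCast_eq hd hγ (hstep i hi.1) (hstep j hj.1) hij)
  · simp only [matched, Finset.mem_filter, Finset.mem_univ, true_and] at hi
    obtain ⟨-, p, rfl, hp⟩ := hi
    obtain ⟨γ, hγ, hs⟩ := exists_glider hd hp
    have hcl : ClassHasStep (⟦⟨γ, hγ⟩⟧ : GliderClass x) (p : ZMod n) := ⟨_, rfl, p, hs, rfl⟩
    refine Finset.card_eq_one.2 ⟨_, Finset.eq_singleton_iff_unique_mem.2
      ⟨by simpa [Finset.mem_bipartiteBelow] using hcl, fun c hc => ?_⟩⟩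
    rw [Finset.mem_bipartiteBelow] at hc
    exact hc.2.unique hd hcl

-- A class of speed `v` has exactly one mark with bit `b` modulo `n`, so incidence is a bijection
-- between classes and marks.
open Classical in
theorem count_V (hd : Drift n (hat x)) (v : ℕ) (b : Bool) : (V x).count v =
    (Finset.univ.filter fun i : ZMod n => ∃ p ∈ gliderMarks x v b, (p : ZMod n) = i).card := by
  set M := Finset.univ.filter fun i : ZMod n => ∃ p ∈ gliderMarks x v b, (p : ZMod n) = i with hM
  have hV : (V x).count v =
      ((Finset.univ : Finset (GliderClass x)).filter fun c => v = classSpeed c).card := by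
    rw [V, Multiset.count_map]
    rfl
  rw [hV]
  have := Finset.card_mul_eq_card_mul
    (s := (Finset.univ : Finset (GliderClass x)).filter fun c => v = classSpeed c) (t := M)
    ClassHasStep (m := 1) (n := 1) ?_ ?_
  · simpa using this
  · intro c hcl
    induction c using Quotient.inductionOn with
    | h γ =>
      obtain ⟨γ, hγ⟩ := γ
      obtain rfl : v = speed γ := (Finset.mem_filter.1 hcl).2
      obtain ⟨c, e, hc⟩ := exists_isChain hd hγ
      have hv := hc.pos
      have hrep : ∀ p, HasStep γ p → Mark n (hat x) (speed γ) p → hat x p = b →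
          IsRep x (speed γ) b (c 0) p := by
        intro p hp hm hb
        rw [e] at hp
        obtain ⟨i, hi, rfl⟩ := hasStep_chainGlider.1 hp
        exact ⟨c, by rwa [← e], hc, rfl, (hc.seat_lt (hc.mono (Nat.zero_le i) hi)
          (hc.mono (by omega) (by omega))).2.1 hm, hb⟩
      have hex : ∃ q, HasStep γ q ∧ Mark n (hat x) (speed γ) q ∧ hat x q = b := by
        have h4 := (hc.colour 0 (by omega)).2
        simp only [add_zero] at h4
        by_cases hb : hat x (c 0) = b
        · exact ⟨c 0, by rw [e]; exact hasStep_chainGlider.2 ⟨0, by omega, rfl⟩, hc.mark.1, hb⟩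
        · refine ⟨c (speed γ), ?_, hc.mark.2, ?_⟩
          · rw [e]
            exact hasStep_chainGlider.2 ⟨speed γ, by omega, by rw [← e]⟩
          · rw [h4]
            cases b <;> simpa using hb
      obtain ⟨q, hq, hqm, hqb⟩ := hex
      refine Finset.card_eq_one.2 ⟨(q : ZMod n), Finset.eq_singleton_iff_unique_mem.2 ⟨?_, ?_⟩⟩
      · rw [Finset.mem_bipartiteAbove, classHasStep_mk, hM, Finset.mem_filter]
        exact ⟨⟨Finset.mem_univ _, q, ⟨hqm, hqb, γ, hγ, rfl, hq⟩, rfl⟩, q, hq, rfl⟩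
      · intro i hi
        rw [Finset.mem_bipartiteAbove, classHasStep_mk, hM, Finset.mem_filter] at hi
        obtain ⟨⟨-, p, hp, rfl⟩, p', hp', e'⟩ := hi
        obtain ⟨t, rfl⟩ := exists_eq_add_of_intCast_eq e'.symm
        have := (hrep _ hp' (hp.1.add hd t) (by rw [hd.periodic_mul]; exact hp.2.1)).unique
          (hrep q hq hqm hqb)
        rw [← e', this]
  · intro i hi
    obtain ⟨-, p, hp, rfl⟩ := Finset.mem_filter.1 hi
    obtain ⟨γ, hγ, rfl, hs⟩ := hp.2.2
    have hcl : ClassHasStep (⟦⟨γ, hγ⟩⟧ : GliderClass x) (p : ZMod n) := ⟨_, rfl, p, hs, rfl⟩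
    refine Finset.card_eq_one.2 ⟨⟦⟨γ, hγ⟩⟧, Finset.eq_singleton_iff_unique_mem.2 ⟨?_, fun c hc => ?_⟩⟩
    · rw [Finset.mem_bipartiteBelow, Finset.mem_filter]
      exact ⟨⟨Finset.mem_univ _, rfl⟩, hcl⟩
    · rw [Finset.mem_bipartiteBelow] at hc
      exact hc.2.unique hd hcl

theorem pos_of_mem_V (hd : Drift n (hat x)) {v : ℕ} (hv : v ∈ V x) : 0 < v := by
  obtain ⟨c, -, rfl⟩ := Multiset.mem_map.1 hv
  induction c using Quotient.inductionOn with
  | h γ =>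
    obtain ⟨c, -, hc⟩ := exists_isChain hd γ.2
    exact hc.pos

theorem sum_V_eq {k : ℕ} (hn : 2 * k + 1 ≤ n) (hx : x ∈ X n k) : (V x).sum = k := by
  classical
  have hd := drift_hat hn hx
  have hx' : {i | x i = true}.ncard = k := hx
  rw [sum_V hd true, ← hx', ← Set.ncard_coe_finset]
  congr 1
  ext i
  simp only [matched, Finset.coe_filter, Finset.mem_univ, true_and, Set.mem_ofPred_eq,
    and_iff_left_iff_imp]
  intro hi
  obtain ⟨p, rfl⟩ := ZMod.intCast_surjective i
  refine ⟨p, rfl, fun hf => ?_⟩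
  have : hat x p = true := hi
  rw [hf.bit] at this
  simp at this

/-- The 1s of `f x` are the matched 0s of `x`, and `sum_V` applied to both bits shows that these are
as many as the 1s of `x`. -/
theorem f_mem_X {k : ℕ} (hn : 2 * k + 1 ≤ n) (hx : x ∈ X n k) : f x ∈ X n k := by
  classical
  have hd := drift_hat hn hx
  have h : {i | f x i = true}.ncard = k := by
    rw [← sum_V_eq hn hx, sum_V hd false, ← Set.ncard_coe_finset]
    congr 1
    ext i
    simp [matched, f_apply hd]
  exact h

/-- Gliders are counted by their marks with bit 0 in `x` and by their marks with bit 1 in `f x`. -/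
theorem V_f_eq {k : ℕ} (hn : 2 * k + 1 ≤ n) (hx : x ∈ X n k) : V (f x) = V x := by
  have hd := drift_hat hn hx
  have h := evolves_f hd (drift_hat hn (f_mem_X hn hx))
  ext v
  rw [count_V hd v false, count_V h.drift' v true, h.gliderMarks_eq v]

theorem Z_f_eq {k : ℕ} (hn : 2 * k + 1 ≤ n) (hx : x ∈ X n k) : Z (f x) = Z x := by
  have hd := drift_hat hn hx
  have h := evolves_f hd (drift_hat hn (f_mem_X hn hx))
  ext z
  simp only [Z, Set.mem_ofPred_eq, V_f_eq hn hx, h.trainSizes_eq]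

theorem iterate_f {k : ℕ} (hn : 2 * k + 1 ≤ n) (hx : x ∈ X n k) (t : ℕ) :
    f^[t] x ∈ X n k ∧ V (f^[t] x) = V x ∧ Z (f^[t] x) = Z x := by
  induction t with
  | zero => exact ⟨hx, rfl, rfl⟩
  | succ t ih =>
    obtain ⟨h1, h2, h3⟩ := ih
    rw [Function.iterate_succ_apply']
    exact ⟨f_mem_X hn h1, (V_f_eq hn h1).trans h2, (Z_f_eq hn h1).trans h3⟩

end

end KneserGliders

theorem mainTheorem7 (n k : ℕ) [NeZero n] (hn : 2 * k + 1 ≤ n) (x : ZMod n → Bool)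
    (hx : x ∈ KneserGliders.X n k) :
    ((∀ v ∈ KneserGliders.V x, 0 < v) ∧ (KneserGliders.V x).sum = k) ∧
      ∀ y ∈ KneserGliders.cycle x,
        KneserGliders.V y = KneserGliders.V x ∧ KneserGliders.Z y = KneserGliders.Z x := by
  refine ⟨⟨fun v hv => KneserGliders.pos_of_mem_V (KneserGliders.drift_hat hn hx) hv,
    KneserGliders.sum_V_eq hn hx⟩, ?_⟩
  rintro y ⟨t, rfl⟩
  exact (KneserGliders.iterate_f hn hx t).2
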